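/- Let $X$ be a compact $C^\infty$ manifold without boundary of dimension $n$, with a smooth Riemannian metric and a fixed smooth positive density $dx$, and let $\varphi_t=\exp tV$ be a $C^\infty$ Anosov flow on $X$ generated by a vector field $V\in C^\infty(X;TX)$; that is, there is a continuous $d\varphi_t$-invariant splitting $T_xX=E_0(x)\oplus E_s(x)\oplus E_u(x)$ with $E_0(x)=\mathbb R V(x)$, and there are constants $C_0$ and $\theta>0$ such that $|d\varphi_t(x)v|\le C_0e^{-\theta|t|}|v|$ for $v\in E_u(x)$, $t<0$, and for $v\in E_s(x)$, $t>0$. Let $d$ be the Riemannian distance (points in different components being at infinite distance), let $\psi\in C_c^\infty(\mathbb R;[0,1])$ be equal to $1$ near $0$, and for $0<\varepsilon\le 1$ put $$E_\varepsilon u(x)=\int_X E_\varepsilon(x,y)\,u(y)\,dy,\qquad E_\varepsilon(x,y)=\frac1{F_\varepsilon(x)}\,\psi\Big(\frac{d(x,y)}{\varepsilon}\Big),\qquad F_\varepsilon(x)=\int_X\psi\Big(\frac{d(x,y)}{\varepsilon}\Big)\,dy,$$ where $\psi(\infty):=0$, so that $E_\varepsilon 1=1$. Let $\varphi_t^*u=u\circ\varphi_t$.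 Then $E_\varepsilon$ and $\varphi_t^*$ are bounded operators on $L^2(X,dx)$, the operators $E_\varepsilon\varphi_{-t}^*E_\varepsilon$ have a trace, and for every $t_0>0$ there is a constant $C>0$ such that for all $\varepsilon\in(0,1]$ and all $T\ge t_0$ $$\|E_\varepsilon\varphi_{-T}^*E_\varepsilon\|_{\mathrm{tr}}\le Ce^{CT}\varepsilon^{-n-2}\qquad\text{and}\qquad\int_T^{T+1}\big|\mathrm{tr}\,E_\varepsilon\varphi_{-t}^*E_\varepsilon\big|\,dt\le Ce^{CT},$$ the integrand being integrable. Here $\|\cdot\|_{\mathrm{tr}}$ is the trace norm and $\mathrm{tr}$ the trace of operators on $L^2(X,dx)$. -/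

import Mathlib

open MeasureTheory Set Filter Topology Bundle
open scoped ENNReal Manifold ContDiff InnerProductSpace

namespace FlatTrace

noncomputable section

section Dynamics

variable {n : ℕ} {X : Type*} [TopologicalSpace X] [ChartedSpace (EuclideanSpace ℝ (Fin n)) X]

/-- `μ` is a smooth positive density on `X`: in each of the charts `chartAt x` it has a smooth
positive density `ρ` with respect to Lebesgue measure. -/
def IsSmoothDensity [MeasurableSpace X] (μ : Measure X) : Prop :=
  ∀ x : X, ∃ ρ : EuclideanSpace ℝ (Fin n) → ℝ,
    ContDiffOn ℝ ∞ ρ (chartAt (EuclideanSpace ℝ (Fin n)) x).target ∧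
    (∀ z ∈ (chartAt (EuclideanSpace ℝ (Fin n)) x).target, 0 < ρ z) ∧
    ∀ s ⊆ (chartAt (EuclideanSpace ℝ (Fin n)) x).source, MeasurableSet s →
      μ s = ∫⁻ z in chartAt (EuclideanSpace ℝ (Fin n)) x '' s, ENNReal.ofReal (ρ z)

/-- `φ` is the (complete, smooth) flow `exp (tV)` of the smooth vector field `V`. -/
structure IsSmoothFlow [IsManifold (𝓡 n) ∞ X]
    (V : (x : X) → TangentSpace (𝓡 n) x) (φ : ℝ → X → X) : Prop where
  smooth_field : ContMDiff (𝓡 n) (𝓡 n).tangent ∞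
    (fun x => (⟨x, V x⟩ : TangentBundle (𝓡 n) X))
  smooth_flow : ContMDiff (𝓘(ℝ, ℝ).prod (𝓡 n)) (𝓡 n) ∞ (fun p : ℝ × X => φ p.1 p.2)
  zero : ∀ x, φ 0 x = x
  add : ∀ s t x, φ (s + t) x = φ s (φ t x)
  integralCurve : ∀ x, IsMIntegralCurve (fun t => φ t x) V

/-- `T_x X = E₀ x ⊕ E₁ x ⊕ E₂ x` for every `x`, and the decomposition is continuous, that is,
the three projections that it defines are continuous maps of the tangent bundle. -/
def IsContinuousSplitting [IsManifold (𝓡 n) ∞ X]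
    (E₀ E₁ E₂ : (x : X) → Submodule ℝ (TangentSpace (𝓡 n) x)) : Prop :=
  (∀ x, DirectSum.IsInternal ![E₀ x, E₁ x, E₂ x]) ∧
  ∃ P₀ P₁ P₂ : (x : X) → TangentSpace (𝓡 n) x →ₗ[ℝ] TangentSpace (𝓡 n) x,
    (∀ x v, P₀ x v ∈ E₀ x ∧ P₁ x v ∈ E₁ x ∧ P₂ x v ∈ E₂ x ∧
      P₀ x v + P₁ x v + P₂ x v = v) ∧
    Continuous (fun w : TangentBundle (𝓡 n) X =>
      (⟨w.proj, P₀ w.proj w.snd⟩ : TangentBundle (𝓡 n) X)) ∧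
    Continuous (fun w : TangentBundle (𝓡 n) X =>
      (⟨w.proj, P₁ w.proj w.snd⟩ : TangentBundle (𝓡 n) X)) ∧
    Continuous (fun w : TangentBundle (𝓡 n) X =>
      (⟨w.proj, P₂ w.proj w.snd⟩ : TangentBundle (𝓡 n) X))

/-- The flow `φ` of `V` is Anosov. The norms `‖·‖` on the tangent spaces are those of the
Riemannian metric of `X`. -/
def IsAnosov [IsManifold (𝓡 n) ∞ X] [RiemannianBundle (fun x : X => TangentSpace (𝓡 n) x)]
    (V : (x : X) → TangentSpace (𝓡 n) x) (φ : ℝ → X → X) : Prop :=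
  ∃ E₀ Es Eu : (x : X) → Submodule ℝ (TangentSpace (𝓡 n) x),
    IsContinuousSplitting E₀ Es Eu ∧
    (∀ x, E₀ x = Submodule.span ℝ {V x}) ∧
    (∀ t x,
      (E₀ x).map (mfderiv (𝓡 n) (𝓡 n) (φ t) x).toLinearMap = E₀ (φ t x) ∧
      (Es x).map (mfderiv (𝓡 n) (𝓡 n) (φ t) x).toLinearMap = Es (φ t x) ∧
      (Eu x).map (mfderiv (𝓡 n) (𝓡 n) (φ t) x).toLinearMap = Eu (φ t x)) ∧
    ∃ C θ : ℝ, 0 < θ ∧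
      (∀ x, ∀ v ∈ Eu x, ∀ t < 0,
        ‖mfderiv (𝓡 n) (𝓡 n) (φ t) x v‖ ≤ C * Real.exp (-θ * |t|) * ‖v‖) ∧
      (∀ x, ∀ v ∈ Es x, ∀ t > 0,
        ‖mfderiv (𝓡 n) (𝓡 n) (φ t) x v‖ ≤ C * Real.exp (-θ * |t|) * ‖v‖)

end Dynamics

section Mollifiers

variable {X : Type*} [EMetricSpace X]

open Classical in
/-- The function `ψ (d (x, y) / ε)`, where `d` is the distance of `X`. It is zero if `x` and `y` are
at infinite distance (in different components of a manifold). -/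
def cutoff (ψ : ℝ → ℝ) (ε : ℝ) (x y : X) : ℝ :=
  if edist x y = ⊤ then 0 else ψ ((edist x y).toReal / ε)

variable [MeasurableSpace X]

/-- The normalizing factor `F_ε`, that is, the one for which `E_ε 1 = 1`. -/
def mollifierNorm (μ : Measure X) (ψ : ℝ → ℝ) (ε : ℝ) (x : X) : ℝ :=
  ∫ y, cutoff ψ ε x y ∂μ

/-- The kernel `E_ε (x, y) = F_ε (x)⁻¹ ψ (d (x, y) / ε)`. -/
def mollifierKernel (μ : Measure X) (ψ : ℝ → ℝ) (ε : ℝ) (x y : X) : ℝ :=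
  1 / mollifierNorm μ ψ ε x * cutoff ψ ε x y

end Mollifiers

section Operators

variable {X : Type*} [MeasurableSpace X]

/-- `A` is the integral operator `u ↦ ∫ K (x, y) u y dμ(y)` on `L²(X, μ)`. -/
def IsIntegralOperator (μ : Measure X) (K : X → X → ℝ)
    (A : Lp ℂ 2 μ →L[ℂ] Lp ℂ 2 μ) : Prop :=
  ∀ u : Lp ℂ 2 μ, A u =ᵐ[μ] fun x => ∫ y, (K x y : ℂ) * u y ∂μ

/-- `A` is the pullback operator `u ↦ u ∘ f` on `L²(X, μ)`. -/
def IsPullback (μ : Measure X) (f : X → X) (A : Lp ℂ 2 μ →L[ℂ] Lp ℂ 2 μ) : Prop :=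
  ∀ u : Lp ℂ 2 μ, A u =ᵐ[μ] fun x => u (f x)

end Operators

section Trace

variable {H : Type*} [NormedAddCommGroup H] [InnerProductSpace ℂ H]

/-- The trace norm of a bounded operator: the supremum of `∑ |⟪f i, A (e i)⟫|` over all pairs of
(finite) orthonormal systems with the same index set. `A` is of trace class if it is finite. -/
def traceNorm (A : H →L[ℂ] H) : ℝ≥0∞ :=
  ⨆ (m : ℕ) (e : Fin m → H) (f : Fin m → H) (_ : Orthonormal ℂ e) (_ : Orthonormal ℂ f),
    ∑ i, ‖⟪f i, A (e i)⟫_ℂ‖ₑ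

/-- `z` is the trace of `A`: for every Hilbert basis `b` the series `∑ ⟪b i, A (b i)⟫` converges
(unconditionally) to `z`. -/
def HasTrace (A : H →L[ℂ] H) (z : ℂ) : Prop :=
  ∀ (w : Set H) (b : HilbertBasis w ℂ H), HasSum (fun i => ⟪b i, A (b i)⟫_ℂ) z

end Trace

end

end FlatTrace

set_option linter.unusedSectionVars false

/-! Let K be the kernel of E_ε. The trace of E_ε φ_{-t}^* E_ε is the double integral of K(φ_{-t} x,
y) K(y, x) (`hasTrace_isIntegralOperator_comp`). Since K is O(ε^{-n}) and lives within O(ε) of the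
diagonal, the trace is at most a constant times ε^{-n} times the measure of the points with d(x,
φ_{-t} x) = O(ε) (`abs_integral_integral_kernel_le`). So the heart of the matter is a volume bound:
the pairs (t, x) with t in [T, T + 1] and d(x, φ_t x) ≤ ε have measure O(e^{CT} ε^n)
(`IsAnosov.exists_measure_return_le`).

Take two such pairs (t, y) and (t', y') at distance at most a multiple of e^{-LT}, and put s = t' -
t and w = y' - y in a chart. A Taylor expansion with constants exponential in T
(`FiniteAtlas.exists_flow_taylor`) shows that s V + dφ_t w - w is O(ε), up to a small multiple of
|s| + |w|. For large T the map dφ_t expands E_u and contracts E_s by a factor of at least two, so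
dφ_t - 1 controls both components of w, while the flow component of the equation controls s. Only
the component of w along V stays free, and a functional ℓ with ℓ(V) ≠ 0 detects it
(`IsHyperbolicSplitting.exists_chart_estimate`). Hence |s| + |w| ≤ K (|ℓ(w)| + ε)
(`IsAnosov.exists_separation`). At scale e^{-LT} the set thus behaves like an O(ε)-tube around a
curve in dimension n + 1, and double counting gives the volume bound
(`exists_measure_le_of_separated`). Smaller T ≥ t₀ reduce to large ones, because N-fold iteration
turns a near return at time t into one at time N t.

The trace norm is at most ‖φ_{-T}^*‖ times a bound for the squared Hilbert-Schmidt norms of E_ε and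
its adjoint, hence O(e^{CT} ε^{-n}) (`traceNorm_isIntegralOperator_comp_le`). -/

namespace FlatTrace

noncomputable section

/-! ### Derivatives of charts on tangent spaces -/

section Charts

variable {n : ℕ} {X : Type*} [EMetricSpace X] [ChartedSpace (EuclideanSpace ℝ (Fin n)) X]
  [IsManifold (𝓡 n) ∞ X]

/-- The derivative of the chart at `x` at the point `y`, as a map to the model space. -/
def chartDeriv (x y : X) : TangentSpace (𝓡 n) y →L[ℝ] EuclideanSpace ℝ (Fin n) :=
  (trivializationAt (EuclideanSpace ℝ (Fin n)) (TangentSpace (𝓡 n)) x).continuousLinearMapAt ℝ y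

/-- The inverse of `chartDeriv`. -/
def chartDerivSymm (x y : X) : EuclideanSpace ℝ (Fin n) →L[ℝ] TangentSpace (𝓡 n) y :=
  (trivializationAt (EuclideanSpace ℝ (Fin n)) (TangentSpace (𝓡 n)) x).symmL ℝ y

lemma chartDeriv_symm {x y : X} (hy : y ∈ (extChartAt (𝓡 n) x).source)
    (v : EuclideanSpace ℝ (Fin n)) : chartDeriv x y (chartDerivSymm x y v) = v := by
  rw [extChartAt_source] at hy
  exact Trivialization.continuousLinearMapAt_symmL _ (by simpa using hy) v

lemma chartDerivSymm_chartDeriv {x y : X} (hy : y ∈ (extChartAt (𝓡 n) x).source)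
    (w : TangentSpace (𝓡 n) y) : chartDerivSymm x y (chartDeriv x y w) = w := by
  rw [extChartAt_source] at hy
  exact Trivialization.symmL_continuousLinearMapAt _ (by simpa using hy) w

lemma hasMFDerivAt_extChartAt_chartDeriv {x y : X} (hy : y ∈ (extChartAt (𝓡 n) x).source) :
    HasMFDerivAt (𝓡 n) 𝓘(ℝ, EuclideanSpace ℝ (Fin n)) (extChartAt (𝓡 n) x) y
      (chartDeriv x y) := by
  rw [extChartAt_source] at hy
  have h := (mdifferentiableAt_extChartAt (I := 𝓡 n) hy).hasMFDerivAt
  rwa [← TangentBundle.continuousLinearMapAt_trivializationAt hy] at h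

lemma hasFDerivAt_extChartAt_comp {F : Type*} [NormedAddCommGroup F] [NormedSpace ℝ F]
    {f : F → X} {z : F} {f' : F →L[ℝ] TangentSpace (𝓡 n) (f z)} {x : X}
    (hf : HasMFDerivAt 𝓘(ℝ, F) (𝓡 n) f z f') (hx : f z ∈ (extChartAt (𝓡 n) x).source) :
    HasFDerivAt (fun a => extChartAt (𝓡 n) x (f a)) (chartDeriv x (f z) ∘L f') z :=
  ((hasMFDerivAt_extChartAt_chartDeriv hx).comp z hf).hasFDerivAt

end Charts

/-! ### Riemannian distance in charts and finite bi-Lipschitz atlases -/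

section LocalGeometry

variable {n : ℕ} {X : Type*} [EMetricSpace X] [ChartedSpace (EuclideanSpace ℝ (Fin n)) X]
  [IsManifold (𝓡 n) ∞ X] [RiemannianBundle (fun x : X => TangentSpace (𝓡 n) x)]
  [IsContinuousRiemannianBundle (EuclideanSpace ℝ (Fin n)) (fun x : X => TangentSpace (𝓡 n) x)]
  [IsRiemannianManifold (𝓡 n) X]

omit [IsRiemannianManifold (𝓡 n) X] in
lemma eventually_norm_chartDeriv_le (x : X) :
    ∃ C > 0, ∀ᶠ y in 𝓝 x, ∀ w : TangentSpace (𝓡 n) y, ‖chartDeriv x y w‖ ≤ C * ‖w‖ := by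
  obtain ⟨C, hC, h⟩ := eventually_norm_trivializationAt_lt (EuclideanSpace ℝ (Fin n))
    (fun x : X => TangentSpace (𝓡 n) x) x
  refine ⟨C, hC, h.mono fun y hy w => ?_⟩
  exact ContinuousLinearMap.le_of_opNorm_le _ hy.le w

omit [IsRiemannianManifold (𝓡 n) X] in
lemma eventually_norm_le_chartDeriv (x : X) :
    ∃ C > 0, ∀ᶠ y in 𝓝 x, ∀ w : TangentSpace (𝓡 n) y, ‖w‖ ≤ C * ‖chartDeriv x y w‖ := by
  obtain ⟨C, hC, h⟩ := eventually_norm_symmL_trivializationAt_lt (EuclideanSpace ℝ (Fin n))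
    (fun x : X => TangentSpace (𝓡 n) x) x
  refine ⟨C, hC, ?_⟩
  filter_upwards [h, extChartAt_source_mem_nhds (I := 𝓡 n) x] with y hy hs w
  have := ContinuousLinearMap.le_of_opNorm_le _ hy.le (chartDeriv x y w)
  rwa [← chartDerivSymm, chartDerivSymm_chartDeriv hs] at this

open Manifold

/-- Charts are locally Lipschitz for the Riemannian distance. -/
lemma exists_edist_extChartAt_le (x : X) :
    ∃ C : NNReal, ∃ U ∈ 𝓝 x, ∀ y ∈ U, ∀ y' ∈ U,
      edist (extChartAt (𝓡 n) x y) (extChartAt (𝓡 n) x y') ≤ C * edist y y' := by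
  obtain ⟨C, hC, h⟩ := eventually_norm_chartDeriv_le (n := n) x
  lift C to NNReal using hC.le
  obtain ⟨r, hr, hU⟩ := EMetric.mem_nhds_iff.1
    (inter_mem h (extChartAt_source_mem_nhds (I := 𝓡 n) x))
  have hr4 : 0 < r / 4 := ENNReal.div_pos hr.ne' (by simp)
  -- The quarter radius leaves room for connecting curves: those of length below r / 2 between
  -- points of the small ball stay in the ball of radius r, where the derivative bound holds.
  refine ⟨C, Metric.eball x (r / 4), Metric.eball_mem_nhds _ hr4, ?_⟩
  intro y hy y' hy'
  have hyy' : edist y y' < r / 2 := by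
    calc edist y y' ≤ edist y x + edist y' x := edist_triangle_right _ _ _
      _ < r / 4 + r / 4 := ENNReal.add_lt_add hy hy'
      _ = r / 2 := by
        rw [← ENNReal.add_div, ← two_mul, show (4 : ℝ≥0∞) = 2 * 2 by norm_num,
          ENNReal.mul_div_mul_left _ _ (by simp) (by simp)]
  -- The distance is an infimum of lengths that need not be attained, so the estimate is proved for
  -- each larger R, and R decreases to the distance at the end.
  have main : ∀ R ∈ Ioo (edist y y') (r / 2),
      edist (extChartAt (𝓡 n) x y) (extChartAt (𝓡 n) x y') ≤ C * R := by
    rintro R ⟨hR, hR2⟩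
    have hR' := hR
    rw [IsRiemannianManifold.out (I := 𝓡 n) y y'] at hR'
    obtain ⟨γ, hγ0, hγ1, hγ, hlen, -⟩ :=
      exists_lt_locally_constant_of_riemannianEDist_lt hR' zero_lt_one
    have hmem : ∀ t ∈ Icc (0 : ℝ) 1, γ t ∈ Metric.eball x r := by
      intro t ht
      have h1 : edist y (γ t) ≤ pathELength (𝓡 n) γ 0 t := by
        rw [IsRiemannianManifold.out (I := 𝓡 n) y (γ t)]
        exact riemannianEDist_le_pathELength hγ.contMDiffOn hγ0 rfl ht.1
      have h2 : pathELength (𝓡 n) γ 0 t ≤ pathELength (𝓡 n) γ 0 1 :=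
        pathELength_mono le_rfl ht.2
      have h3 : edist x y < r / 2 := by
        rw [edist_comm]
        exact lt_of_lt_of_le hy (ENNReal.div_le_div_left (by norm_num) _)
      rw [Metric.mem_eball, edist_comm]
      calc edist x (γ t) ≤ edist x y + edist y (γ t) := edist_triangle _ _ _
        _ < r / 2 + r / 2 := ENNReal.add_lt_add h3 ((h1.trans h2).trans_lt (hlen.trans hR2))
        _ = r := ENNReal.add_halves r
    have hd : ∀ t ∈ Icc (0 : ℝ) 1, HasDerivAt (fun s => extChartAt (𝓡 n) x (γ s))
        (chartDeriv x (γ t) (mfderiv 𝓘(ℝ, ℝ) (𝓡 n) γ t 1)) t := fun t ht =>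
      (hasFDerivAt_extChartAt_comp (x := x)
        (hγ.contMDiffAt.mdifferentiableAt one_ne_zero).hasMFDerivAt (hU (hmem t ht)).2).hasDerivAt
    have hcd : ContDiffOn ℝ 1 (fun s => extChartAt (𝓡 n) x (γ s)) (Icc 0 1) := by
      rw [← contMDiffOn_iff_contDiffOn]
      refine (contMDiffOn_extChartAt (I := 𝓡 n) (x := x)).comp hγ.contMDiffOn fun t ht => ?_
      have := (hU (hmem t ht)).2
      rwa [extChartAt_source] at this
    have h1 := enorm_sub_le_lintegral_derivWithin_Icc_of_contDiffOn_Icc hcd zero_le_one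
    rw [hγ0, hγ1] at h1
    rw [edist_comm, edist_eq_enorm_sub]
    refine h1.trans ?_
    calc _ ≤ ∫⁻ t in Icc (0 : ℝ) 1, C * ‖mfderiv 𝓘(ℝ, ℝ) (𝓡 n) γ t 1‖ₑ := by
          refine setLIntegral_mono' measurableSet_Icc fun t ht => ?_
          rw [(hd t ht).hasDerivWithinAt.derivWithin (uniqueDiffOn_Icc zero_lt_one t ht)]
          have := (hU (hmem t ht)).1 (mfderiv 𝓘(ℝ, ℝ) (𝓡 n) γ t 1)
          simp only [enorm]
          exact_mod_cast this
      _ = C * pathELength (𝓡 n) γ 0 1 := by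
          rw [lintegral_const_mul' _ _ ENNReal.coe_ne_top, pathELength_eq_lintegral_mfderiv_Icc]
      _ ≤ C * R := by gcongr
  have hne : (𝓝[>] (edist y y')).NeBot := nhdsGT_neBot_of_exists_gt ⟨_, hyy'⟩
  refine ge_of_tendsto (x := 𝓝[>] (edist y y')) (f := fun R => (C : ℝ≥0∞) * R) ?_ ?_
  · exact ((ENNReal.continuous_const_mul ENNReal.coe_ne_top).tendsto _).mono_left
      nhdsWithin_le_nhds
  · filter_upwards [Ioo_mem_nhdsGT hyy'] with R hR using main R hR

/-- The preimage of a straight segment in a chart ball is a curve whose speed is bounded by the norm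
of the inverse chart derivative, and its length bounds the distance. -/
lemma exists_edist_le_extChartAt (x : X) :
    ∃ C : NNReal, ∃ U ∈ 𝓝 x, ∀ y ∈ U, ∀ y' ∈ U,
      edist y y' ≤ C * edist (extChartAt (𝓡 n) x y) (extChartAt (𝓡 n) x y') := by
  obtain ⟨C, hC, h⟩ := eventually_norm_le_chartDeriv (n := n) x
  lift C to NNReal using hC.le
  have hmem := inter_mem h (extChartAt_source_mem_nhds (I := 𝓡 n) x)
  obtain ⟨r, hr, hU⟩ := Metric.mem_nhds_iff.1 (inter_mem
    (extChartAt_preimage_mem_nhds (I := 𝓡 n) hmem) (extChartAt_target_mem_nhds (I := 𝓡 n) x))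
  refine ⟨C, (extChartAt (𝓡 n) x) ⁻¹' Metric.ball (extChartAt (𝓡 n) x x) r ∩
    (extChartAt (𝓡 n) x).source, inter_mem ((continuousAt_extChartAt x).preimage_mem_nhds
      (Metric.ball_mem_nhds _ hr)) (extChartAt_source_mem_nhds (I := 𝓡 n) x), ?_⟩
  rintro y ⟨hy, hys⟩ y' ⟨hy', hys'⟩
  rw [IsRiemannianManifold.out (I := 𝓡 n) y y']
  set e := extChartAt (𝓡 n) x with he
  let η : ℝ → EuclideanSpace ℝ (Fin n) := fun t => e y + t • (e y' - e y)
  have hη : ∀ t ∈ Icc (0 : ℝ) 1, η t ∈ Metric.ball (e x) r := by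
    intro t ht
    exact (convex_ball (e x) r).add_smul_sub_mem hy hy' ht
  let γ : ℝ → X := fun t => e.symm (η t)
  have hγ : ContMDiffOn 𝓘(ℝ, ℝ) (𝓡 n) 1 γ (Icc 0 1) := by
    refine (contMDiffOn_extChartAt_symm x).comp (t := e.target) ?_ fun t ht => (hU (hη t ht)).2
    refine ContMDiff.contMDiffOn ?_
    rw [contMDiff_iff_contDiff]
    fun_prop
  refine (riemannianEDist_le_pathELength (a := 0) (b := 1) hγ
    (by simpa [γ, η] using e.left_inv hys) (by simpa [γ, η] using e.left_inv hys')
    zero_le_one).trans ?_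
  rw [pathELength_eq_lintegral_mfderiv_Ioo]
  have key : ∀ t ∈ Ioo (0 : ℝ) 1, ‖mfderiv 𝓘(ℝ, ℝ) (𝓡 n) γ t 1‖ₑ ≤ C * edist (e y) (e y') := by
    intro t ht
    have hU' := hU (hη t (Ioo_subset_Icc_self ht))
    have hd : HasMFDerivAt 𝓘(ℝ, ℝ) (𝓡 n) γ t (mfderiv 𝓘(ℝ, ℝ) (𝓡 n) γ t) :=
      ((hγ.contMDiffAt (Icc_mem_nhds ht.1 ht.2)).mdifferentiableAt one_ne_zero).hasMFDerivAt
    have h1 := (hasFDerivAt_extChartAt_comp (x := x) hd hU'.1.2).hasDerivAt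
    have h2 : HasDerivAt (fun a => e (γ a)) (e y' - e y) t := by
      have : HasDerivAt η (e y' - e y) t := by
        simpa [η] using ((hasDerivAt_id t).smul_const (e y' - e y)).const_add (e y)
      refine this.congr_of_eventuallyEq ?_
      filter_upwards [Icc_mem_nhds ht.1 ht.2] with s hs
      exact e.right_inv (hU (hη s hs)).2
    have h3 := h1.unique h2
    have h4 := hU'.1.1 (mfderiv 𝓘(ℝ, ℝ) (𝓡 n) γ t 1)
    have h5 : chartDeriv x (γ t) (mfderiv 𝓘(ℝ, ℝ) (𝓡 n) γ t 1) = e y' - e y := h3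
    change ‖mfderiv 𝓘(ℝ, ℝ) (𝓡 n) γ t 1‖ ≤
      C * ‖chartDeriv x (γ t) (mfderiv 𝓘(ℝ, ℝ) (𝓡 n) γ t 1)‖ at h4
    rw [h5] at h4
    rw [edist_comm, edist_eq_enorm_sub]
    simp only [enorm]
    exact_mod_cast h4
  calc _ ≤ ∫⁻ t in Ioo (0 : ℝ) 1, C * edist (e y) (e y') :=
        setLIntegral_mono' measurableSet_Ioo key
    _ = _ := by simp

variable (n X) in
/-- A finite family of charts of a compact Riemannian manifold, restricted to compact sets on which
they are bi-Lipschitz, and such that each point is well inside one of these sets. -/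
structure FiniteAtlas where
  /-- the centers of the charts -/
  s : Finset X
  /-- the compact sets -/
  K : X → Set X
  /-- the Lipschitz constant -/
  C : ℝ
  /-- each ball with this radius lies in one of the compact sets -/
  r : ℝ
  /-- each point has a ball with this radius around it in one of the charts -/
  ρ : ℝ
  one_le_C : 1 ≤ C
  r_pos : 0 < r
  ρ_pos : 0 < ρ
  isCompact : ∀ x ∈ s, IsCompact (K x)
  subset_source : ∀ x ∈ s, K x ⊆ (extChartAt (𝓡 n) x).source
  norm_sub_le : ∀ x ∈ s, ∀ y ∈ K x, ∀ y' ∈ K x, ∀ δ : ℝ, 0 ≤ δ → edist y y' ≤ ENNReal.ofReal δ →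
    ‖extChartAt (𝓡 n) x y' - extChartAt (𝓡 n) x y‖ ≤ C * δ
  edist_le : ∀ x ∈ s, ∀ y ∈ K x, ∀ y' ∈ K x,
    edist y y' ≤ ENNReal.ofReal (C * ‖extChartAt (𝓡 n) x y' - extChartAt (𝓡 n) x y‖)
  norm_chartDeriv_le : ∀ x ∈ s, ∀ y ∈ K x, ∀ w : TangentSpace (𝓡 n) y,
    ‖chartDeriv x y w‖ ≤ C * ‖w‖
  norm_le_chartDeriv : ∀ x ∈ s, ∀ y ∈ K x, ∀ w : TangentSpace (𝓡 n) y,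
    ‖w‖ ≤ C * ‖chartDeriv x y w‖
  exists_chart : ∀ y, ∃ x ∈ s, (∀ y', edist y y' < ENNReal.ofReal r → y' ∈ K x) ∧
    Metric.closedBall (extChartAt (𝓡 n) x y) ρ ⊆ extChartAt (𝓡 n) x '' K x

omit [IsManifold (𝓡 n) ∞ X] [RiemannianBundle (fun x : X => TangentSpace (𝓡 n) x)]
  [IsContinuousRiemannianBundle (EuclideanSpace ℝ (Fin n)) (fun x : X => TangentSpace (𝓡 n) x)]
  [IsRiemannianManifold (𝓡 n) X] in
-- `K` comes from a closed ball of radius R / 2 in the chart and `W` from the concentric ball of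
-- radius R / 4, so a uniform margin of R / 4 remains around the points of `W`.
lemma exists_compact_chart_nhds (x : X) {U : Set X} (hU : U ∈ 𝓝 x) :
    ∃ ρ > 0, ∃ K : Set X, IsCompact K ∧ K ⊆ U ∧ K ⊆ (extChartAt (𝓡 n) x).source ∧
      ∃ W : Set X, IsOpen W ∧ x ∈ W ∧ W ⊆ K ∧ ∀ y ∈ W,
        Metric.closedBall (extChartAt (𝓡 n) x y) ρ ⊆ extChartAt (𝓡 n) x '' K := by
  set e := extChartAt (𝓡 n) x with he
  obtain ⟨R, hR, hball⟩ := Metric.mem_nhds_iff.1 (inter_mem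
    (extChartAt_preimage_mem_nhds (I := 𝓡 n) hU) (extChartAt_target_mem_nhds (I := 𝓡 n) x))
  have hsub : Metric.closedBall (e x) (R / 2) ⊆ Metric.ball (e x) R :=
    Metric.closedBall_subset_ball (by linarith)
  refine ⟨R / 4, by positivity, e.symm '' Metric.closedBall (e x) (R / 2), ?_, ?_, ?_,
    e.source ∩ e ⁻¹' Metric.ball (e x) (R / 4), ?_, ?_, ?_, ?_⟩
  · exact (isCompact_closedBall _ _).image_of_continuousOn
      ((continuousOn_extChartAt_symm x).mono fun z hz => (hball (hsub hz)).2)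
  · rintro _ ⟨z, hz, rfl⟩
    exact (hball (hsub hz)).1
  · rintro _ ⟨z, hz, rfl⟩
    exact e.map_target (hball (hsub hz)).2
  · exact (continuousOn_extChartAt x).isOpen_inter_preimage (isOpen_extChartAt_source x)
      Metric.isOpen_ball
  · exact ⟨mem_extChartAt_source x, by simpa using hR⟩
  · rintro y ⟨hy, hy'⟩
    refine ⟨e y, ?_, e.left_inv hy⟩
    have : dist (e y) (e x) < R / 4 := hy'
    rw [Metric.mem_closedBall]
    linarith
  · rintro y ⟨hy, hy'⟩ z hz
    have h1 : dist (e y) (e x) < R / 4 := hy'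
    have h2 : dist z (e y) ≤ R / 4 := hz
    have h3 : z ∈ Metric.closedBall (e x) (R / 2) := by
      rw [Metric.mem_closedBall]
      linarith [dist_triangle z (e y) (e x)]
    exact ⟨e.symm z, ⟨z, h3, rfl⟩, e.right_inv (hball (hsub h3)).2⟩

/-- Compactness makes all local constants uniform, and a Lebesgue number of the finite cover
supplies `r`. The sets `good` let an application impose one more local condition on the charts, such
as transversality of a functional to the flow. -/
lemma exists_finiteAtlas [CompactSpace X] (good : X → Set X) (hgood : ∀ x, good x ∈ 𝓝 x) :
    ∃ A : FiniteAtlas n X, ∀ x ∈ A.s, A.K x ⊆ good x := by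
  choose C₁ U₁ hU₁ h₁ using exists_edist_extChartAt_le (n := n) (X := X)
  choose C₂ U₂ hU₂ h₂ using exists_edist_le_extChartAt (n := n) (X := X)
  choose C₃ hC₃ h₃ using eventually_norm_chartDeriv_le (n := n) (X := X)
  choose C₄ hC₄ h₄ using eventually_norm_le_chartDeriv (n := n) (X := X)
  choose ρ hρ K hKc hKU hKs W hWo hxW hWK hWρ using fun x =>
    exists_compact_chart_nhds (n := n) x (inter_mem (inter_mem (inter_mem (hU₁ x) (hU₂ x))
      (inter_mem (h₃ x) (h₄ x))) (hgood x))
  obtain ⟨s, hs⟩ := isCompact_univ.elim_finite_subcover W hWo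
    (fun x _ => mem_iUnion.2 ⟨x, hxW x⟩)
  obtain ⟨δ, hδ, hδW⟩ := lebesgue_number_lemma_of_emetric (s := (univ : Set X))
    (c := fun x : s => W x) isCompact_univ (fun x => hWo x) (by
      intro y hy
      obtain ⟨x, hx, hyx⟩ := mem_iUnion₂.1 (hs hy)
      exact mem_iUnion.2 ⟨⟨x, hx⟩, hyx⟩)
  obtain ⟨r, hr, hrδ⟩ : ∃ r : ℝ, 0 < r ∧ ENNReal.ofReal r ≤ δ := by
    refine ⟨(min δ 1).toReal, ENNReal.toReal_pos (by simp [hδ.ne']) (by simp), ?_⟩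
    rw [ENNReal.ofReal_toReal (by simp)]
    exact min_le_left _ _
  set C : ℝ := 1 + ∑ x ∈ s, ((C₁ x : ℝ) + C₂ x + C₃ x + C₄ x) with hC
  have hCx : ∀ x ∈ s, (C₁ x : ℝ) + C₂ x + C₃ x + C₄ x ≤ C - 1 := by
    intro x hx
    rw [hC, add_sub_cancel_left]
    exact Finset.single_le_sum (f := fun x => ((C₁ x : ℝ) + C₂ x + C₃ x + C₄ x))
      (fun x _ => by have := hC₃ x; have := hC₄ x; positivity) hx
  have hC1 : 1 ≤ C := by
    have : 0 ≤ ∑ x ∈ s, ((C₁ x : ℝ) + C₂ x + C₃ x + C₄ x) :=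
      Finset.sum_nonneg fun x _ => by have := hC₃ x; have := hC₄ x; positivity
    linarith
  obtain ⟨ρ₀, hρ₀, hρ₀s⟩ : ∃ ρ₀ > 0, ∀ x ∈ s, ρ₀ ≤ ρ x := by
    rcases s.eq_empty_or_nonempty with rfl | hne
    · exact ⟨1, one_pos, by simp⟩
    · obtain ⟨x₀, -, h⟩ := s.exists_min_image ρ hne
      exact ⟨ρ x₀, hρ x₀, h⟩
  refine ⟨⟨s, K, C, r, ρ₀, hC1, hr, hρ₀, fun x _ => hKc x, fun x _ => hKs x, ?_, ?_, ?_, ?_, ?_⟩,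
    fun x hx y hy => (hKU x hy).2⟩
  · intro x hx y hy y' hy' d hd hyy'
    have h := h₁ x y (hKU x hy).1.1.1 y' (hKU x hy').1.1.1
    have hc : (C₁ x : ℝ) ≤ C := by
      have := hCx x hx; have := hC₃ x; have := hC₄ x; have := (C₂ x).2; linarith
    have h' := h.trans (mul_le_mul_right hyy' _)
    rw [edist_comm, edist_dist, dist_eq_norm, ← ENNReal.ofReal_coe_nnreal,
      ← ENNReal.ofReal_mul (by positivity), ENNReal.ofReal_le_ofReal_iff (by positivity)] at h'
    exact h'.trans (by gcongr)
  · intro x hx y hy y' hy'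
    have h := h₂ x y (hKU x hy).1.1.2 y' (hKU x hy').1.1.2
    have hc : (C₂ x : ℝ) ≤ C := by
      have := hCx x hx; have := hC₃ x; have := hC₄ x; have := (C₁ x).2; linarith
    refine h.trans ?_
    rw [edist_comm (extChartAt (𝓡 n) x y), edist_dist, dist_eq_norm, ← ENNReal.ofReal_coe_nnreal,
      ← ENNReal.ofReal_mul (by positivity)]
    exact ENNReal.ofReal_le_ofReal (by gcongr)
  · intro x hx y hy w
    have h := (hKU x hy).1.2.1 w
    have hc : C₃ x ≤ C := by
      have := hCx x hx; have := (C₁ x).2; have := hC₄ x; have := (C₂ x).2; linarith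
    exact h.trans (by gcongr)
  · intro x hx y hy w
    have h := (hKU x hy).1.2.2 w
    have hc : C₄ x ≤ C := by
      have := hCx x hx; have := (C₁ x).2; have := hC₃ x; have := (C₂ x).2; linarith
    exact h.trans (by gcongr)
  · intro y
    obtain ⟨⟨x, hx⟩, hxy⟩ := hδW y (mem_univ y)
    refine ⟨x, hx, fun y' hy' => hWK x (hxy ?_), ?_⟩
    · rw [Metric.mem_eball, edist_comm]
      exact hy'.trans_le hrδ
    · refine (Metric.closedBall_subset_closedBall (hρ₀s x hx)).trans (hWρ x y (hxy ?_))
      exact Metric.mem_eball_self hδ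

end LocalGeometry

/-! ### Smooth densities, Hausdorff measure and volumes of balls -/

section Measure

lemma euclideanHausdorffMeasure_image_le_of_lipschitzOnWith {X Y : Type*} [EMetricSpace X]
    [EMetricSpace Y] [MeasurableSpace X] [BorelSpace X] [MeasurableSpace Y] [BorelSpace Y]
    {C : NNReal} {f : X → Y} {s : Set X} (h : LipschitzOnWith C f s) (d : ℕ) :
    μHE[d] (f '' s) ≤ (C : ℝ≥0∞) ^ d * μHE[d] s := by
  have := h.hausdorffMeasure_image_le (d := d) (Nat.cast_nonneg d)
  rw [ENNReal.rpow_natCast] at this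
  simp only [Measure.euclideanHausdorffMeasure_def, Measure.smul_apply, ENNReal.smul_def,
    smul_eq_mul]
  rw [mul_left_comm]
  gcongr

variable {n : ℕ} {X : Type*} [EMetricSpace X] [ChartedSpace (EuclideanSpace ℝ (Fin n)) X]
  [IsManifold (𝓡 n) ∞ X] [RiemannianBundle (fun x : X => TangentSpace (𝓡 n) x)]
  [IsContinuousRiemannianBundle (EuclideanSpace ℝ (Fin n)) (fun x : X => TangentSpace (𝓡 n) x)]
  [IsRiemannianManifold (𝓡 n) X] [MeasurableSpace X] [BorelSpace X]

omit [IsManifold (𝓡 n) ∞ X] [RiemannianBundle (fun x : X => TangentSpace (𝓡 n) x)]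
  [IsContinuousRiemannianBundle (EuclideanSpace ℝ (Fin n)) (fun x : X => TangentSpace (𝓡 n) x)]
  [IsRiemannianManifold (𝓡 n) X] in
lemma IsSmoothDensity.exists_nhds_comparable {μ : Measure X} (hμ : IsSmoothDensity (n := n) μ)
    (x : X) : ∃ C : NNReal, ∃ U ∈ 𝓝 x, ∀ A ⊆ U, MeasurableSet A →
      μ A ≤ C * volume (extChartAt (𝓡 n) x '' A) ∧
      volume (extChartAt (𝓡 n) x '' A) ≤ C * μ A := by
  obtain ⟨ρ, hρ, hpos, hInt⟩ := hμ x
  set c := chartAt (EuclideanSpace ℝ (Fin n)) x with hc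
  have hxs : x ∈ c.source := mem_chart_source _ x
  have hcx : c x ∈ c.target := c.map_source hxs
  have hcont : ContinuousAt ρ (c x) :=
    hρ.continuousOn.continuousAt (c.open_target.mem_nhds hcx)
  have hpx := hpos _ hcx
  have hev : ∀ᶠ z in 𝓝 (c x), ρ (c x) / 2 < ρ z ∧ ρ z < 2 * ρ (c x) :=
    (hcont.eventually_const_lt (by linarith)).and (hcont.eventually_lt_const (by linarith))
  have hev' : ∀ᶠ y in 𝓝 x, ρ (c x) / 2 < ρ (c y) ∧ ρ (c y) < 2 * ρ (c x) :=
    (c.continuousAt hxs).eventually hev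
  refine ⟨Real.toNNReal (2 * ρ (c x)) + Real.toNNReal (2 / ρ (c x)), _,
    inter_mem hev' (c.open_source.mem_nhds hxs), fun A hA hAm => ?_⟩
  have hAs : A ⊆ c.source := fun y hy => (hA hy).2
  have himg : extChartAt (𝓡 n) x '' A = c '' A := by simp [extChartAt, hc]
  have hm : MeasurableSet (c '' A) := by
    have h1 : c '' A = Subtype.val '' (c.target.domRestrict c.symm ⁻¹' A) := by
      rw [c.image_eq_target_inter_inv_preimage hAs, domRestrict_eq, preimage_comp,
        Subtype.image_preimage_coe]
    rw [h1]
    exact (MeasurableEmbedding.subtype_coe c.open_target.measurableSet).measurableSet_image.2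
      (c.continuousOn_symm.domRestrict.measurable hAm)
  rw [himg, hInt A hAs hAm]
  constructor
  · calc _ ≤ ∫⁻ z in c '' A, ENNReal.ofReal (2 * ρ (c x)) := by
          refine setLIntegral_mono' hm ?_
          rintro _ ⟨y, hy, rfl⟩
          exact ENNReal.ofReal_le_ofReal (hA hy).1.2.le
      _ = ENNReal.ofReal (2 * ρ (c x)) * volume (c '' A) := by simp
      _ ≤ _ := by
        gcongr
        rw [ENNReal.ofReal]
        exact_mod_cast le_self_add
  · calc volume (c '' A) = ∫⁻ z in c '' A, 1 := by simp
      _ ≤ ∫⁻ z in c '' A, ENNReal.ofReal (2 / ρ (c x)) * ENNReal.ofReal (ρ z) := by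
          refine setLIntegral_mono' hm ?_
          rintro _ ⟨y, hy, rfl⟩
          rw [← ENNReal.ofReal_mul (by positivity), ← ENNReal.ofReal_one]
          refine ENNReal.ofReal_le_ofReal ?_
          rw [div_mul_eq_mul_div, le_div_iff₀ hpx]
          linarith [(hA hy).1.1]
      _ = ENNReal.ofReal (2 / ρ (c x)) * ∫⁻ z in c '' A, ENNReal.ofReal (ρ z) :=
          lintegral_const_mul' _ _ ENNReal.ofReal_ne_top
      _ ≤ _ := by
        gcongr
        rw [ENNReal.ofReal]
        exact_mod_cast le_add_self

/-- In a bi-Lipschitz chart both measures are comparable with Lebesgue measure. Hausdorff measure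
depends on the distance only, so Lipschitz bounds for the flow can later replace Jacobians and
changes of variables. -/
lemma IsSmoothDensity.exists_nhds_comparable_hausdorff {μ : Measure X}
    (hμ : IsSmoothDensity (n := n) μ) (x : X) : ∃ C : NNReal, ∃ U ∈ 𝓝 x, ∀ A ⊆ U,
      MeasurableSet A → μ A ≤ C * μHE[n] A ∧ μHE[n] A ≤ C * μ A := by
  obtain ⟨C₁, U₁, hU₁, h₁⟩ := exists_edist_extChartAt_le (n := n) x
  obtain ⟨C₂, U₂, hU₂, h₂⟩ := exists_edist_le_extChartAt (n := n) x
  obtain ⟨C₃, U₃, hU₃, h₃⟩ := hμ.exists_nhds_comparable x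
  set e := extChartAt (𝓡 n) x with he
  refine ⟨C₃ * C₁ ^ n + C₂ ^ n * C₃, _, inter_mem (inter_mem hU₁ hU₂) (inter_mem hU₃
    (extChartAt_source_mem_nhds (I := 𝓡 n) x)), fun A hA hAm => ?_⟩
  obtain ⟨h3, h4⟩ := h₃ A (fun y hy => (hA hy).2.1) hAm
  have h1 : volume (e '' A) ≤ (C₁ : ℝ≥0∞) ^ n * μHE[n] A := by
    rw [← EuclideanSpace.euclideanHausdorffMeasure_eq_volume]
    exact euclideanHausdorffMeasure_image_le_of_lipschitzOnWith
      (fun y hy y' hy' => h₁ y (hA hy).1.1 y' (hA hy').1.1) n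
  have h2 : μHE[n] A ≤ (C₂ : ℝ≥0∞) ^ n * volume (e '' A) := by
    have hA' : e.symm '' (e '' A) = A := by
      rw [image_image]
      refine (image_congr fun y hy => e.left_inv (hA hy).2.2).trans (image_id' A)
    rw [← EuclideanSpace.euclideanHausdorffMeasure_eq_volume]
    nth_rewrite 1 [← hA']
    refine euclideanHausdorffMeasure_image_le_of_lipschitzOnWith ?_ n
    rintro _ ⟨y, hy, rfl⟩ _ ⟨y', hy', rfl⟩
    rw [e.left_inv (hA hy).2.2, e.left_inv (hA hy').2.2]
    exact h₂ y (hA hy).1.2 y' (hA hy').1.2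
  push_cast
  constructor
  · calc μ A ≤ C₃ * ((C₁ : ℝ≥0∞) ^ n * μHE[n] A) := h3.trans (by gcongr)
      _ = C₃ * (C₁ : ℝ≥0∞) ^ n * μHE[n] A := by rw [mul_assoc]
      _ ≤ _ := by gcongr; exact le_self_add
  · calc μHE[n] A ≤ (C₂ : ℝ≥0∞) ^ n * (C₃ * μ A) := h2.trans (by gcongr)
      _ = (C₂ : ℝ≥0∞) ^ n * C₃ * μ A := by rw [mul_assoc]
      _ ≤ _ := by gcongr; exact le_add_self

/-- Measures that are locally dominated by each other up to constants are so globally on a compact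
space. -/
lemma exists_measure_le_of_nhds {Y : Type*} [TopologicalSpace Y] [CompactSpace Y]
    [MeasurableSpace Y] [OpensMeasurableSpace Y] {μ ν : Measure Y}
    (h : ∀ x, ∃ C : NNReal, ∃ U ∈ 𝓝 x, ∀ A ⊆ U, MeasurableSet A → μ A ≤ C * ν A) :
    ∃ C : NNReal, μ ≤ C • ν := by
  choose C U hU hC using h
  obtain ⟨s, hs⟩ := isCompact_univ.elim_finite_subcover (fun x => interior (U x))
    (fun x => isOpen_interior) (fun x _ => mem_iUnion.2 ⟨x, mem_interior_iff_mem_nhds.2 (hU x)⟩)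
  refine ⟨∑ x ∈ s, C x, Measure.le_iff.2 fun A hA => ?_⟩
  have hA' : A ⊆ ⋃ x ∈ s, A ∩ interior (U x) := by
    intro y hy
    obtain ⟨x, hx, hyx⟩ := mem_iUnion₂.1 (hs (mem_univ y))
    exact mem_iUnion₂.2 ⟨x, hx, hy, hyx⟩
  calc μ A ≤ ∑ x ∈ s, μ (A ∩ interior (U x)) :=
        (measure_mono hA').trans (measure_biUnion_finset_le _ _)
    _ ≤ ∑ x ∈ s, C x * ν A := by
        refine Finset.sum_le_sum fun x _ => ?_
        refine (hC x _ (fun y hy => interior_subset hy.2)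
          (hA.inter isOpen_interior.measurableSet)).trans ?_
        gcongr
        exact inter_subset_left
    _ = _ := by
        rw [← Finset.sum_mul, Measure.smul_apply, ENNReal.smul_def, smul_eq_mul]
        push_cast
        rfl

lemma IsSmoothDensity.exists_comparable_hausdorff [CompactSpace X] {μ : Measure X}
    (hμ : IsSmoothDensity (n := n) μ) :
    ∃ C : NNReal, μ ≤ C • μHE[n] ∧ μHE[n] ≤ C • μ := by
  choose C U hU h using hμ.exists_nhds_comparable_hausdorff
  obtain ⟨C₁, h₁⟩ := exists_measure_le_of_nhds (μ := μ) (ν := μHE[n])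
    fun x => ⟨C x, U x, hU x, fun A hA hm => (h x A hA hm).1⟩
  obtain ⟨C₂, h₂⟩ := exists_measure_le_of_nhds (μ := μHE[n]) (ν := μ)
    fun x => ⟨C x, U x, hU x, fun A hA hm => (h x A hA hm).2⟩
  refine ⟨C₁ + C₂, h₁.trans ?_, h₂.trans ?_⟩
  · exact Measure.le_iff.2 fun A _ => by
      simp only [Measure.smul_apply, ENNReal.smul_def, smul_eq_mul]; gcongr; simp
  · exact Measure.le_iff.2 fun A _ => by
      simp only [Measure.smul_apply, ENNReal.smul_def, smul_eq_mul]; gcongr; simp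

lemma FiniteAtlas.lipschitzOnWith (𝒜 : FiniteAtlas n X) {x : X} (hx : x ∈ 𝒜.s) :
    LipschitzOnWith (Real.toNNReal 𝒜.C) (extChartAt (𝓡 n) x) (𝒜.K x) := by
  have hC : 0 ≤ 𝒜.C := zero_le_one.trans 𝒜.one_le_C
  intro y hy y' hy'
  by_cases htop : edist y y' = ⊤
  · rw [htop, ENNReal.mul_top]
    · exact le_top
    · simpa using zero_lt_one.trans_le 𝒜.one_le_C
  · have := 𝒜.norm_sub_le x hx y hy y' hy' (edist y y').toReal ENNReal.toReal_nonneg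
      (by rw [ENNReal.ofReal_toReal htop])
    rw [edist_comm, edist_dist, dist_eq_norm]
    refine (ENNReal.ofReal_le_ofReal this).trans ?_
    rw [ENNReal.ofReal_mul hC, ENNReal.ofReal_toReal htop]
    rfl

/-- The chart of an atlas is co-Lipschitz. -/
lemma FiniteAtlas.measure_le_volume_image (𝒜 : FiniteAtlas n X) {x : X} (hx : x ∈ 𝒜.s)
    {A : Set X} (hA : A ⊆ 𝒜.K x) :
    μHE[n] A ≤ ENNReal.ofReal 𝒜.C ^ n * volume (extChartAt (𝓡 n) x '' A) := by
  set e := extChartAt (𝓡 n) x with he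
  have hC : 0 ≤ 𝒜.C := zero_le_one.trans 𝒜.one_le_C
  have hleft : ∀ y ∈ A, e.symm (e y) = y := fun y hy =>
    e.left_inv (𝒜.subset_source x hx (hA hy))
  have hA' : e.symm '' (e '' A) = A := by
    rw [image_image]
    exact (image_congr hleft).trans (image_id' A)
  rw [← EuclideanSpace.euclideanHausdorffMeasure_eq_volume]
  nth_rewrite 1 [← hA']
  refine euclideanHausdorffMeasure_image_le_of_lipschitzOnWith ?_ n
  rintro _ ⟨y, hy, rfl⟩ _ ⟨y', hy', rfl⟩
  rw [hleft y hy, hleft y' hy', edist_comm (e y), edist_dist (e y'), dist_eq_norm]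
  refine (𝒜.edist_le x hx y (hA hy) y' (hA hy')).trans ?_
  rw [ENNReal.ofReal_mul hC]
  rfl

lemma FiniteAtlas.volume_image_le (𝒜 : FiniteAtlas n X) {x : X} (hx : x ∈ 𝒜.s)
    {A : Set X} (hA : A ⊆ 𝒜.K x) :
    volume (extChartAt (𝓡 n) x '' A) ≤ ENNReal.ofReal 𝒜.C ^ n * μHE[n] A := by
  rw [← EuclideanSpace.euclideanHausdorffMeasure_eq_volume]
  exact euclideanHausdorffMeasure_image_le_of_lipschitzOnWith
    ((𝒜.lipschitzOnWith hx).mono hA) n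

variable [CompactSpace X]

lemma isFiniteMeasure_euclideanHausdorffMeasure : IsFiniteMeasure (μHE[n] : Measure X) := by
  obtain ⟨𝒜, -⟩ := exists_finiteAtlas (n := n) (X := X) (fun _ => univ) (fun _ => univ_mem)
  have hcover : (univ : Set X) ⊆ ⋃ x ∈ 𝒜.s, 𝒜.K x := by
    intro y _
    obtain ⟨x, hx, hy, -⟩ := 𝒜.exists_chart y
    exact mem_iUnion₂.2 ⟨x, hx, hy y (by simpa using 𝒜.r_pos)⟩
  refine ⟨(measure_mono hcover).trans_lt ((measure_biUnion_finset_le _ _).trans_lt ?_)⟩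
  refine ENNReal.sum_lt_top.2 fun x hx => (𝒜.measure_le_volume_image hx subset_rfl).trans_lt ?_
  refine ENNReal.mul_lt_top (by simp) ?_
  exact ((𝒜.isCompact x hx).image_of_continuousOn
    ((continuousOn_extChartAt x).mono (𝒜.subset_source x hx))).measure_lt_top

lemma IsSmoothDensity.isFiniteMeasure {μ : Measure X} (hμ : IsSmoothDensity (n := n) μ) :
    IsFiniteMeasure μ := by
  obtain ⟨C, hC, -⟩ := hμ.exists_comparable_hausdorff
  have := isFiniteMeasure_euclideanHausdorffMeasure (n := n) (X := X)
  exact isFiniteMeasure_of_le (C • μHE[n]) hC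

/-- Balls of radius below `𝒜.r` lie in one chart, where they are contained in a Euclidean ball of
comparable radius. For larger radii the total mass is already bounded by a multiple of r ^ n. -/
lemma IsSmoothDensity.exists_measure_closedEBall_le {μ : Measure X}
    (hμ : IsSmoothDensity (n := n) μ) : ∃ C : ℝ, 0 < C ∧ ∀ (x : X) (r : ℝ), 0 ≤ r →
      μ (Metric.closedEBall x (ENNReal.ofReal r)) ≤ ENNReal.ofReal (C * r ^ n) := by
  obtain ⟨C, hC, -⟩ := hμ.exists_comparable_hausdorff
  have hfin := hμ.isFiniteMeasure
  obtain ⟨𝒜, -⟩ := exists_finiteAtlas (n := n) (X := X) (fun _ => univ) (fun _ => univ_mem)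
  set v := volume (Metric.ball (0 : EuclideanSpace ℝ (Fin n)) 1) with hv
  have hvtop : v ≠ ⊤ := measure_ball_lt_top.ne
  have hA := zero_lt_one.trans_le 𝒜.one_le_C
  have hr₀ := 𝒜.r_pos
  refine ⟨C * 𝒜.C ^ n * 𝒜.C ^ n * v.toReal + (μ univ).toReal / 𝒜.r ^ n + 1, by positivity,
    fun x r hr => ?_⟩
  rcases lt_or_ge r 𝒜.r with hlt | hge
  · obtain ⟨c, hc, hball, -⟩ := 𝒜.exists_chart x
    have hxc : x ∈ 𝒜.K c := hball x (by simpa using hr₀)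
    have hsub : Metric.closedEBall x (ENNReal.ofReal r) ⊆ 𝒜.K c := by
      intro y hy
      refine hball y (lt_of_le_of_lt ?_ ((ENNReal.ofReal_lt_ofReal_iff hr₀).2 hlt))
      rw [edist_comm]
      exact hy
    have himg : extChartAt (𝓡 n) c '' Metric.closedEBall x (ENNReal.ofReal r) ⊆
        Metric.closedBall (extChartAt (𝓡 n) c x) (𝒜.C * r) := by
      rintro _ ⟨y, hy, rfl⟩
      rw [Metric.mem_closedBall, dist_eq_norm]
      exact 𝒜.norm_sub_le c hc x hxc y (hsub hy) r hr (by rw [edist_comm]; exact hy)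
    calc μ (Metric.closedEBall x (ENNReal.ofReal r))
        ≤ C * μHE[n] (Metric.closedEBall x (ENNReal.ofReal r)) := hC _
      _ ≤ C * (ENNReal.ofReal 𝒜.C ^ n * (ENNReal.ofReal ((𝒜.C * r) ^ n) * v)) := by
          gcongr
          refine (𝒜.measure_le_volume_image hc hsub).trans ?_
          gcongr
          refine (measure_mono himg).trans ?_
          rw [Measure.addHaar_closedBall _ _ (by positivity)]
          simp [hv]
      _ = ENNReal.ofReal (C * 𝒜.C ^ n * 𝒜.C ^ n * v.toReal * r ^ n) := by
          rw [← ENNReal.ofReal_toReal hvtop, ← ENNReal.ofReal_pow hA.le,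
            ← ENNReal.ofReal_mul (by positivity), ← ENNReal.ofReal_mul (by positivity),
            ← ENNReal.ofReal_coe_nnreal, ← ENNReal.ofReal_mul (by positivity),
            ENNReal.toReal_ofReal ENNReal.toReal_nonneg]
          congr 1
          ring
      _ ≤ _ := by
          refine ENNReal.ofReal_le_ofReal ?_
          gcongr
          have : 0 ≤ (μ univ).toReal / 𝒜.r ^ n := by positivity
          linarith
  · calc μ (Metric.closedEBall x (ENNReal.ofReal r)) ≤ μ univ := measure_mono (subset_univ _)
      _ = ENNReal.ofReal ((μ univ).toReal) := (ENNReal.ofReal_toReal (measure_ne_top μ _)).symm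
      _ ≤ _ := by
        refine ENNReal.ofReal_le_ofReal ?_
        calc (μ univ).toReal = (μ univ).toReal / 𝒜.r ^ n * 𝒜.r ^ n := by field_simp
          _ ≤ (μ univ).toReal / 𝒜.r ^ n * r ^ n := by gcongr
          _ ≤ _ := by
            gcongr
            have : 0 ≤ C * 𝒜.C ^ n * 𝒜.C ^ n * v.toReal := by positivity
            linarith

/-- A Euclidean ball of radius κ r around the chart image of x lies in the image of the metric ball.
This needs the margin `𝒜.ρ`, which keeps the Euclidean ball inside the image of the compact set. -/
lemma IsSmoothDensity.exists_le_measure_closedEBall {μ : Measure X}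
    (hμ : IsSmoothDensity (n := n) μ) : ∃ c : ℝ, 0 < c ∧ ∀ (x : X) (r : ℝ), 0 < r → r ≤ 1 →
      ENNReal.ofReal (c * r ^ n) ≤ μ (Metric.closedEBall x (ENNReal.ofReal r)) := by
  obtain ⟨C, -, hC⟩ := hμ.exists_comparable_hausdorff
  have hfin := hμ.isFiniteMeasure
  obtain ⟨𝒜, -⟩ := exists_finiteAtlas (n := n) (X := X) (fun _ => univ) (fun _ => univ_mem)
  set v := volume (Metric.ball (0 : EuclideanSpace ℝ (Fin n)) 1) with hv
  have hvtop : v ≠ ⊤ := measure_ball_lt_top.ne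
  have hvpos : 0 < v.toReal :=
    ENNReal.toReal_pos (Metric.measure_ball_pos volume _ one_pos).ne' hvtop
  have hA := zero_lt_one.trans_le 𝒜.one_le_C
  set κ := min 𝒜.ρ 𝒜.C⁻¹ with hκ
  have hκ0 : 0 < κ := lt_min 𝒜.ρ_pos (by positivity)
  set B : ℝ := 𝒜.C ^ n * (C + 1) with hB
  have hB0 : 0 < B := by positivity
  refine ⟨κ ^ n * v.toReal / B, by positivity, fun x r hr hr1 => ?_⟩
  obtain ⟨c, hc, hball, hρ⟩ := 𝒜.exists_chart x
  have hxc : x ∈ 𝒜.K c := hball x (by simpa using 𝒜.r_pos)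
  set S := Metric.closedEBall x (ENNReal.ofReal r) ∩ 𝒜.K c with hS
  have himg : Metric.closedBall (extChartAt (𝓡 n) c x) (κ * r) ⊆ extChartAt (𝓡 n) c '' S := by
    intro z hz
    have hz' : dist z (extChartAt (𝓡 n) c x) ≤ κ * r := hz
    have hκρ : κ * r ≤ 𝒜.ρ := by
      calc κ * r ≤ κ * 1 := by gcongr
        _ ≤ 𝒜.ρ := by rw [mul_one]; exact min_le_left _ _
    obtain ⟨y, hy, rfl⟩ := hρ (Metric.closedBall_subset_closedBall hκρ hz)
    refine ⟨y, ⟨?_, hy⟩, rfl⟩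
    rw [Metric.mem_closedEBall, edist_comm]
    refine (𝒜.edist_le c hc x hxc y hy).trans (ENNReal.ofReal_le_ofReal ?_)
    rw [← dist_eq_norm]
    calc 𝒜.C * dist (extChartAt (𝓡 n) c y) (extChartAt (𝓡 n) c x) ≤ 𝒜.C * (𝒜.C⁻¹ * r) := by
          gcongr
          exact hz'.trans (by gcongr; exact min_le_right _ _)
      _ = r := by field_simp
  have h1 : ENNReal.ofReal (κ ^ n * v.toReal * r ^ n) ≤ ENNReal.ofReal B * μ S := by
    calc ENNReal.ofReal (κ ^ n * v.toReal * r ^ n)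
        = ENNReal.ofReal ((κ * r) ^ n) * v := by
          nth_rewrite 2 [← ENNReal.ofReal_toReal hvtop]
          rw [← ENNReal.ofReal_mul (by positivity)]
          congr 1
          ring
      _ = volume (Metric.closedBall (extChartAt (𝓡 n) c x) (κ * r)) := by
          rw [Measure.addHaar_closedBall _ _ (by positivity)]
          simp [hv]
      _ ≤ ENNReal.ofReal 𝒜.C ^ n * μHE[n] S :=
          (measure_mono himg).trans (𝒜.volume_image_le hc inter_subset_right)
      _ ≤ ENNReal.ofReal 𝒜.C ^ n * (C * μ S) := by
          gcongr
          exact hC S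
      _ ≤ ENNReal.ofReal B * μ S := by
          rw [← mul_assoc, ← ENNReal.ofReal_pow hA.le, ← ENNReal.ofReal_coe_nnreal,
            ← ENNReal.ofReal_mul (by positivity)]
          gcongr
          rw [hB]
          gcongr
          linarith
  calc ENNReal.ofReal (κ ^ n * v.toReal / B * r ^ n)
      = ENNReal.ofReal (B⁻¹) * ENNReal.ofReal (κ ^ n * v.toReal * r ^ n) := by
        rw [← ENNReal.ofReal_mul (by positivity)]
        congr 1
        field_simp
    _ ≤ ENNReal.ofReal (B⁻¹) * (ENNReal.ofReal B * μ S) := by gcongr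
    _ = μ S := by
        rw [← mul_assoc, ← ENNReal.ofReal_mul (by positivity), inv_mul_cancel₀ hB0.ne']
        simp
    _ ≤ _ := measure_mono inter_subset_left

end Measure

/-! ### Uniform constants and a Taylor estimate -/

lemma exists_uniform_constants {ι : Type*} (s : Finset ι) {P : ι → ℝ → ℝ → Prop}
    (hP : ∀ i C C' r r', C ≤ C' → r' ≤ r → P i C r → P i C' r')
    (h : ∀ i ∈ s, ∃ C > 0, ∃ r > 0, P i C r) : ∃ C > 0, ∃ r > 0, ∀ i ∈ s, P i C r := by
  classical
  induction s using Finset.induction_on with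
  | empty => exact ⟨1, one_pos, 1, one_pos, by simp⟩
  | insert a s ha ih =>
    obtain ⟨C, hC, r, hr, h₁⟩ := ih fun i hi => h i (Finset.mem_insert_of_mem hi)
    obtain ⟨C', hC', r', hr', h₂⟩ := h a (Finset.mem_insert_self a s)
    refine ⟨max C C', lt_max_of_lt_left hC, min r r', lt_min hr hr', fun i hi => ?_⟩
    rcases Finset.mem_insert.1 hi with rfl | hi
    · exact hP _ _ _ _ _ (le_max_right _ _) (min_le_right _ _) h₂
    · exact hP _ _ _ _ _ (le_max_left _ _) (min_le_left _ _) (h₁ i hi)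

/-- A locally uniform second order Taylor estimate. -/
lemma exists_nhds_taylor {F G : Type*} [NormedAddCommGroup F] [NormedSpace ℝ F]
    [NormedAddCommGroup G] [NormedSpace ℝ G] {g : F → G} {p : F} (hg : ContDiffAt ℝ ∞ g p) :
    ∃ C > 0, ∃ R > 0, ∀ q ∈ Metric.ball p R, ‖fderiv ℝ g q‖ ≤ C ∧ ∀ q' ∈ Metric.ball p R,
      ‖g q' - g q - fderiv ℝ g q (q' - q)‖ ≤ C * ‖q' - q‖ ^ 2 := by
  have h1 : ContDiffAt ℝ 1 (fderiv ℝ g) p :=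
    hg.fderiv_right (m := 1) (by
      rw [one_add_one_eq_two]
      exact WithTop.coe_le_coe.2 le_top)
  obtain ⟨K, t, ht, hK⟩ := h1.exists_lipschitzOnWith
  have hd : ∀ᶠ q in 𝓝 p, DifferentiableAt ℝ g q := by
    have : ContDiffAt ℝ 1 g p := hg.of_le (by exact_mod_cast le_top)
    filter_upwards [this.eventually (by simp)] with q hq
    exact hq.differentiableAt one_ne_zero
  have hb : ∀ᶠ q in 𝓝 p, ‖fderiv ℝ g q‖ < ‖fderiv ℝ g p‖ + 1 :=
    h1.continuousAt.norm.eventually_lt_const (by linarith)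
  obtain ⟨R, hR, hball⟩ := Metric.mem_nhds_iff.1 (inter_mem ht (inter_mem hd hb))
  refine ⟨‖fderiv ℝ g p‖ + 1 + K, by positivity, R, hR, fun q hq => ⟨?_, fun q' hq' => ?_⟩⟩
  · have := (hball hq).2.2
    have h2 : ‖fderiv ℝ g q‖ < ‖fderiv ℝ g p‖ + 1 := this
    linarith [K.2]
  · have hseg : segment ℝ q q' ⊆ Metric.ball p R := (convex_ball p R).segment_subset hq hq'
    -- The mean value inequality is applied to g minus its linear part at q. The derivative is
    -- locally Lipschitz, so on the segment it differs from its value at q by at most K ‖q' - q‖.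
    have key := (convex_segment q q').norm_image_sub_le_of_norm_hasFDerivWithin_le'
      (f := g) (f' := fderiv ℝ g) (φ := fderiv ℝ g q) (C := K * ‖q' - q‖)
      (fun x hx => ((hball (hseg hx)).2.1 : DifferentiableAt ℝ g x).hasFDerivAt.hasFDerivWithinAt)
      (fun x hx => by
        refine (hK.norm_sub_le (hball (hseg hx)).1 (hball hq).1).trans ?_
        gcongr
        have := norm_sub_le_of_mem_segment hx
        simpa [norm_sub_rev] using this)
      (left_mem_segment ℝ q q') (right_mem_segment ℝ q q')
    refine key.trans ?_
    rw [mul_assoc, ← sq]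
    gcongr
    have := norm_nonneg (fderiv ℝ g p)
    linarith

/-! ### The flow in charts -/

section Flow

variable {n : ℕ} {X : Type*} [EMetricSpace X] [ChartedSpace (EuclideanSpace ℝ (Fin n)) X]
  [IsManifold (𝓡 n) ∞ X]

/-- The map `(t, x) ↦ φ t x` in charts. -/
def chartFlow (φ : ℝ → X → X) (c₀ c₁ : X) (p : ℝ × EuclideanSpace ℝ (Fin n)) :
    EuclideanSpace ℝ (Fin n) :=
  extChartAt (𝓡 n) c₁ (φ p.1 ((extChartAt (𝓡 n) c₀).symm p.2))

variable {φ : ℝ → X → X}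
  (hφ : ContMDiff (𝓘(ℝ, ℝ).prod (𝓡 n)) (𝓡 n) ∞ (fun p : ℝ × X => φ p.1 p.2))

include hφ

omit [IsManifold (𝓡 n) ∞ X] in
lemma contMDiff_of_contMDiff_uncurry (h : ℝ) : ContMDiff (𝓡 n) (𝓡 n) ∞ (φ h) :=
  hφ.comp (contMDiff_const.prodMk contMDiff_id)

lemma contDiffAt_chartFlow {c₀ c₁ y : X} {h : ℝ} (hy : y ∈ (extChartAt (𝓡 n) c₀).source)
    (hy₁ : φ h y ∈ (extChartAt (𝓡 n) c₁).source) :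
    ContDiffAt ℝ ∞ (chartFlow (n := n) φ c₀ c₁) (h, extChartAt (𝓡 n) c₀ y) := by
  rw [← contMDiffAt_iff_contDiffAt]
  have hs : ContMDiffAt 𝓘(ℝ, EuclideanSpace ℝ (Fin n)) (𝓡 n) ∞ (extChartAt (𝓡 n) c₀).symm
      (extChartAt (𝓡 n) c₀ y) :=
    (contMDiffOn_extChartAt_symm c₀).contMDiffAt
      ((isOpen_extChartAt_target c₀).mem_nhds ((extChartAt (𝓡 n) c₀).map_source hy))
  have h2 : ContMDiffAt 𝓘(ℝ, ℝ × EuclideanSpace ℝ (Fin n)) (𝓡 n) ∞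
      (fun p : ℝ × EuclideanSpace ℝ (Fin n) => (extChartAt (𝓡 n) c₀).symm p.2)
      (h, extChartAt (𝓡 n) c₀ y) :=
    ContMDiffAt.comp (h, extChartAt (𝓡 n) c₀ y) (g := (extChartAt (𝓡 n) c₀).symm)
      (f := Prod.snd) hs contDiff_snd.contMDiff.contMDiffAt
  have h1 : ContMDiffAt 𝓘(ℝ, ℝ × EuclideanSpace ℝ (Fin n)) 𝓘(ℝ, ℝ) ∞
      (Prod.fst : ℝ × EuclideanSpace ℝ (Fin n) → ℝ)
      (h, extChartAt (𝓡 n) c₀ y) := contDiff_fst.contMDiff.contMDiffAt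
  have h3 := hφ.contMDiffAt.comp (h, extChartAt (𝓡 n) c₀ y) (h1.prodMk h2)
  rw [extChartAt_source] at hy₁
  refine ContMDiffAt.comp (h, extChartAt (𝓡 n) c₀ y) (g := extChartAt (𝓡 n) c₁)
    (f := fun p : ℝ × EuclideanSpace ℝ (Fin n) => φ p.1 ((extChartAt (𝓡 n) c₀).symm p.2)) ?_ h3
  refine contMDiffAt_extChartAt' ?_
  rwa [(extChartAt (𝓡 n) c₀).left_inv hy]

lemma chartDeriv_mfderiv {c₀ c₁ y : X} {h : ℝ} (hy : y ∈ (extChartAt (𝓡 n) c₀).source)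
    (hy₁ : φ h y ∈ (extChartAt (𝓡 n) c₁).source) (w : TangentSpace (𝓡 n) y) :
    chartDeriv c₁ (φ h y) (mfderiv (𝓡 n) (𝓡 n) (φ h) y w) =
      fderiv ℝ (chartFlow (n := n) φ c₀ c₁) (h, extChartAt (𝓡 n) c₀ y)
        (0, chartDeriv c₀ y w) := by
  have hd : HasMFDerivAt (𝓡 n) (𝓡 n) (φ h) y (mfderiv (𝓡 n) (𝓡 n) (φ h) y) :=
    ((contMDiff_of_contMDiff_uncurry hφ h).contMDiffAt.mdifferentiableAt
      (by simp)).hasMFDerivAt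
  have h1 := (hasMFDerivAt_extChartAt_chartDeriv hy₁).comp y hd
  have hg : HasFDerivAt (chartFlow (n := n) φ c₀ c₁)
      (fderiv ℝ (chartFlow (n := n) φ c₀ c₁) (h, extChartAt (𝓡 n) c₀ y))
      (h, extChartAt (𝓡 n) c₀ y) :=
    ((contDiffAt_chartFlow hφ hy hy₁).differentiableAt (by simp)).hasFDerivAt
  have hg2 : HasFDerivAt (fun z => chartFlow (n := n) φ c₀ c₁ (h, z))
      (fderiv ℝ (chartFlow (n := n) φ c₀ c₁) (h, extChartAt (𝓡 n) c₀ y) ∘L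
        ContinuousLinearMap.inr ℝ ℝ (EuclideanSpace ℝ (Fin n))) (extChartAt (𝓡 n) c₀ y) :=
    hg.comp (extChartAt (𝓡 n) c₀ y) (hasFDerivAt_prodMk_right h (extChartAt (𝓡 n) c₀ y))
  have h2 := hg2.hasMFDerivAt.comp y (hasMFDerivAt_extChartAt_chartDeriv hy)
  have he : extChartAt (𝓡 n) c₁ ∘ φ h =ᶠ[𝓝 y]
      (fun z => chartFlow (n := n) φ c₀ c₁ (h, z)) ∘ extChartAt (𝓡 n) c₀ := by
    filter_upwards [(isOpen_extChartAt_source c₀).mem_nhds hy] with a ha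
    simp only [Function.comp_apply, chartFlow]
    rw [(extChartAt (𝓡 n) c₀).left_inv ha]
  have h4 := hasMFDerivAt_unique h1 (h2.congr_of_eventuallyEq he)
  have h5 := congrArg (fun L : TangentSpace (𝓡 n) y →L[ℝ] EuclideanSpace ℝ (Fin n) => L w) h4
  exact h5

/-- The tangent vector `w` need not be the chart displacement y' - y; the discrepancy appears on the
right-hand side. In this form the estimate can be iterated, because the discrepancy after one step
is the input of the next. -/
lemma exists_nhds_chartFlow_estimate {c₀ c₁ y₀ : X} {h₀ : ℝ}
    (hy : y₀ ∈ (extChartAt (𝓡 n) c₀).source)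
    (hy₁ : φ h₀ y₀ ∈ (extChartAt (𝓡 n) c₁).source) :
    ∃ C > 0, ∃ N ∈ 𝓝 h₀, ∃ U ∈ 𝓝 y₀, ∀ h ∈ N, ∀ y ∈ U, ∀ w : TangentSpace (𝓡 n) y,
      ‖chartDeriv c₁ (φ h y) (mfderiv (𝓡 n) (𝓡 n) (φ h) y w)‖ ≤ C * ‖chartDeriv c₀ y w‖ ∧
      ∀ y' ∈ U, ‖extChartAt (𝓡 n) c₁ (φ h y') - extChartAt (𝓡 n) c₁ (φ h y) -
          chartDeriv c₁ (φ h y) (mfderiv (𝓡 n) (𝓡 n) (φ h) y w)‖ ≤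
        C * (‖extChartAt (𝓡 n) c₀ y' - extChartAt (𝓡 n) c₀ y - chartDeriv c₀ y w‖ +
          ‖extChartAt (𝓡 n) c₀ y' - extChartAt (𝓡 n) c₀ y‖ ^ 2) := by
  obtain ⟨C, hC, R, hR, hT⟩ := exists_nhds_taylor (contDiffAt_chartFlow hφ hy hy₁)
  have hcont : Continuous fun p : ℝ × X => φ p.1 p.2 := hφ.continuous
  have hev : ∀ᶠ p : ℝ × X in 𝓝 (h₀, y₀), φ p.1 p.2 ∈ (extChartAt (𝓡 n) c₁).source :=
    hcont.continuousAt.eventually ((isOpen_extChartAt_source c₁).mem_nhds hy₁)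
  rw [nhds_prod_eq] at hev
  obtain ⟨N, hN, U, hU, hNU⟩ := (eventually_prod_iff.1 hev)
  have hcc : ∀ᶠ y in 𝓝 y₀, extChartAt (𝓡 n) c₀ y ∈
      Metric.ball (extChartAt (𝓡 n) c₀ y₀) R :=
    (continuousAt_extChartAt' hy).eventually (Metric.ball_mem_nhds _ hR)
  refine ⟨C, hC, _, inter_mem hN (Metric.ball_mem_nhds h₀ hR), _, inter_mem hU (inter_mem hcc
    ((isOpen_extChartAt_source c₀).mem_nhds hy)), ?_⟩
  rintro h ⟨hhN, hhR⟩ y ⟨hyU, hyR, hys⟩ w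
  have hyR' : extChartAt (𝓡 n) c₀ y ∈ Metric.ball (extChartAt (𝓡 n) c₀ y₀) R := hyR
  have hq : ((h, extChartAt (𝓡 n) c₀ y) : ℝ × EuclideanSpace ℝ (Fin n)) ∈
      Metric.ball ((h₀, extChartAt (𝓡 n) c₀ y₀) : ℝ × EuclideanSpace ℝ (Fin n)) R := by
    rw [← ball_prod_same]
    exact ⟨hhR, hyR'⟩
  rw [chartDeriv_mfderiv hφ hys (hNU hhN hyU)]
  set L := fderiv ℝ (chartFlow (n := n) φ c₀ c₁) (h, extChartAt (𝓡 n) c₀ y) with hL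
  have hLb : ∀ v : EuclideanSpace ℝ (Fin n), ‖L (0, v)‖ ≤ C * ‖v‖ := by
    intro v
    refine (L.le_of_opNorm_le (hT _ hq).1 (0, v)).trans ?_
    simp [Prod.norm_def]
  refine ⟨hLb _, ?_⟩
  rintro y' ⟨hyU', hyR'', hys'⟩
  have hq' : ((h, extChartAt (𝓡 n) c₀ y') : ℝ × EuclideanSpace ℝ (Fin n)) ∈
      Metric.ball ((h₀, extChartAt (𝓡 n) c₀ y₀) : ℝ × EuclideanSpace ℝ (Fin n)) R := by
    rw [← ball_prod_same]
    exact ⟨hhR, hyR''⟩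
  have key := (hT _ hq).2 _ hq'
  have hval : ∀ a ∈ (extChartAt (𝓡 n) c₀).source,
      chartFlow (n := n) φ c₀ c₁ (h, extChartAt (𝓡 n) c₀ a) = extChartAt (𝓡 n) c₁ (φ h a) := by
    intro a ha
    simp only [chartFlow]
    rw [(extChartAt (𝓡 n) c₀).left_inv ha]
  rw [hval y hys, hval y' hys'] at key
  set v := extChartAt (𝓡 n) c₀ y' - extChartAt (𝓡 n) c₀ y with hv
  have hdiff : ((h, extChartAt (𝓡 n) c₀ y') : ℝ × EuclideanSpace ℝ (Fin n)) -
      (h, extChartAt (𝓡 n) c₀ y) = (0, v) := by simp [hv]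
  rw [← hL, hdiff] at key
  have hn : ‖((0, v) : ℝ × EuclideanSpace ℝ (Fin n))‖ = ‖v‖ := by simp [Prod.norm_def]
  rw [hn] at key
  have hsplit : L (0, chartDeriv c₀ y w) = L (0, v) - L (0, v - chartDeriv c₀ y w) := by
    rw [← map_sub]
    simp
  rw [hsplit]
  calc _ = ‖(extChartAt (𝓡 n) c₁ (φ h y') - extChartAt (𝓡 n) c₁ (φ h y) - L (0, v)) +
        L (0, v - chartDeriv c₀ y w)‖ := by congr 1; abel
    _ ≤ C * ‖v‖ ^ 2 + C * ‖v - chartDeriv c₀ y w‖ := (norm_add_le _ _).trans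
        (add_le_add key (hLb _))
    _ = _ := by ring

end Flow

/-! ### First and second order estimates for the flow with exponential constants -/

section FlowEstimates

variable {n : ℕ} {X : Type*} [EMetricSpace X] [ChartedSpace (EuclideanSpace ℝ (Fin n)) X]
  [IsManifold (𝓡 n) ∞ X] [RiemannianBundle (fun x : X => TangentSpace (𝓡 n) x)]
  [IsContinuousRiemannianBundle (EuclideanSpace ℝ (Fin n)) (fun x : X => TangentSpace (𝓡 n) x)]
  [IsRiemannianManifold (𝓡 n) X]

/-- First and second order estimates in charts for the map `φ h` at the point `y`. -/
def FiniteAtlas.FlowEstimateAt (𝒜 : FiniteAtlas n X) (φ : ℝ → X → X) (c₀ c₁ : X) (C r h : ℝ)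
    (y : X) : Prop :=
  ∀ w : TangentSpace (𝓡 n) y,
    ‖chartDeriv c₁ (φ h y) (mfderiv (𝓡 n) (𝓡 n) (φ h) y w)‖ ≤ C * ‖chartDeriv c₀ y w‖ ∧
    ∀ y' ∈ 𝒜.K c₀, ∀ δ : ℝ, 0 ≤ δ → δ ≤ r → edist y y' ≤ ENNReal.ofReal δ →
      ‖extChartAt (𝓡 n) c₁ (φ h y') - extChartAt (𝓡 n) c₁ (φ h y) -
          chartDeriv c₁ (φ h y) (mfderiv (𝓡 n) (𝓡 n) (φ h) y w)‖ ≤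
        C * (‖extChartAt (𝓡 n) c₀ y' - extChartAt (𝓡 n) c₀ y - chartDeriv c₀ y w‖ + δ ^ 2)

omit [IsContinuousRiemannianBundle (EuclideanSpace ℝ (Fin n))
  (fun x : X => TangentSpace (𝓡 n) x)] [IsRiemannianManifold (𝓡 n) X] in
lemma FiniteAtlas.FlowEstimateAt.mono {𝒜 : FiniteAtlas n X} {φ : ℝ → X → X} {c₀ c₁ : X}
    {C C' r r' h : ℝ} {y : X} (H : 𝒜.FlowEstimateAt φ c₀ c₁ C r h y) (hC : C ≤ C')
    (hr : r' ≤ r) : 𝒜.FlowEstimateAt φ c₀ c₁ C' r' h y := by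
  intro w
  obtain ⟨h1, h2⟩ := H w
  refine ⟨h1.trans (by gcongr), fun y' hy' δ hδ hδr hyy' => ?_⟩
  exact (h2 y' hy' δ hδ (hδr.trans hr) hyy').trans (by gcongr)

/-- First and second order estimates in charts for the maps `φ h`, `|h| ≤ 1`, on pairs of sets of
an atlas. -/
def FiniteAtlas.FlowEstimate (𝒜 : FiniteAtlas n X) (φ : ℝ → X → X) (c₀ c₁ : X) (C r : ℝ) : Prop :=
  ∀ h ∈ Icc (-1 : ℝ) 1, ∀ y ∈ 𝒜.K c₀, φ h y ∈ 𝒜.K c₁ → 𝒜.FlowEstimateAt φ c₀ c₁ C r h y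

lemma exists_ofReal_two_mul_le {ε : ℝ≥0∞} (hε : 0 < ε) :
    ∃ r : ℝ, 0 < r ∧ ENNReal.ofReal (2 * r) ≤ ε := by
  refine ⟨(min ε 1).toReal / 2,
    div_pos (ENNReal.toReal_pos (by simp [hε.ne']) (by simp)) two_pos, ?_⟩
  rw [mul_div_cancel₀ _ two_ne_zero, ENNReal.ofReal_toReal (by simp)]
  exact min_le_left _ _

lemma FiniteAtlas.exists_flowEstimate [CompactSpace X] (𝒜 : FiniteAtlas n X) {φ : ℝ → X → X}
    (hφ : ContMDiff (𝓘(ℝ, ℝ).prod (𝓡 n)) (𝓡 n) ∞ (fun p : ℝ × X => φ p.1 p.2)) :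
    ∃ C > 0, ∃ r > 0, ∀ c₀ ∈ 𝒜.s, ∀ c₁ ∈ 𝒜.s, 𝒜.FlowEstimate φ c₀ c₁ C r := by
  have hA := zero_lt_one.trans_le 𝒜.one_le_C
  suffices h : ∃ C > 0, ∃ r > 0, ∀ i ∈ 𝒜.s ×ˢ 𝒜.s, 𝒜.FlowEstimate φ i.1 i.2 C r by
    obtain ⟨C, hC, r, hr, h⟩ := h
    exact ⟨C, hC, r, hr, fun c₀ h₀ c₁ h₁ => h (c₀, c₁) (Finset.mk_mem_product h₀ h₁)⟩
  refine exists_uniform_constants _ ?_ ?_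
  · intro i C C' r r' hC hr hP h hh y hy hy'
    exact (hP h hh y hy hy').mono hC hr
  · rintro ⟨c₀, c₁⟩ hc
    obtain ⟨h₀, h₁⟩ := Finset.mem_product.1 hc
    have hcont : Continuous fun p : ℝ × X => φ p.1 p.2 := hφ.continuous
    -- On this compact set of times and points both charts are available, so the local estimates can
    -- be made uniform by compactness.
    set Q : Set (ℝ × X) := (Icc (-1 : ℝ) 1 ×ˢ 𝒜.K c₀) ∩ (fun p => φ p.1 p.2) ⁻¹' 𝒜.K c₁ with hQ
    have hQc : IsCompact Q := (isCompact_Icc.prod (𝒜.isCompact c₀ h₀)).inter_right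
      ((𝒜.isCompact c₁ h₁).isClosed.preimage hcont)
    suffices h : ∃ C > 0, ∃ r > 0, ∀ p ∈ Q, 𝒜.FlowEstimateAt φ c₀ c₁ C r p.1 p.2 by
      obtain ⟨C, hC, r, hr, h⟩ := h
      exact ⟨C, hC, r, hr, fun t ht y hy hy' => h (t, y) ⟨⟨ht, hy⟩, hy'⟩⟩
    refine hQc.induction_on (p := fun S => ∃ C > 0, ∃ r > 0, ∀ p ∈ S,
      𝒜.FlowEstimateAt φ c₀ c₁ C r p.1 p.2) ?_ ?_ ?_ ?_
    · exact ⟨1, one_pos, 1, one_pos, by simp⟩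
    · rintro S S' hS ⟨C, hC, r, hr, h⟩
      exact ⟨C, hC, r, hr, fun p hp => h p (hS hp)⟩
    · rintro S S' ⟨C, hC, r, hr, h⟩ ⟨C', hC', r', hr', h'⟩
      refine ⟨max C C', lt_max_of_lt_left hC, min r r', lt_min hr hr', ?_⟩
      rintro p (hp | hp)
      · exact (h p hp).mono (le_max_left _ _) (min_le_left _ _)
      · exact (h' p hp).mono (le_max_right _ _) (min_le_right _ _)
    · rintro ⟨t₀, y₀⟩ ⟨⟨ht₀, hy₀⟩, hφ₀⟩
      obtain ⟨C, hC, N, hN, U, hU, hest⟩ := exists_nhds_chartFlow_estimate hφ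
        (𝒜.subset_source c₀ h₀ hy₀) (𝒜.subset_source c₁ h₁ hφ₀)
      obtain ⟨ε, hε, hεU⟩ := EMetric.mem_nhds_iff.1 hU
      obtain ⟨r, hr, hrε⟩ := exists_ofReal_two_mul_le hε
      have hmem : N ×ˢ (Metric.eball y₀ (ENNReal.ofReal r) ∩ 𝒜.K c₀) ∈ 𝓝[Q] (t₀, y₀) := by
        have h1 : N ×ˢ Metric.eball y₀ (ENNReal.ofReal r) ∈ 𝓝 (t₀, y₀) :=
          prod_mem_nhds hN (Metric.eball_mem_nhds _ (by simpa using hr))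
        filter_upwards [nhdsWithin_le_nhds h1, self_mem_nhdsWithin] with p hp hpQ
        exact ⟨hp.1, hp.2, hpQ.1.2⟩
      -- The factor 1 + `𝒜.C` ^ 2 accounts for replacing the squared chart distance by δ ^ 2.
      refine ⟨_, hmem, C * (1 + 𝒜.C ^ 2), by positivity, r, hr, ?_⟩
      rintro ⟨t, y⟩ ⟨ht, hy, hyK⟩ w
      have hle : ENNReal.ofReal r ≤ ε :=
        (ENNReal.ofReal_le_ofReal (by linarith)).trans hrε
      have hyU : y ∈ U := hεU (lt_of_lt_of_le hy hle)
      have hCC : C ≤ C * (1 + 𝒜.C ^ 2) := by nlinarith [sq_nonneg 𝒜.C]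
      refine ⟨(hest t ht y hyU w).1.trans (by gcongr), fun y' hy' δ hδ hδr hyy' => ?_⟩
      have hyU' : y' ∈ U := by
        refine hεU (lt_of_lt_of_le ?_ hrε)
        change edist y' y₀ < _
        rw [two_mul, ENNReal.ofReal_add hr.le hr.le]
        calc edist y' y₀ ≤ edist y' y + edist y y₀ := edist_triangle _ _ _
          _ < ENNReal.ofReal r + ENNReal.ofReal r := by
            refine ENNReal.add_lt_add_of_le_of_lt ?_ ?_ hy
            · rw [edist_comm]
              exact ne_top_of_le_ne_top ENNReal.ofReal_ne_top hyy'
            rw [edist_comm]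
            exact hyy'.trans (ENNReal.ofReal_le_ofReal hδr)
      refine ((hest t ht y hyU w).2 y' hyU').trans ?_
      have hn := 𝒜.norm_sub_le c₀ h₀ y hyK y' hy' δ hδ hyy'
      set a := ‖extChartAt (𝓡 n) c₀ y' - extChartAt (𝓡 n) c₀ y - chartDeriv c₀ y w‖ with ha
      have ha0 : 0 ≤ a := norm_nonneg _
      have hn2 : ‖extChartAt (𝓡 n) c₀ y' - extChartAt (𝓡 n) c₀ y‖ ^ 2 ≤ 𝒜.C ^ 2 * δ ^ 2 := by
        rw [← mul_pow]
        gcongr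
      calc _ ≤ C * (a + 𝒜.C ^ 2 * δ ^ 2) := by gcongr
        _ ≤ C * ((1 + 𝒜.C ^ 2) * (a + δ ^ 2)) := by
          gcongr
          nlinarith [sq_nonneg δ, mul_nonneg (sq_nonneg 𝒜.C) ha0]
        _ = _ := by ring

/-- The differentials of the time `h` maps, `|h| ≤ 1`, are uniformly bounded. -/
lemma exists_norm_mfderiv_le [CompactSpace X] {φ : ℝ → X → X}
    (hφ : ContMDiff (𝓘(ℝ, ℝ).prod (𝓡 n)) (𝓡 n) ∞ (fun p : ℝ × X => φ p.1 p.2)) :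
    ∃ L : NNReal, 1 ≤ L ∧ ∀ h ∈ Icc (-1 : ℝ) 1, ∀ y, ∀ w : TangentSpace (𝓡 n) y,
      ‖mfderiv (𝓡 n) (𝓡 n) (φ h) y w‖ ≤ L * ‖w‖ := by
  obtain ⟨𝒜, -⟩ := exists_finiteAtlas (n := n) (X := X) (fun _ => univ) (fun _ => univ_mem)
  obtain ⟨C, hC, r, hr, hest⟩ := 𝒜.exists_flowEstimate hφ
  have hA := zero_lt_one.trans_le 𝒜.one_le_C
  refine ⟨max 1 (Real.toNNReal (𝒜.C * (C * 𝒜.C))), le_max_left _ _, fun h hh y w => ?_⟩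
  obtain ⟨c₀, hc₀, hb₀, -⟩ := 𝒜.exists_chart y
  obtain ⟨c₁, hc₁, hb₁, -⟩ := 𝒜.exists_chart (φ h y)
  have hy : y ∈ 𝒜.K c₀ := hb₀ y (by simpa using 𝒜.r_pos)
  have hy₁ : φ h y ∈ 𝒜.K c₁ := hb₁ _ (by simpa using 𝒜.r_pos)
  calc ‖mfderiv (𝓡 n) (𝓡 n) (φ h) y w‖
      ≤ 𝒜.C * ‖chartDeriv c₁ (φ h y) (mfderiv (𝓡 n) (𝓡 n) (φ h) y w)‖ :=
        𝒜.norm_le_chartDeriv c₁ hc₁ _ hy₁ _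
    _ ≤ 𝒜.C * (C * (𝒜.C * ‖w‖)) := by
        gcongr
        refine (hest c₀ hc₀ c₁ hc₁ h hh y hy hy₁ w).1.trans ?_
        gcongr
        exact 𝒜.norm_chartDeriv_le c₀ hc₀ y hy w
    _ = 𝒜.C * (C * 𝒜.C) * ‖w‖ := by ring
    _ ≤ _ := by
        gcongr
        rw [NNReal.coe_max, Real.coe_toNNReal _ (by positivity)]
        exact le_max_right _ _

open Manifold in
omit [IsContinuousRiemannianBundle (EuclideanSpace ℝ (Fin n))
  (fun x : X => TangentSpace (𝓡 n) x)] [IsManifold (𝓡 n) ∞ X] in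
-- The map stretches the length of every curve by at most L; apply this to curves that almost
-- realize the distance. The assumption 1 ≤ L only serves pairs at infinite distance, where the
-- bound must be infinite.
lemma lipschitzWith_of_norm_mfderiv_le {f : X → X} (hf : ContMDiff (𝓡 n) (𝓡 n) 1 f) {L : NNReal}
    (hL1 : 1 ≤ L)
    (hL : ∀ y, ∀ w : TangentSpace (𝓡 n) y, ‖mfderiv (𝓡 n) (𝓡 n) f y w‖ ≤ L * ‖w‖) :
    LipschitzWith L f := by
  intro y y'
  rcases eq_or_ne (edist y y') ⊤ with htop | htop
  · rw [htop, ENNReal.mul_top (by simpa using (zero_lt_one.trans_le hL1).ne')]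
    exact le_top
  have main : ∀ R > edist y y', edist (f y) (f y') ≤ L * R := by
    intro R hR
    have hR' : riemannianEDist (𝓡 n) y y' < R := by
      rwa [← IsRiemannianManifold.out (I := 𝓡 n) y y']
    obtain ⟨γ, hγ0, hγ1, hγ, hlen, -⟩ :=
      exists_lt_locally_constant_of_riemannianEDist_lt hR' zero_lt_one
    rw [IsRiemannianManifold.out (I := 𝓡 n) (f y) (f y')]
    refine (riemannianEDist_le_pathELength (γ := f ∘ γ) (a := 0) (b := 1)
      (hf.comp hγ).contMDiffOn (by simp [hγ0]) (by simp [hγ1]) zero_le_one).trans ?_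
    calc pathELength (𝓡 n) (f ∘ γ) 0 1 ≤ L * pathELength (𝓡 n) γ 0 1 := by
          rw [pathELength_eq_lintegral_mfderiv_Icc, pathELength_eq_lintegral_mfderiv_Icc,
            ← lintegral_const_mul' _ _ ENNReal.coe_ne_top]
          refine setLIntegral_mono' measurableSet_Icc fun t _ => ?_
          rw [mfderiv_comp_apply t (hf.mdifferentiableAt one_ne_zero)
            (hγ.mdifferentiableAt one_ne_zero)]
          have := hL (γ t) (mfderiv 𝓘(ℝ, ℝ) (𝓡 n) γ t 1)
          simp only [enorm]
          exact_mod_cast this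
      _ ≤ L * R := by gcongr
  have hne : (𝓝[>] (edist y y')).NeBot :=
    nhdsGT_neBot_of_exists_gt ⟨⊤, lt_of_le_of_ne le_top htop⟩
  refine ge_of_tendsto (x := 𝓝[>] (edist y y')) (f := fun R => (L : ℝ≥0∞) * R) ?_ ?_
  · exact ((ENNReal.continuous_const_mul ENNReal.coe_ne_top).tendsto _).mono_left
      nhdsWithin_le_nhds
  · filter_upwards [self_mem_nhdsWithin] with R hR using main R hR

/-- A smooth flow is Lipschitz, with a constant that grows at most exponentially. -/
lemma exists_edist_flow_le [CompactSpace X] {φ : ℝ → X → X}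
    (hφ : ContMDiff (𝓘(ℝ, ℝ).prod (𝓡 n)) (𝓡 n) ∞ (fun p : ℝ × X => φ p.1 p.2))
    (h0 : ∀ x, φ 0 x = x) (hadd : ∀ s t x, φ (s + t) x = φ s (φ t x)) :
    ∃ Λ : ℝ, 0 ≤ Λ ∧ ∀ t, LipschitzWith (Real.toNNReal (Real.exp (Λ * (|t| + 1)))) (φ t) := by
  obtain ⟨L, hL1, hL⟩ := exists_norm_mfderiv_le hφ
  have hstep : ∀ h ∈ Icc (-1 : ℝ) 1, LipschitzWith L (φ h) := fun h hh =>
    lipschitzWith_of_norm_mfderiv_le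
      ((contMDiff_of_contMDiff_uncurry hφ h).of_le (by exact_mod_cast le_top)) hL1 (hL h hh)
  have hiter : ∀ h ∈ Icc (-1 : ℝ) 1, ∀ k : ℕ, LipschitzWith (L ^ k) (φ (k * h)) := by
    intro h hh k
    induction k with
    | zero =>
      have : φ ((0 : ℕ) * h) = id := by
        funext x
        simp [h0]
      rw [this, pow_zero]
      exact LipschitzWith.id
    | succ k ih =>
      have : φ ((k + 1 : ℕ) * h) = φ h ∘ φ (k * h) := by
        funext x
        rw [Function.comp_apply, ← hadd]
        push_cast
        ring_nf
      rw [this, pow_succ']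
      exact (hstep h hh).comp ih
  have hLr : (1 : ℝ) ≤ L := by exact_mod_cast hL1
  refine ⟨Real.log L, Real.log_nonneg hLr, fun t => ?_⟩
  -- The time t is split into k steps of length at most 1; the +1 in the exponent pays for rounding
  -- up. For t = 0 there are no steps and t / k = 0.
  set k := ⌈|t|⌉₊ with hk
  have hkt : |t| ≤ k := Nat.le_ceil _
  have hkt' : (k : ℝ) ≤ |t| + 1 := (Nat.ceil_lt_add_one (abs_nonneg t)).le
  have ht : t = k * (t / k) := by
    rcases eq_or_ne (k : ℝ) 0 with h | h
    · have : |t| = 0 := le_antisymm (by rwa [h] at hkt) (abs_nonneg t)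
      rw [abs_eq_zero.1 this]
      simp
    · field_simp
  have hmem : t / k ∈ Icc (-1 : ℝ) 1 := by
    rw [mem_Icc, ← abs_le, abs_div, Nat.abs_cast]
    exact div_le_one_of_le₀ hkt (Nat.cast_nonneg k)
  have := hiter _ hmem k
  rw [← ht] at this
  refine this.weaken ?_
  rw [← NNReal.coe_le_coe, Real.coe_toNNReal _ (Real.exp_pos _).le, NNReal.coe_pow]
  calc (L : ℝ) ^ k = Real.exp (Real.log L * k) := by
        rw [Real.exp_mul, Real.exp_log (by linarith), Real.rpow_natCast]
    _ ≤ _ := by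
        gcongr
        exact Real.log_nonneg hLr

/-- The pullback of a smooth density by a smooth flow is dominated by the density, with a constant
that grows at most exponentially. -/
lemma IsSmoothDensity.exists_map_flow_le [CompactSpace X] [MeasurableSpace X] [BorelSpace X]
    {μ : Measure X} (hμ : IsSmoothDensity (n := n) μ) {φ : ℝ → X → X}
    (hφ : ContMDiff (𝓘(ℝ, ℝ).prod (𝓡 n)) (𝓡 n) ∞ (fun p : ℝ × X => φ p.1 p.2))
    (h0 : ∀ x, φ 0 x = x) (hadd : ∀ s t x, φ (s + t) x = φ s (φ t x)) :
    ∃ Λ : ℝ, 0 ≤ Λ ∧ ∀ t,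
      μ.map (φ t) ≤ ENNReal.ofReal (Real.exp (Λ * (|t| + 1))) • μ := by
  obtain ⟨Λ, hΛ, hlip⟩ := exists_edist_flow_le hφ h0 hadd
  obtain ⟨C, hC, hC'⟩ := hμ.exists_comparable_hausdorff
  refine ⟨2 * C + n * Λ, by positivity, fun t => Measure.le_iff.2 fun A hA => ?_⟩
  have hcont : Continuous (φ t) := (contMDiff_of_contMDiff_uncurry hφ t).continuous
  rw [Measure.map_apply hcont.measurable hA]
  -- A preimage under the flow is an image under the reversed flow, so the Lipschitz bound controls
  -- its Hausdorff measure. The two comparison constants are absorbed by the summand 2 C of the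
  -- exponent.
  have hsub : φ t ⁻¹' A ⊆ φ (-t) '' A := fun x hx =>
    ⟨φ t x, hx, by rw [← hadd, neg_add_cancel, h0]⟩
  have hle := euclideanHausdorffMeasure_image_le_of_lipschitzOnWith
    ((hlip (-t)).lipschitzOnWith (s := A)) n
  rw [abs_neg] at hle
  have hCexp : (C : ℝ) ≤ Real.exp (C * (|t| + 1)) := by
    have h1 := Real.add_one_le_exp ((C : ℝ) * (|t| + 1))
    have h2 : (0 : ℝ) ≤ C * |t| := by positivity
    nlinarith
  calc μ (φ t ⁻¹' A) ≤ μ (φ (-t) '' A) := measure_mono hsub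
    _ ≤ C * μHE[n] (φ (-t) '' A) := hC _
    _ ≤ C * (ENNReal.ofReal (Real.exp (Λ * (|t| + 1))) ^ n * (C * μ A)) := by
        gcongr
        exact hle.trans (by gcongr; exacts [le_rfl, hC' A])
    _ = ENNReal.ofReal (C * C * Real.exp (Λ * (|t| + 1)) ^ n) * μ A := by
        rw [ENNReal.ofReal_mul (by positivity), ENNReal.ofReal_mul (by positivity),
          ENNReal.ofReal_coe_nnreal, ENNReal.ofReal_pow (Real.exp_pos _).le]
        ring
    _ ≤ _ := by
        rw [Measure.smul_apply, smul_eq_mul]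
        gcongr
        calc (C : ℝ) * C * Real.exp (Λ * (|t| + 1)) ^ n
            ≤ Real.exp (C * (|t| + 1)) * Real.exp (C * (|t| + 1)) *
              Real.exp (Λ * (|t| + 1)) ^ n := by gcongr
          _ = _ := by
            rw [← Real.exp_nat_mul, ← Real.exp_add, ← Real.exp_add]
            congr 1
            ring

/-- The second order Taylor estimate in charts for the time `t` map, with constants that are
exponential in `t`. -/
lemma FiniteAtlas.exists_flow_taylor [CompactSpace X] (𝒜 : FiniteAtlas n X) {φ : ℝ → X → X}
    (hφ : ContMDiff (𝓘(ℝ, ℝ).prod (𝓡 n)) (𝓡 n) ∞ (fun p : ℝ × X => φ p.1 p.2))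
    (h0 : ∀ x, φ 0 x = x) (hadd : ∀ s t x, φ (s + t) x = φ s (φ t x)) :
    ∃ Λ > 0, ∃ r > 0, ∀ t, 0 ≤ t → ∀ c₀ ∈ 𝒜.s, ∀ c₁ ∈ 𝒜.s, ∀ y ∈ 𝒜.K c₀, ∀ y' ∈ 𝒜.K c₀,
      ∀ δ, 0 ≤ δ → Real.exp (Λ * (t + 1)) * δ ≤ r → edist y y' ≤ ENNReal.ofReal δ →
      ∀ w : TangentSpace (𝓡 n) y,
        chartDeriv c₀ y w = extChartAt (𝓡 n) c₀ y' - extChartAt (𝓡 n) c₀ y →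
        φ t y ∈ 𝒜.K c₁ →
        ‖extChartAt (𝓡 n) c₁ (φ t y') - extChartAt (𝓡 n) c₁ (φ t y) -
          chartDeriv c₁ (φ t y) (mfderiv (𝓡 n) (𝓡 n) (φ t) y w)‖ ≤
          Real.exp (Λ * (t + 1)) * δ ^ 2 := by
  obtain ⟨C, hC, r, hr, hest⟩ := 𝒜.exists_flowEstimate hφ
  obtain ⟨Λ, hΛ, hlip⟩ := exists_edist_flow_le hφ h0 hadd
  -- Each step turns an error e into at most C (e + δ' ^ 2), where δ' is the separation reached by
  -- then. This B exceeds 2 C and the square of the growth factor of δ' per step, so the bound by B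
  -- ^ (k + 1) δ ^ 2 propagates.
  set B := 2 * C + Real.exp (2 * Λ) + 1 with hB
  have hE : 0 < Real.exp (2 * Λ) := Real.exp_pos _
  have hB1 : 1 ≤ B := by linarith
  -- The bound `𝒜.r` / 2 on the separation keeps both orbits in a common chart at every intermediate
  -- step.
  have hr₁ : 0 < min r (𝒜.r / 2) := lt_min hr (half_pos 𝒜.r_pos)
  have main : ∀ h ∈ Icc (0 : ℝ) 1, ∀ c₀ ∈ 𝒜.s, ∀ y ∈ 𝒜.K c₀, ∀ y' ∈ 𝒜.K c₀,
      ∀ δ, 0 ≤ δ → edist y y' ≤ ENNReal.ofReal δ → ∀ w : TangentSpace (𝓡 n) y,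
      chartDeriv c₀ y w = extChartAt (𝓡 n) c₀ y' - extChartAt (𝓡 n) c₀ y → ∀ k : ℕ,
      Real.exp (Λ * (k + 1)) * δ ≤ min r (𝒜.r / 2) → ∀ c₁ ∈ 𝒜.s, φ (k * h) y ∈ 𝒜.K c₁ →
      ‖extChartAt (𝓡 n) c₁ (φ (k * h) y') - extChartAt (𝓡 n) c₁ (φ (k * h) y) -
          chartDeriv c₁ (φ (k * h) y) (mfderiv (𝓡 n) (𝓡 n) (φ (k * h)) y w)‖ ≤
          B ^ (k + 1) * δ ^ 2 := by
    intro h hh c₀ hc₀ y hy y' hy' δ hδ hyy' w hw k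
    have hh' : h ∈ Icc (-1 : ℝ) 1 := ⟨by linarith [hh.1], hh.2⟩
    induction k with
    -- Even at time 0 there is a quadratic error, since the identity is expressed in two different
    -- charts.
    | zero =>
      intro hδr c₁ hc₁ hyc
      have hz : ((0 : ℕ) : ℝ) * h = 0 := by simp
      rw [hz] at hyc ⊢
      have h1 : δ ≤ r := by
        refine le_trans ?_ (hδr.trans (min_le_left _ _))
        exact le_mul_of_one_le_left hδ (Real.one_le_exp (by positivity))
      refine ((hest c₀ hc₀ c₁ hc₁ 0 (by simp) y hy hyc w).2 y' hy' δ hδ h1 hyy').trans ?_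
      rw [hw, sub_self, norm_zero, zero_add, zero_add, pow_one]
      gcongr
      linarith
    | succ k ih =>
      intro hδr c₁ hc₁ hyc
      have hmono : Real.exp (Λ * (k + 1)) * δ ≤ min r (𝒜.r / 2) := by
        refine le_trans ?_ hδr
        gcongr
        linarith
      have hcomp : φ ((k + 1 : ℕ) * h) = φ h ∘ φ (k * h) := by
        funext x
        rw [Function.comp_apply, ← hadd]
        push_cast
        ring_nf
      rw [hcomp] at hyc ⊢
      have hd : MDifferentiableAt (𝓡 n) (𝓡 n) (φ (k * h)) y :=
        (contMDiff_of_contMDiff_uncurry hφ _).contMDiffAt.mdifferentiableAt (by simp)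
      have hd' : MDifferentiableAt (𝓡 n) (𝓡 n) (φ h) (φ (k * h) y) :=
        (contMDiff_of_contMDiff_uncurry hφ _).contMDiffAt.mdifferentiableAt (by simp)
      rw [mfderiv_comp_apply y hd' hd]
      simp only [Function.comp_apply] at hyc ⊢
      obtain ⟨c, hc, hball, -⟩ := 𝒜.exists_chart (φ (k * h) y)
      set δ' := Real.exp (Λ * (k + 1)) * δ with hδ'
      have hδ'0 : 0 ≤ δ' := by positivity
      have hdist : edist (φ (k * h) y) (φ (k * h) y') ≤ ENNReal.ofReal δ' := by
        refine (hlip (k * h) y y').trans ?_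
        rw [hδ', ENNReal.ofReal_mul (Real.exp_pos _).le]
        refine mul_le_mul' (ENNReal.ofReal_le_ofReal ?_) hyy'
        gcongr
        rw [abs_of_nonneg (mul_nonneg (Nat.cast_nonneg k) hh.1)]
        exact mul_le_of_le_one_right (Nat.cast_nonneg k) hh.2
      have hlt : δ' < 𝒜.r :=
        lt_of_le_of_lt (hmono.trans (min_le_right _ _)) (half_lt_self 𝒜.r_pos)
      have hym : φ (k * h) y ∈ 𝒜.K c := hball _ (by simpa using 𝒜.r_pos)
      have hym' : φ (k * h) y' ∈ 𝒜.K c :=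
        hball _ (hdist.trans_lt ((ENNReal.ofReal_lt_ofReal_iff 𝒜.r_pos).2 hlt))
      have hind := ih hmono c hc hym
      have hnew := (hest c hc c₁ hc₁ h hh' _ hym hyc
        (mfderiv (𝓡 n) (𝓡 n) (φ (k * h)) y w)).2 _ hym' δ' hδ'0
        (hmono.trans (min_le_left _ _)) hdist
      refine hnew.trans ?_
      have hsq : δ' ^ 2 ≤ B ^ (k + 1) * δ ^ 2 := by
        rw [hδ', mul_pow]
        gcongr
        calc Real.exp (Λ * (k + 1)) ^ 2 = Real.exp (2 * Λ) ^ (k + 1) := by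
              rw [← Real.exp_nat_mul, ← Real.exp_nat_mul]
              congr 1
              push_cast
              ring
          _ ≤ B ^ (k + 1) := by gcongr; linarith
      calc C * (_ + δ' ^ 2) ≤ C * (B ^ (k + 1) * δ ^ 2 + B ^ (k + 1) * δ ^ 2) := by gcongr
        _ = (2 * C) * (B ^ (k + 1) * δ ^ 2) := by ring
        _ ≤ B * (B ^ (k + 1) * δ ^ 2) := by gcongr; linarith
        _ = B ^ (k + 1 + 1) * δ ^ 2 := by ring
  have hlogB : 0 ≤ Real.log B := Real.log_nonneg hB1
  -- The number k of steps is at most t + 1, so k + 1 ≤ 2 (t + 1); this explains the factor 2.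
  refine ⟨2 * (Λ + Real.log B + 1), by positivity, min r (𝒜.r / 2), hr₁, ?_⟩
  intro t ht c₀ hc₀ c₁ hc₁ y hy y' hy' δ hδ hδr hyy' w hw hyc
  set k := ⌈t⌉₊ with hk
  have hkt : t ≤ k := Nat.le_ceil _
  have hkt' : (k : ℝ) ≤ t + 1 := (Nat.ceil_lt_add_one ht).le
  have htk : t = k * (t / k) := by
    rcases eq_or_ne (k : ℝ) 0 with h | h
    · rw [h] at hkt
      rw [le_antisymm hkt ht]
      simp
    · field_simp
  have hmem : t / k ∈ Icc (0 : ℝ) 1 :=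
    ⟨by positivity, div_le_one_of_le₀ hkt (Nat.cast_nonneg k)⟩
  have hδr' : Real.exp (Λ * (k + 1)) * δ ≤ min r (𝒜.r / 2) := by
    refine le_trans (mul_le_mul_of_nonneg_right (Real.exp_le_exp.2 ?_) hδ) hδr
    nlinarith [mul_le_mul_of_nonneg_left hkt' hΛ, mul_nonneg hΛ ht, mul_nonneg hlogB ht]
  have := main _ hmem c₀ hc₀ y hy y' hy' δ hδ hyy' w hw k hδr' c₁ hc₁ (by rwa [← htk])
  rw [← htk] at this
  refine this.trans ?_
  gcongr
  calc B ^ (k + 1) = Real.exp (Real.log B * (k + 1)) := by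
        rw [Real.exp_mul, Real.exp_log (by linarith)]
        exact_mod_cast (Real.rpow_natCast B (k + 1)).symm
    _ ≤ _ := by
        refine Real.exp_le_exp.2 ?_
        nlinarith [mul_le_mul_of_nonneg_left hkt' hlogB, mul_nonneg hΛ ht, mul_nonneg hlogB ht]

end FlowEstimates

/-! ### Linear algebra of the hyperbolic estimate -/

/-- The numbers stand for the sizes of the unstable part u, the stable part w and the whole v of a
tangent vector, the residual r of the linearized return equation, the time shift s, the flow
coefficient a and the value l of the transversal functional. The parameter η measures how much the
splitting varies between a point and its return, and is chosen so small that the v-terms on the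
right can be absorbed. -/
lemma exists_hyperbolic_estimate {C c : ℝ} (hC : 0 < C) (hc : 0 < c) :
    ∃ K > 0, ∃ η > 0, ∀ u w v r s a l : ℝ, 0 ≤ u → 0 ≤ w → 0 ≤ v → 0 ≤ r → 0 ≤ s → 0 ≤ a →
      0 ≤ l → u ≤ C * r + η * v → w ≤ 2 * (C * r + η * v) →
      c * s ≤ C * r + η * v + η * a → c * a ≤ l + C * (u + w) → v ≤ C * a + w + u →
      s + v ≤ K * (l + r) := by
  -- after scaling, everything is controlled by `l`, `r` and a small multiple of `v`
  set D : ℝ := 3 * C ^ 2 / c + 3 with hD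
  have hD0 : 0 < D := by positivity
  set η : ℝ := 1 / (2 * D) with hη
  have hη0 : 0 < η := by positivity
  set M : ℝ := 2 * (C / c + D * C) with hM
  have hM0 : 0 < M := by positivity
  set A : ℝ := (1 + 3 * C * (C + η * M)) / c with hAdef
  have hA0 : 0 < A := by positivity
  refine ⟨M + (C + η * M + η * A) / c, by positivity, η, hη0, ?_⟩
  intro u w v r s a l hu hw hv hr hs ha hl h1 h2 h3 h4 h5
  have huw : u + w ≤ 3 * (C * r + η * v) := by linarith
  have ha' : a ≤ (l + 3 * C * (C * r + η * v)) / c := by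
    rw [le_div_iff₀ hc]
    nlinarith
  have hv1 : v ≤ C / c * l + D * (C * r + η * v) := by
    calc v ≤ C * a + (u + w) := by linarith
      _ ≤ C * ((l + 3 * C * (C * r + η * v)) / c) + 3 * (C * r + η * v) := by gcongr
      _ = _ := by rw [hD]; field_simp; ring
  have hDη : D * η = 1 / 2 := by rw [hη]; field_simp
  have hv2 : v ≤ M * (l + r) := by
    have : v ≤ C / c * l + D * C * r + 1 / 2 * v := by
      calc v ≤ _ := hv1
        _ = C / c * l + D * C * r + D * η * v := by ring
        _ = _ := by rw [hDη]
    have e1 : 0 ≤ C / c * r := by positivity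
    have e2 : 0 ≤ D * C * l := by positivity
    rw [hM]
    nlinarith
  have hrl : r ≤ l + r := by linarith
  have hll : l ≤ l + r := by linarith
  have hsum : C * r + η * v ≤ (C + η * M) * (l + r) := by
    calc C * r + η * v ≤ C * (l + r) + η * (M * (l + r)) := by gcongr
      _ = _ := by ring
  have ha2 : a ≤ A * (l + r) := by
    refine ha'.trans ?_
    have hA' : A * (l + r) = (1 + 3 * C * (C + η * M)) * (l + r) / c := by
      rw [hAdef]
      ring
    rw [hA']
    refine div_le_div_of_nonneg_right ?_ hc.le
    calc l + 3 * C * (C * r + η * v) ≤ (l + r) + 3 * C * ((C + η * M) * (l + r)) := by gcongr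
      _ = _ := by ring
  have hs2 : s ≤ (C + η * M + η * A) / c * (l + r) := by
    rw [div_mul_eq_mul_div, le_div_iff₀ hc]
    calc s * c = c * s := mul_comm _ _
      _ ≤ (C * r + η * v) + η * a := h3
      _ ≤ (C + η * M) * (l + r) + η * (A * (l + r)) := by gcongr
      _ = _ := by ring
  calc s + v ≤ (C + η * M + η * A) / c * (l + r) + M * (l + r) := add_le_add hs2 hv2
    _ = _ := by ring

lemma sum_eq_sum_of_isInternal {M : Type*} [AddCommGroup M] [Module ℝ M]
    {A B C : Submodule ℝ M} (h : DirectSum.IsInternal ![A, B, C]) {a a' b b' c c' : M}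
    (ha : a ∈ A) (ha' : a' ∈ A) (hb : b ∈ B) (hb' : b' ∈ B) (hc : c ∈ C) (hc' : c' ∈ C)
    (heq : a + b + c = a' + b' + c') : a = a' ∧ b = b' ∧ c = c' := by
  have hind := (iSupIndep_iff_finsetSum_eq_zero_imp_eq_zero _).1 h.submodule_iSupIndep
    Finset.univ ![a - a', b - b', c - c']
  have hmem : ∀ i ∈ Finset.univ, ![a - a', b - b', c - c'] i ∈ ![A, B, C] i := by
    intro i _
    fin_cases i
    · exact A.sub_mem ha ha'
    · exact B.sub_mem hb hb'
    · exact C.sub_mem hc hc'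
  have hsum : ∑ i, ![a - a', b - b', c - c'] i = 0 := by
    simp only [Fin.sum_univ_three, Matrix.cons_val_zero, Matrix.cons_val_one, Matrix.cons_val]
    rw [← sub_eq_zero] at heq
    rw [← heq]
    abel
  have h0 := hind hmem hsum
  exact ⟨sub_eq_zero.1 (h0 0 (Finset.mem_univ _)), sub_eq_zero.1 (h0 1 (Finset.mem_univ _)),
    sub_eq_zero.1 (h0 2 (Finset.mem_univ _))⟩

/-! ### Continuous bundle maps and sections in charts -/

section Bundle

variable {n : ℕ} {X : Type*} [EMetricSpace X] [ChartedSpace (EuclideanSpace ℝ (Fin n)) X]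
  [IsManifold (𝓡 n) ∞ X]

lemma mem_baseSet_iff {c y : X} :
    y ∈ (trivializationAt (EuclideanSpace ℝ (Fin n)) (TangentSpace (𝓡 n)) c).baseSet ↔
      y ∈ (extChartAt (𝓡 n) c).source := by
  rw [extChartAt_source]
  simp

lemma chartDeriv_apply {c y : X} (hy : y ∈ (extChartAt (𝓡 n) c).source)
    (w : TangentSpace (𝓡 n) y) : chartDeriv c y w =
      (trivializationAt (EuclideanSpace ℝ (Fin n)) (TangentSpace (𝓡 n)) c
        (⟨y, w⟩ : TangentBundle (𝓡 n) X)).2 := by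
  rw [← mem_baseSet_iff] at hy
  exact Trivialization.continuousLinearMapAt_apply_of_mem _ _ hy w

/-- In a chart, a continuous fiberwise map of the tangent bundle is continuous. -/
lemma continuousOn_chartDeriv_bundleMap
    {P : (x : X) → TangentSpace (𝓡 n) x → TangentSpace (𝓡 n) x}
    (hP : Continuous (fun w : TangentBundle (𝓡 n) X =>
      (⟨w.proj, P w.proj w.snd⟩ : TangentBundle (𝓡 n) X))) (c : X) :
    ContinuousOn (fun p : X × EuclideanSpace ℝ (Fin n) =>
      chartDeriv c p.1 (P p.1 (chartDerivSymm c p.1 p.2)))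
      ((extChartAt (𝓡 n) c).source ×ˢ univ) := by
  set e := trivializationAt (EuclideanSpace ℝ (Fin n)) (TangentSpace (𝓡 n) : X → Type _) c with he
  have h1 := e.continuousOn_symm
  have h2 := hP.comp_continuousOn h1
  have h3 : ContinuousOn e e.source := e.continuousOn
  have h4 := h3.comp h2 (by
    rintro ⟨y, v⟩ ⟨hy, -⟩
    rw [e.mem_source]
    exact hy)
  have h5 := continuous_snd.comp_continuousOn h4
  have hs : e.baseSet = (extChartAt (𝓡 n) c).source := by
    ext y
    exact mem_baseSet_iff
  rw [hs] at h5
  refine h5.congr ?_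
  rintro ⟨y, v⟩ ⟨hy, -⟩
  have hy' : y ∈ e.baseSet := by rwa [hs]
  simp only [Function.comp_apply]
  rw [chartDeriv_apply hy, chartDerivSymm, Trivialization.symmL_apply _ hy']

lemma continuousOn_chartDeriv_section {V : (x : X) → TangentSpace (𝓡 n) x}
    (hV : Continuous (fun x => (⟨x, V x⟩ : TangentBundle (𝓡 n) X))) (c : X) :
    ContinuousOn (fun y => chartDeriv c y (V y)) (extChartAt (𝓡 n) c).source := by
  set e := trivializationAt (EuclideanSpace ℝ (Fin n)) (TangentSpace (𝓡 n) : X → Type _) c with he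
  have h3 : ContinuousOn e e.source := e.continuousOn
  have h4 := h3.comp (s := (extChartAt (𝓡 n) c).source) hV.continuousOn (by
    intro y hy
    rw [e.mem_source]
    exact mem_baseSet_iff.2 hy)
  refine (continuous_snd.comp_continuousOn h4).congr ?_
  intro y hy
  exact chartDeriv_apply hy (V y)

/-- Continuity on the compact product of K with the unit ball gives a bound there, and linearity
scales it to all vectors. -/
lemma exists_bound_bundleMap {P : (x : X) → TangentSpace (𝓡 n) x →ₗ[ℝ] TangentSpace (𝓡 n) x}
    (hP : Continuous (fun w : TangentBundle (𝓡 n) X =>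
      (⟨w.proj, P w.proj w.snd⟩ : TangentBundle (𝓡 n) X))) {c : X} {K : Set X}
    (hK : IsCompact K) (hKc : K ⊆ (extChartAt (𝓡 n) c).source) :
    ∃ C > 0, ∀ y ∈ K, ∀ w : TangentSpace (𝓡 n) y,
      ‖chartDeriv c y (P y w)‖ ≤ C * ‖chartDeriv c y w‖ := by
  have hcont := (continuousOn_chartDeriv_bundleMap (P := fun x => P x) hP c).mono
    (prod_mono hKc (subset_univ (Metric.closedBall (0 : EuclideanSpace ℝ (Fin n)) 1)))
  obtain ⟨C, hC⟩ := (hK.prod (isCompact_closedBall _ _)).exists_bound_of_continuousOn hcont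
  refine ⟨max C 1, by positivity, fun y hy w => ?_⟩
  set v := chartDeriv c y w with hv
  have hw : w = chartDerivSymm c y v := (chartDerivSymm_chartDeriv (hKc hy) w).symm
  rcases eq_or_ne ‖v‖ 0 with h0 | h0
  · rw [hw, norm_eq_zero.1 h0]
    simp
  · have hmem : (y, ‖v‖⁻¹ • v) ∈ K ×ˢ Metric.closedBall (0 : EuclideanSpace ℝ (Fin n)) 1 := by
      refine ⟨hy, ?_⟩
      simp [norm_smul, h0]
    have := hC _ hmem
    simp only [map_smul] at this
    rw [← hw, norm_smul, norm_inv, norm_norm, inv_mul_le_iff₀ (by positivity)] at this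
    rw [mul_comm]
    exact this.trans (by gcongr; exact le_max_left _ _)

/-- Tangent vectors at two points are compared by giving them the same chart coordinates. The rest
is uniform continuity on K times the unit ball, scaled by linearity. -/
lemma exists_modulus_bundleMap {P : (x : X) → TangentSpace (𝓡 n) x →ₗ[ℝ] TangentSpace (𝓡 n) x}
    (hP : Continuous (fun w : TangentBundle (𝓡 n) X =>
      (⟨w.proj, P w.proj w.snd⟩ : TangentBundle (𝓡 n) X))) {c : X} {K : Set X}
    (hK : IsCompact K) (hKc : K ⊆ (extChartAt (𝓡 n) c).source) {η : ℝ} (hη : 0 < η) :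
    ∃ ε > 0, ∀ y ∈ K, ∀ y' ∈ K, edist y y' ≤ ENNReal.ofReal ε → ∀ (w : TangentSpace (𝓡 n) y)
      (w' : TangentSpace (𝓡 n) y'), chartDeriv c y' w' = chartDeriv c y w →
      ‖chartDeriv c y' (P y' w') - chartDeriv c y (P y w)‖ ≤ η * ‖chartDeriv c y w‖ := by
  have hcont := (continuousOn_chartDeriv_bundleMap (P := fun x => P x) hP c).mono
    (prod_mono hKc (subset_univ (Metric.closedBall (0 : EuclideanSpace ℝ (Fin n)) 1)))
  obtain ⟨δ, hδ, huc⟩ := EMetric.uniformContinuousOn_iff.1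
    ((hK.prod (isCompact_closedBall _ _)).uniformContinuousOn_of_continuous hcont)
    (ENNReal.ofReal η) (by simpa using hη)
  obtain ⟨ε, hε, hεδ⟩ := exists_ofReal_two_mul_le hδ
  have hlt : ENNReal.ofReal ε < δ := lt_of_lt_of_le
    ((ENNReal.ofReal_lt_ofReal_iff (by positivity)).2 (by linarith)) hεδ
  refine ⟨ε, hε, fun y hy y' hy' hyy' w w' hww' => ?_⟩
  set v := chartDeriv c y w with hv
  have hw : w = chartDerivSymm c y v := (chartDerivSymm_chartDeriv (hKc hy) w).symm
  have hw' : w' = chartDerivSymm c y' v := by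
    rw [← hww', chartDerivSymm_chartDeriv (hKc hy')]
  rcases eq_or_ne ‖v‖ 0 with h0 | h0
  · rw [hw, hw', norm_eq_zero.1 h0]
    simp
  · have hb : ‖v‖⁻¹ • v ∈ Metric.closedBall (0 : EuclideanSpace ℝ (Fin n)) 1 := by
      simp [norm_smul, h0]
    have := huc (a := (y', ‖v‖⁻¹ • v)) ⟨hy', hb⟩ (b := (y, ‖v‖⁻¹ • v)) ⟨hy, hb⟩ (by
      rw [Prod.edist_eq, edist_self, max_eq_left (by simp), edist_comm]
      exact hyy'.trans_lt hlt)
    rw [edist_dist, ENNReal.ofReal_lt_ofReal_iff hη, dist_eq_norm] at this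
    simp only [map_smul] at this
    rw [← hw, ← hw', ← smul_sub, norm_smul, norm_inv, norm_norm,
      inv_mul_lt_iff₀ (by positivity)] at this
    rw [mul_comm]
    exact this.le

lemma exists_modulus_section {V : (x : X) → TangentSpace (𝓡 n) x}
    (hV : Continuous (fun x => (⟨x, V x⟩ : TangentBundle (𝓡 n) X))) {c : X} {K : Set X}
    (hK : IsCompact K) (hKc : K ⊆ (extChartAt (𝓡 n) c).source) {η : ℝ} (hη : 0 < η) :
    ∃ ε > 0, ∀ y ∈ K, ∀ y' ∈ K, edist y y' ≤ ENNReal.ofReal ε →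
      ‖chartDeriv c y' (V y') - chartDeriv c y (V y)‖ ≤ η := by
  obtain ⟨δ, hδ, huc⟩ := EMetric.uniformContinuousOn_iff.1
    (hK.uniformContinuousOn_of_continuous ((continuousOn_chartDeriv_section hV c).mono hKc))
    (ENNReal.ofReal η) (by simpa using hη)
  obtain ⟨ε, hε, hεδ⟩ := exists_ofReal_two_mul_le hδ
  have hlt : ENNReal.ofReal ε < δ := lt_of_lt_of_le
    ((ENNReal.ofReal_lt_ofReal_iff (by positivity)).2 (by linarith)) hεδ
  refine ⟨ε, hε, fun y hy y' hy' hyy' => ?_⟩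
  have := huc hy' hy (by rw [edist_comm]; exact hyy'.trans_lt hlt)
  rw [edist_dist, ENNReal.ofReal_lt_ofReal_iff hη, dist_eq_norm] at this
  exact this.le

end Bundle

/-! ### Hyperbolicity of Anosov flows -/

section Anosov

variable {n : ℕ} {X : Type*} [EMetricSpace X] [ChartedSpace (EuclideanSpace ℝ (Fin n)) X]
  [IsManifold (𝓡 n) ∞ X] [RiemannianBundle (fun x : X => TangentSpace (𝓡 n) x)]

/-- The projections that belong to the splitting of an Anosov flow (the flow direction, the stable
and the unstable one), with their relevant properties. -/
structure IsHyperbolicSplitting (V : (x : X) → TangentSpace (𝓡 n) x) (φ : ℝ → X → X)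
    (P₀ P₁ P₂ : (x : X) → TangentSpace (𝓡 n) x →ₗ[ℝ] TangentSpace (𝓡 n) x) (C θ : ℝ) : Prop where
  C_pos : 0 < C
  θ_pos : 0 < θ
  add_eq : ∀ x w, P₀ x w + P₁ x w + P₂ x w = w
  exists_smul : ∀ x w, ∃ a : ℝ, P₀ x w = a • V x
  proj₀_field : ∀ x, P₀ x (V x) = V x
  proj₁_field : ∀ x, P₁ x (V x) = 0
  proj₂_field : ∀ x, P₂ x (V x) = 0
  comm₀ : ∀ t x w, mfderiv (𝓡 n) (𝓡 n) (φ t) x (P₀ x w) =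
    P₀ (φ t x) (mfderiv (𝓡 n) (𝓡 n) (φ t) x w)
  comm₁ : ∀ t x w, mfderiv (𝓡 n) (𝓡 n) (φ t) x (P₁ x w) =
    P₁ (φ t x) (mfderiv (𝓡 n) (𝓡 n) (φ t) x w)
  comm₂ : ∀ t x w, mfderiv (𝓡 n) (𝓡 n) (φ t) x (P₂ x w) =
    P₂ (φ t x) (mfderiv (𝓡 n) (𝓡 n) (φ t) x w)
  stable : ∀ t > 0, ∀ x w,
    ‖mfderiv (𝓡 n) (𝓡 n) (φ t) x (P₁ x w)‖ ≤ C * Real.exp (-θ * t) * ‖P₁ x w‖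
  unstable : ∀ t > 0, ∀ x w,
    ‖P₂ x w‖ ≤ C * Real.exp (-θ * t) * ‖mfderiv (𝓡 n) (𝓡 n) (φ t) x (P₂ x w)‖
  continuous₀ : Continuous (fun w : TangentBundle (𝓡 n) X =>
    (⟨w.proj, P₀ w.proj w.snd⟩ : TangentBundle (𝓡 n) X))
  continuous₁ : Continuous (fun w : TangentBundle (𝓡 n) X =>
    (⟨w.proj, P₁ w.proj w.snd⟩ : TangentBundle (𝓡 n) X))
  continuous₂ : Continuous (fun w : TangentBundle (𝓡 n) X =>
    (⟨w.proj, P₂ w.proj w.snd⟩ : TangentBundle (𝓡 n) X))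

omit [RiemannianBundle (fun x : X => TangentSpace (𝓡 n) x)] in
/-- The differential of a flow maps the generating vector field to itself. -/
lemma IsSmoothFlow.mfderiv_field {V : (x : X) → TangentSpace (𝓡 n) x} {φ : ℝ → X → X}
    (hφ : IsSmoothFlow V φ) (t : ℝ) (x : X) :
    mfderiv (𝓡 n) (𝓡 n) (φ t) x (V x) = V (φ t x) := by
  have hcurve : ∀ g : ℝ → X, (g = fun a => φ (t + a) x) →
      HasMFDerivAt 𝓘(ℝ, ℝ) (𝓡 n) g 0 ((1 : ℝ →L[ℝ] ℝ).smulRight (V (g 0))) := by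
    rintro _ rfl
    have h1 := hφ.integralCurve x (t + 0)
    have h2 : HasMFDerivAt 𝓘(ℝ, ℝ) 𝓘(ℝ, ℝ) (fun a : ℝ => t + a) 0
        (ContinuousLinearMap.id ℝ ℝ) := ((hasFDerivAt_id (0 : ℝ)).const_add t).hasMFDerivAt
    exact h1.comp (0 : ℝ) h2
  -- The curve a ↦ φ_t(φ_a x) = φ_{t+a}(x) is differentiated at 0 in two ways: as an integral curve
  -- here, and by the chain rule in `h2`.
  have h1 := hcurve (fun a => φ t (φ a x)) (by funext a; exact (hφ.add t a x).symm)
  have hd : HasMFDerivAt (𝓡 n) (𝓡 n) (φ t) (φ 0 x) (mfderiv (𝓡 n) (𝓡 n) (φ t) (φ 0 x)) :=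
    ((contMDiff_of_contMDiff_uncurry hφ.smooth_flow t).contMDiffAt.mdifferentiableAt
      (by simp)).hasMFDerivAt
  have h2 := hd.comp (0 : ℝ) (hφ.integralCurve x 0)
  have h3 := hasMFDerivAt_unique h2 h1
  have h4 : mfderiv (𝓡 n) (𝓡 n) (φ t) (φ 0 x) (V (φ 0 x)) = V (φ t (φ 0 x)) := by
    have := congrArg (fun L : ℝ →L[ℝ] TangentSpace (𝓡 n) (φ t (φ 0 x)) => L 1) h3
    have e1 : ((1 : ℝ →L[ℝ] ℝ).smulRight (V (φ 0 x))) 1 = V (φ 0 x) := by simp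
    have e2 : ((1 : ℝ →L[ℝ] ℝ).smulRight (V (φ t (φ 0 x)))) 1 = V (φ t (φ 0 x)) := by simp
    rw [← e2]
    nth_rewrite 1 [← e1]
    exact this
  rwa [hφ.zero] at h4

lemma norm_mfderiv_neg_comp {φ : ℝ → X → X} {V : (x : X) → TangentSpace (𝓡 n) x}
    (hφ : IsSmoothFlow V φ) (t : ℝ) (x : X) (w : TangentSpace (𝓡 n) x) :
    ‖mfderiv (𝓡 n) (𝓡 n) (φ (-t)) (φ t x) (mfderiv (𝓡 n) (𝓡 n) (φ t) x w)‖ = ‖w‖ := by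
  have hd : ∀ s y, MDifferentiableAt (𝓡 n) (𝓡 n) (φ s) y := fun s y =>
    (contMDiff_of_contMDiff_uncurry hφ.smooth_flow s).contMDiffAt.mdifferentiableAt (by simp)
  have h : ∀ g : X → X, g = id → ‖mfderiv (𝓡 n) (𝓡 n) g x w‖ = ‖w‖ := by
    rintro _ rfl
    rw [mfderiv_id]
    rfl
  have h1 := h (φ (-t) ∘ φ t) (by
    funext y
    rw [Function.comp_apply, ← hφ.add, neg_add_cancel, hφ.zero, id])
  rwa [mfderiv_comp_apply x (hd _ _) (hd _ _)] at h1

/-- The projections commute with dφ_t because the subspaces are invariant and decompositions are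
unique. The expansion on E_u is the given backward contraction applied to dφ_t P₂ w at φ_t x. -/
lemma IsAnosov.exists_isHyperbolicSplitting {φ : ℝ → X → X}
    {V : (x : X) → TangentSpace (𝓡 n) x} (hφ : IsSmoothFlow V φ) (hA : IsAnosov V φ) :
    ∃ P₀ P₁ P₂ C θ, IsHyperbolicSplitting (n := n) V φ P₀ P₁ P₂ C θ := by
  obtain ⟨E₀, Es, Eu, ⟨hInt, P₀, P₁, P₂, hP, hc₀, hc₁, hc₂⟩, hE₀, hinv, C, θ, hθ, hu, hs⟩ := hA
  have hcomm : ∀ t x w,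
      mfderiv (𝓡 n) (𝓡 n) (φ t) x (P₀ x w) = P₀ (φ t x) (mfderiv (𝓡 n) (𝓡 n) (φ t) x w) ∧
      mfderiv (𝓡 n) (𝓡 n) (φ t) x (P₁ x w) = P₁ (φ t x) (mfderiv (𝓡 n) (𝓡 n) (φ t) x w) ∧
      mfderiv (𝓡 n) (𝓡 n) (φ t) x (P₂ x w) = P₂ (φ t x) (mfderiv (𝓡 n) (𝓡 n) (φ t) x w) := by
    intro t x w
    obtain ⟨h0, h1, h2, hsum⟩ := hP x w
    obtain ⟨h0', h1', h2', hsum'⟩ := hP (φ t x) (mfderiv (𝓡 n) (𝓡 n) (φ t) x w)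
    refine sum_eq_sum_of_isInternal (hInt (φ t x)) ?_ h0' ?_ h1' ?_ h2' ?_
    · rw [← (hinv t x).1]
      exact Submodule.mem_map_of_mem h0
    · rw [← (hinv t x).2.1]
      exact Submodule.mem_map_of_mem h1
    · rw [← (hinv t x).2.2]
      exact Submodule.mem_map_of_mem h2
    · rw [hsum', ← map_add, ← map_add, hsum]
  have hCle : ∀ t : ℝ, C * Real.exp (-θ * t) ≤ (|C| + 1) * Real.exp (-θ * t) := fun t => by
    gcongr
    linarith [le_abs_self C]
  have hfield : ∀ x, P₀ x (V x) = V x ∧ P₁ x (V x) = 0 ∧ P₂ x (V x) = 0 := by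
    intro x
    obtain ⟨h0, h1, h2, hsum⟩ := hP x (V x)
    refine sum_eq_sum_of_isInternal (hInt x) h0 (a' := V x) ?_ h1 (Submodule.zero_mem _) h2
      (Submodule.zero_mem _) (by rw [hsum, add_zero, add_zero])
    rw [hE₀]
    exact Submodule.mem_span_singleton_self _
  refine ⟨P₀, P₁, P₂, |C| + 1, θ, by positivity, hθ, fun x w => (hP x w).2.2.2, ?_,
    fun x => (hfield x).1, fun x => (hfield x).2.1, fun x => (hfield x).2.2,
    fun t x w => (hcomm t x w).1, fun t x w => (hcomm t x w).2.1, fun t x w => (hcomm t x w).2.2,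
    ?_, ?_, hc₀, hc₁, hc₂⟩
  · intro x w
    have := (hP x w).1
    rw [hE₀, Submodule.mem_span_singleton] at this
    obtain ⟨a, ha⟩ := this
    exact ⟨a, ha.symm⟩
  · intro t ht x w
    have h := hs x (P₁ x w) (hP x w).2.1 t ht
    rw [abs_of_pos ht] at h
    exact h.trans (by gcongr ?_ * _; exact hCle t)
  · intro t ht x w
    have hmem : mfderiv (𝓡 n) (𝓡 n) (φ t) x (P₂ x w) ∈ Eu (φ t x) := by
      rw [← (hinv t x).2.2]
      exact Submodule.mem_map_of_mem (hP x w).2.2.1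
    have h := hu (φ t x) _ hmem (-t) (by linarith)
    rw [norm_mfderiv_neg_comp hφ, abs_neg, abs_of_pos ht] at h
    exact h.trans (by gcongr ?_ * _; exact hCle t)

omit [EMetricSpace X] [ChartedSpace (EuclideanSpace ℝ (Fin n)) X] [IsManifold (𝓡 n) ∞ X]
  [RiemannianBundle (fun x : X => TangentSpace (𝓡 n) x)] in
lemma exists_mul_exp_neg_le (C : ℝ) {θ q : ℝ} (hθ : 0 < θ) (hq : 0 < q) :
    ∃ T > 0, ∀ t ≥ T, C * Real.exp (-θ * t) ≤ q := by
  have h1 : Tendsto (fun t : ℝ => C * Real.exp (-θ * t)) atTop (𝓝 (C * 0)) := by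
    refine Tendsto.const_mul C (Real.tendsto_exp_atBot.comp ?_)
    exact tendsto_id.const_mul_atTop_of_neg (by linarith)
  rw [mul_zero] at h1
  obtain ⟨T, hT⟩ := eventually_atTop.1 (h1.eventually_le_const hq)
  exact ⟨max T 1, by positivity, fun t ht => hT t ((le_max_left _ _).trans ht)⟩

lemma norm_mfderiv_of_eventuallyEq_id {f : X → X} {x : X} (hf : f =ᶠ[𝓝 x] id)
    (w : TangentSpace (𝓡 n) x) : ‖mfderiv (𝓡 n) (𝓡 n) f x w‖ = ‖w‖ := by
  have h : (⟨f x, mfderiv (𝓡 n) (𝓡 n) f x w⟩ : TangentBundle (𝓡 n) X) = ⟨x, w⟩ := by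
    refine TotalSpace.ext hf.eq_of_nhds ?_
    have h1 := hf.mfderiv_eq (I := 𝓡 n) (I' := 𝓡 n)
    rw [mfderiv_id] at h1
    exact heq_of_eq (congrArg
      (fun L : EuclideanSpace ℝ (Fin n) →L[ℝ] EuclideanSpace ℝ (Fin n) => L w) h1)
  exact congrArg (fun p : TangentBundle (𝓡 n) X => ‖p.2‖) h

open Manifold in
-- Since dφ_s maps V to V, the field vanishes along the whole orbit. The orbit segment then has
-- length 0, which bounds the distance of its end points.
lemma IsSmoothFlow.eq_self_of_field_eq_zero [IsRiemannianManifold (𝓡 n) X] {φ : ℝ → X → X}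
    {V : (x : X) → TangentSpace (𝓡 n) x} (hφ : IsSmoothFlow V φ) {x : X} (hx : V x = 0) {t : ℝ}
    (ht : 0 ≤ t) : φ t x = x := by
  have hV : ∀ s, V (φ s x) = 0 := fun s => by rw [← hφ.mfderiv_field, hx, map_zero]
  have hsmooth : ContMDiff 𝓘(ℝ, ℝ) (𝓡 n) 1 (fun s => φ s x) :=
    (hφ.smooth_flow.comp (contMDiff_id.prodMk contMDiff_const)).of_le (by exact_mod_cast le_top)
  have h1 := riemannianEDist_le_pathELength (I := 𝓡 n) (γ := fun s => φ s x) (a := 0) (b := t)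
    (x := x) (y := φ t x) hsmooth.contMDiffOn (hφ.zero x) rfl ht
  rw [← IsRiemannianManifold.out (I := 𝓡 n), pathELength_eq_lintegral_mfderiv_Icc] at h1
  have h2 : ∀ s, ‖mfderiv 𝓘(ℝ, ℝ) (𝓡 n) (fun s => φ s x) s 1‖ₑ = 0 := by
    intro s
    rw [(hφ.integralCurve x s).mfderiv]
    have : ((1 : ℝ →L[ℝ] ℝ).smulRight (V (φ s x))) 1 = 0 := by simp [hV s]
    rw [enorm_eq_zero]
    exact this
  simp only [h2, lintegral_zero, nonpos_iff_eq_zero] at h1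
  exact (edist_eq_zero.1 h1).symm

/-- The vector field of an Anosov flow has no zeros, except on a manifold of dimension `0`. -/
lemma IsHyperbolicSplitting.field_ne_zero [IsRiemannianManifold (𝓡 n) X] {φ : ℝ → X → X}
    {V : (x : X) → TangentSpace (𝓡 n) x}
    {P₀ P₁ P₂ : (x : X) → TangentSpace (𝓡 n) x →ₗ[ℝ] TangentSpace (𝓡 n) x} {C θ : ℝ}
    (h : IsHyperbolicSplitting V φ P₀ P₁ P₂ C θ) (hφ : IsSmoothFlow V φ) (hn : 0 < n) (x : X) :
    V x ≠ 0 := by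
  intro hx
  obtain ⟨-, -, K, hK, -, hKs, W, hW, hxW, hWK, -⟩ :=
    exists_compact_chart_nhds (n := n) x (univ_mem (f := 𝓝 x))
  obtain ⟨ε, hε, hmod⟩ := exists_modulus_bundleMap h.continuous₀ hK hKs one_half_pos
  -- At a zero x of V the projection P₀ is 0. By continuity the chart norm of V y = P₀(V y) is at
  -- most half of itself for y near x, so V vanishes near x.
  have hev : ∀ᶠ y in 𝓝 x, V y = 0 := by
    filter_upwards [hW.mem_nhds hxW, Metric.eball_mem_nhds x (ENNReal.ofReal_pos.2 hε)]
      with y hy hyε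
    have hyK := hWK hy
    have hxK := hWK hxW
    obtain ⟨a, ha⟩ := h.exists_smul x (chartDerivSymm x x (chartDeriv x y (V y)))
    have h1 := hmod x hxK y hyK (by rw [edist_comm]; exact hyε.le)
      (chartDerivSymm x x (chartDeriv x y (V y))) (V y) (chartDeriv_symm (hKs hxK) _).symm
    rw [h.proj₀_field, ha, hx, smul_zero, map_zero, sub_zero, chartDeriv_symm (hKs hxK)] at h1
    have h2 : chartDeriv x y (V y) = 0 := by
      rw [← norm_eq_zero]
      linarith [norm_nonneg (chartDeriv x y (V y))]
    rw [← chartDerivSymm_chartDeriv (hKs hyK) (V y), h2, map_zero]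
  have hid : ∀ t, 0 ≤ t → φ t =ᶠ[𝓝 x] id := fun t ht =>
    hev.mono fun y hy => hφ.eq_self_of_field_eq_zero hy ht
  obtain ⟨T, hT, hdecay⟩ := exists_mul_exp_neg_le C h.θ_pos one_half_pos
  -- Near x the map φ_T is the identity, yet its differential contracts E_s by 1/2 and its inverse
  -- contracts E_u by 1/2. So all three components of every tangent vector vanish, which contradicts
  -- n > 0.
  have hzero : ∀ w : TangentSpace (𝓡 n) x, w = 0 := by
    intro w
    obtain ⟨a, ha⟩ := h.exists_smul x w
    have h1 := h.stable T hT x w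
    have h2 := h.unstable T hT x w
    rw [norm_mfderiv_of_eventuallyEq_id (hid T hT.le)] at h1 h2
    have hd := hdecay T le_rfl
    have e1 : P₁ x w = 0 := by
      rw [← norm_eq_zero]
      nlinarith [norm_nonneg (P₁ x w)]
    have e2 : P₂ x w = 0 := by
      rw [← norm_eq_zero]
      nlinarith [norm_nonneg (P₂ x w)]
    rw [← h.add_eq x w, e1, e2, ha, hx, smul_zero, add_zero, add_zero]
  have : Nonempty (Fin n) := ⟨⟨0, hn⟩⟩
  obtain ⟨v, hv⟩ := exists_ne (0 : EuclideanSpace ℝ (Fin n))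
  exact hv (hzero v)

/-- The basic consequence of hyperbolicity: at points that almost return after a long time, the
differential of the return map minus the identity, together with the flow direction, controls all
directions but one. -/
lemma IsHyperbolicSplitting.exists_chart_estimate
    {φ : ℝ → X → X} {V : (x : X) → TangentSpace (𝓡 n) x}
    {P₀ P₁ P₂ : (x : X) → TangentSpace (𝓡 n) x →ₗ[ℝ] TangentSpace (𝓡 n) x} {C θ : ℝ}
    (h : IsHyperbolicSplitting V φ P₀ P₁ P₂ C θ) (hφ : IsSmoothFlow V φ)
    (𝒜 : FiniteAtlas n X) {c : X} (hc : c ∈ 𝒜.s)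
    (ℓ : EuclideanSpace ℝ (Fin n) →L[ℝ] ℝ) {c₀ : ℝ} (hc₀ : 0 < c₀)
    (hℓ : ∀ y ∈ 𝒜.K c, c₀ ≤ |ℓ (chartDeriv c y (V y))|) :
    ∃ K > 0, ∃ ε > 0, ∀ t ≥ K, ∀ y ∈ 𝒜.K c, φ t y ∈ 𝒜.K c →
      edist y (φ t y) ≤ ENNReal.ofReal ε → ∀ (w : TangentSpace (𝓡 n) y) (s : ℝ),
      |s| + ‖chartDeriv c y w‖ ≤ K * (|ℓ (chartDeriv c y w)| +
        ‖s • chartDeriv c (φ t y) (V (φ t y)) +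
          chartDeriv c (φ t y) (mfderiv (𝓡 n) (𝓡 n) (φ t) y w) - chartDeriv c y w‖) := by
  have hKc := 𝒜.isCompact c hc
  have hKs := 𝒜.subset_source c hc
  have hA := zero_lt_one.trans_le 𝒜.one_le_C
  have hVc : Continuous (fun x => (⟨x, V x⟩ : TangentBundle (𝓡 n) X)) :=
    hφ.smooth_field.continuous
  obtain ⟨B₀, hB₀, hb₀⟩ := exists_bound_bundleMap h.continuous₀ hKc hKs
  obtain ⟨B₁, hB₁, hb₁⟩ := exists_bound_bundleMap h.continuous₁ hKc hKs
  obtain ⟨B₂, hB₂, hb₂⟩ := exists_bound_bundleMap h.continuous₂ hKc hKs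
  obtain ⟨B₃, hB₃⟩ := hKc.exists_bound_of_continuousOn
    ((continuousOn_chartDeriv_section hVc c).mono hKs)
  set B := B₀ + B₁ + B₂ + |B₃| + ‖ℓ‖ + 1 with hB
  have hℓn := norm_nonneg ℓ
  have hB₃' := abs_nonneg B₃
  have hB1 : 1 ≤ B := by linarith
  have hBpos : 0 < B := by linarith
  -- The single constant c₀ / B is a lower bound both for the chart norm of V, as |ℓ(V)| ≥ c₀ and
  -- ‖ℓ‖ ≤ B, and for |ℓ(V)| itself, as B ≥ 1.
  have hκ : 0 < c₀ / B := by positivity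
  obtain ⟨M, hM, η, hη, hreal⟩ := exists_hyperbolic_estimate hBpos hκ
  obtain ⟨ε₀, hε₀, hm₀⟩ := exists_modulus_bundleMap h.continuous₀ hKc hKs hη
  obtain ⟨ε₁, hε₁, hm₁⟩ := exists_modulus_bundleMap h.continuous₁ hKc hKs hη
  obtain ⟨ε₂, hε₂, hm₂⟩ := exists_modulus_bundleMap h.continuous₂ hKc hKs hη
  obtain ⟨ε₃, hε₃, hm₃⟩ := exists_modulus_section hVc hKc hKs hη
  -- The factors `𝒜.C` convert between Riemannian and chart norms; after time T the rate is at most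
  -- 1/2 in chart norms too.
  obtain ⟨T, hT, hdecay⟩ := exists_mul_exp_neg_le (𝒜.C * C * 𝒜.C) h.θ_pos one_half_pos
  refine ⟨max M T, lt_max_of_lt_left hM, min (min ε₀ ε₁) (min ε₂ ε₃), by positivity, ?_⟩
  intro t ht y hy hy₁ hdist w s
  have htT : T ≤ t := (le_max_right _ _).trans ht
  have ht0 : 0 < t := hT.trans_le htT
  have hdec := hdecay t htT
  have hd₀ : edist y (φ t y) ≤ ENNReal.ofReal ε₀ := hdist.trans (ENNReal.ofReal_le_ofReal
    ((min_le_left _ _).trans (min_le_left _ _)))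
  have hd₁ : edist y (φ t y) ≤ ENNReal.ofReal ε₁ := hdist.trans (ENNReal.ofReal_le_ofReal
    ((min_le_left _ _).trans (min_le_right _ _)))
  have hd₂ : edist y (φ t y) ≤ ENNReal.ofReal ε₂ := hdist.trans (ENNReal.ofReal_le_ofReal
    ((min_le_right _ _).trans (min_le_left _ _)))
  have hd₃ : edist y (φ t y) ≤ ENNReal.ofReal ε₃ := hdist.trans (ENNReal.ofReal_le_ofReal
    ((min_le_right _ _).trans (min_le_right _ _)))
  set D := chartDeriv (n := n) c y with hD
  set D' := chartDeriv (n := n) c (φ t y) with hD'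
  set W := mfderiv (𝓡 n) (𝓡 n) (φ t) y w with hW
  -- Transporting w to the return point with the same coordinates gives the difference dφ_t w - w a
  -- meaning in one tangent space.
  set w' := chartDerivSymm (n := n) c (φ t y) (D w) with hw'
  have hDw' : D' w' = D w := chartDeriv_symm (hKs hy₁) _
  set ρ : TangentSpace (𝓡 n) (φ t y) := s • V (φ t y) + W - w' with hρ
  have hDρ : s • D' (V (φ t y)) + D' W - D w = D' ρ := by
    rw [hρ, map_sub, map_add, map_smul, hDw']
  rw [hDρ]
  obtain ⟨a, ha⟩ := h.exists_smul y w
  -- the components of `ρ`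
  have hρ₀ : P₀ (φ t y) ρ = s • V (φ t y) + a • V (φ t y) - P₀ (φ t y) w' := by
    rw [hρ, map_sub, map_add, map_smul, h.proj₀_field, hW, ← h.comm₀, ha, map_smul,
      hφ.mfderiv_field]
  have hρ₁ : P₁ (φ t y) ρ = mfderiv (𝓡 n) (𝓡 n) (φ t) y (P₁ y w) - P₁ (φ t y) w' := by
    rw [hρ, map_sub, map_add, map_smul, h.proj₁_field, hW, ← h.comm₁, smul_zero, zero_add]
  have hρ₂ : P₂ (φ t y) ρ = mfderiv (𝓡 n) (𝓡 n) (φ t) y (P₂ y w) - P₂ (φ t y) w' := by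
    rw [hρ, map_sub, map_add, map_smul, h.proj₂_field, hW, ← h.comm₂, smul_zero, zero_add]
  have hr := norm_nonneg (D' ρ)
  have b₀ : ‖D' (P₀ (φ t y) ρ)‖ ≤ B * ‖D' ρ‖ := (hb₀ _ hy₁ ρ).trans (by gcongr; linarith)
  have b₁ : ‖D' (P₁ (φ t y) ρ)‖ ≤ B * ‖D' ρ‖ := (hb₁ _ hy₁ ρ).trans (by gcongr; linarith)
  have b₂ : ‖D' (P₂ (φ t y) ρ)‖ ≤ B * ‖D' ρ‖ := (hb₂ _ hy₁ ρ).trans (by gcongr; linarith)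
  have m₀ := hm₀ y hy _ hy₁ hd₀ w w' hDw'
  have m₁ := hm₁ y hy _ hy₁ hd₁ w w' hDw'
  have m₂ := hm₂ y hy _ hy₁ hd₂ w w' hDw'
  have m₃ := hm₃ y hy _ hy₁ hd₃
  have hsplit : D w = D (P₀ y w) + D (P₁ y w) + D (P₂ y w) := by
    rw [← map_add, ← map_add, h.add_eq]
  have hBV : ∀ z ∈ 𝒜.K c, ‖chartDeriv c z (V z)‖ ≤ B := fun z hz =>
    (hB₃ z hz).trans ((le_abs_self B₃).trans (by linarith))
  have hℓB : ∀ v, |ℓ v| ≤ B * ‖v‖ := fun v => (ℓ.le_opNorm v).trans (by gcongr; linarith)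
  -- the unstable, stable and flow components of `w`
  have u₂ : ‖D (P₂ y w)‖ ≤ B * ‖D' ρ‖ + η * ‖D w‖ := by
    -- Expansion by 2 exceeds the identity by at least 1, so the unstable part of the residual
    -- controls that of w. In the stable case contraction by 1/2 leaves a gap of 1/2, hence the
    -- factor 2 there.
    have e1 : 2 * ‖D (P₂ y w)‖ ≤ ‖D' (mfderiv (𝓡 n) (𝓡 n) (φ t) y (P₂ y w))‖ := by
      have e2 : ‖D (P₂ y w)‖ ≤ 𝒜.C * C * 𝒜.C * Real.exp (-θ * t) *
          ‖D' (mfderiv (𝓡 n) (𝓡 n) (φ t) y (P₂ y w))‖ := by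
        have hexp := Real.exp_pos (-θ * t)
        have hC := h.C_pos
        calc ‖D (P₂ y w)‖ ≤ 𝒜.C * ‖P₂ y w‖ := 𝒜.norm_chartDeriv_le c hc y hy _
          _ ≤ 𝒜.C * (C * Real.exp (-θ * t) * (𝒜.C *
              ‖D' (mfderiv (𝓡 n) (𝓡 n) (φ t) y (P₂ y w))‖)) := by
            gcongr
            refine (h.unstable t ht0 y w).trans ?_
            gcongr
            exact 𝒜.norm_le_chartDeriv c hc _ hy₁ _
          _ = _ := by ring
      have e3 := mul_le_mul_of_nonneg_right hdec
        (norm_nonneg (D' (mfderiv (𝓡 n) (𝓡 n) (φ t) y (P₂ y w))))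
      linarith
    have e4 : D' (mfderiv (𝓡 n) (𝓡 n) (φ t) y (P₂ y w)) =
        D' (P₂ (φ t y) ρ) + (D' (P₂ (φ t y) w') - D (P₂ y w)) + D (P₂ y w) := by
      rw [hρ₂, map_sub]
      abel
    have e5 := norm_add₃_le (a := D' (P₂ (φ t y) ρ)) (b := D' (P₂ (φ t y) w') - D (P₂ y w))
      (c := D (P₂ y w))
    rw [← e4] at e5
    linarith
  have u₁ : ‖D (P₁ y w)‖ ≤ 2 * (B * ‖D' ρ‖ + η * ‖D w‖) := by
    have e1 : ‖D' (mfderiv (𝓡 n) (𝓡 n) (φ t) y (P₁ y w))‖ ≤ 1 / 2 * ‖D (P₁ y w)‖ := by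
      have hexp := Real.exp_pos (-θ * t)
      have hC := h.C_pos
      calc ‖D' (mfderiv (𝓡 n) (𝓡 n) (φ t) y (P₁ y w))‖
          ≤ 𝒜.C * ‖mfderiv (𝓡 n) (𝓡 n) (φ t) y (P₁ y w)‖ := 𝒜.norm_chartDeriv_le c hc _ hy₁ _
        _ ≤ 𝒜.C * (C * Real.exp (-θ * t) * (𝒜.C * ‖D (P₁ y w)‖)) := by
          gcongr
          refine (h.stable t ht0 y w).trans ?_
          gcongr
          exact 𝒜.norm_le_chartDeriv c hc _ hy _
        _ = 𝒜.C * C * 𝒜.C * Real.exp (-θ * t) * ‖D (P₁ y w)‖ := by ring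
        _ ≤ _ := mul_le_mul_of_nonneg_right hdec (norm_nonneg _)
    have e4 : D (P₁ y w) = D' (mfderiv (𝓡 n) (𝓡 n) (φ t) y (P₁ y w)) - D' (P₁ (φ t y) ρ) -
        (D' (P₁ (φ t y) w') - D (P₁ y w)) := by
      rw [hρ₁, map_sub]
      abel
    have e5 := norm_sub_le (D' (mfderiv (𝓡 n) (𝓡 n) (φ t) y (P₁ y w)) - D' (P₁ (φ t y) ρ))
      (D' (P₁ (φ t y) w') - D (P₁ y w))
    have e6 := norm_sub_le (D' (mfderiv (𝓡 n) (𝓡 n) (φ t) y (P₁ y w))) (D' (P₁ (φ t y) ρ))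
    rw [← e4] at e5
    linarith
  -- The flow part of the residual is (s + a) V(φ_t y) - P₀ w', and P₀ w' is close to a V(y), hence
  -- to a V(φ_t y). The coefficient a cancels up to η |a|, so this equation bounds s but not a.
  have u₀ : c₀ / B * |s| ≤ B * ‖D' ρ‖ + η * ‖D w‖ + η * |a| := by
    have e0 : c₀ / B ≤ ‖D' (V (φ t y))‖ := by
      rw [div_le_iff₀ hBpos, mul_comm]
      exact (hℓ _ hy₁).trans (hℓB _)
    have e1 : s • D' (V (φ t y)) = D' (P₀ (φ t y) ρ) + (D' (P₀ (φ t y) w') - D (P₀ y w)) -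
        a • (D' (V (φ t y)) - D (V y)) := by
      rw [hρ₀, ha, map_sub, map_add, map_smul, map_smul, map_smul, smul_sub]
      abel
    have e2 := norm_sub_le (D' (P₀ (φ t y) ρ) + (D' (P₀ (φ t y) w') - D (P₀ y w)))
      (a • (D' (V (φ t y)) - D (V y)))
    have e3 := norm_add_le (D' (P₀ (φ t y) ρ)) (D' (P₀ (φ t y) w') - D (P₀ y w))
    rw [← e1, norm_smul, norm_smul, Real.norm_eq_abs, Real.norm_eq_abs] at e2
    have e4 : |a| * ‖D' (V (φ t y)) - D (V y)‖ ≤ |a| * η := by gcongr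
    have e5 : c₀ / B * |s| ≤ |s| * ‖D' (V (φ t y))‖ := by rw [mul_comm]; gcongr
    linarith
  -- The remaining unknown a is read off from ℓ(w), since ℓ does not vanish on V.
  have ua : c₀ / B * |a| ≤ |ℓ (D w)| + B * (‖D (P₂ y w)‖ + ‖D (P₁ y w)‖) := by
    have e1 : c₀ / B ≤ c₀ := div_le_self hc₀.le hB1
    have e2 : c₀ * |a| ≤ |ℓ (D (P₀ y w))| := by
      rw [ha, map_smul, map_smul, smul_eq_mul, abs_mul, mul_comm]
      gcongr
      exact hℓ y hy
    have e3 : ℓ (D (P₀ y w)) = ℓ (D w) - ℓ (D (P₁ y w) + D (P₂ y w)) := by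
      rw [← map_sub, hsplit]
      congr 1
      abel
    have e4 : |ℓ (D (P₀ y w))| ≤ |ℓ (D w)| + |ℓ (D (P₁ y w) + D (P₂ y w))| := by
      rw [e3]
      exact abs_sub _ _
    have e5 : |ℓ (D (P₁ y w) + D (P₂ y w))| ≤ B * (‖D (P₂ y w)‖ + ‖D (P₁ y w)‖) := by
      refine (hℓB _).trans ?_
      gcongr
      rw [add_comm ‖D (P₂ y w)‖]
      exact norm_add_le _ _
    have e6 : c₀ / B * |a| ≤ c₀ * |a| := by gcongr
    linarith
  have uv : ‖D w‖ ≤ B * |a| + ‖D (P₁ y w)‖ + ‖D (P₂ y w)‖ := by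
    have e1 := norm_add₃_le (a := D (P₀ y w)) (b := D (P₁ y w)) (c := D (P₂ y w))
    rw [← hsplit] at e1
    have e2 : ‖D (P₀ y w)‖ ≤ B * |a| := by
      rw [ha, map_smul, norm_smul, Real.norm_eq_abs, mul_comm]
      gcongr
      exact hBV y hy
    linarith
  have := hreal ‖D (P₂ y w)‖ ‖D (P₁ y w)‖ ‖D w‖ ‖D' ρ‖ |s| |a| |ℓ (D w)| (norm_nonneg _)
    (norm_nonneg _) (norm_nonneg _) hr (abs_nonneg _) (abs_nonneg _) (abs_nonneg _) u₂ u₁ u₀ ua uv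
  refine this.trans ?_
  gcongr
  exact le_max_left _ _

end Anosov

/-! ### Separation of nearly closed orbits -/

section Separation

variable {n : ℕ} {X : Type*} [EMetricSpace X] [CompactSpace X]
  [ChartedSpace (EuclideanSpace ℝ (Fin n)) X]
  [IsManifold (𝓡 n) ∞ X] [RiemannianBundle (fun x : X => TangentSpace (𝓡 n) x)]
  [IsContinuousRiemannianBundle (EuclideanSpace ℝ (Fin n)) (fun x : X => TangentSpace (𝓡 n) x)]
  [IsRiemannianManifold (𝓡 n) X]

omit [IsRiemannianManifold (𝓡 n) X] [CompactSpace X] [IsContinuousRiemannianBundle (EuclideanSpace ℝ (Fin n)) (fun x : X => TangentSpace (𝓡 n) x)]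
  [RiemannianBundle (fun x : X => TangentSpace (𝓡 n) x)] in
lemma hasDerivAt_extChartAt_flow {φ : ℝ → X → X} {V : (x : X) → TangentSpace (𝓡 n) x}
    (hφ : IsSmoothFlow V φ) {c y : X} {s : ℝ}
    (hs : φ s y ∈ (extChartAt (𝓡 n) c).source) :
    HasDerivAt (fun a => extChartAt (𝓡 n) c (φ a y)) (chartDeriv c (φ s y) (V (φ s y))) s := by
  have h := hasFDerivAt_extChartAt_comp (hφ.integralCurve y s) hs
  have h2 := h.hasDerivAt
  convert h2 using 1
  have : ((1 : ℝ →L[ℝ] ℝ).smulRight (V (φ s y))) 1 = V (φ s y) := by simp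
  exact (congrArg (chartDeriv c (φ s y)) this).symm

omit [ChartedSpace (EuclideanSpace ℝ (Fin n)) X] [IsManifold (𝓡 n) ∞ X]
  [RiemannianBundle (fun x : X => TangentSpace (𝓡 n) x)]
  [IsContinuousRiemannianBundle (EuclideanSpace ℝ (Fin n)) (fun x : X => TangentSpace (𝓡 n) x)]
  [IsRiemannianManifold (𝓡 n) X] in
lemma exists_edist_flow_self_le {φ : ℝ → X → X} (hφ : Continuous fun p : ℝ × X => φ p.1 p.2)
    (h0 : ∀ x, φ 0 x = x) {η : ℝ} (hη : 0 < η) :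
    ∃ δ > 0, ∀ s : ℝ, |s| ≤ δ → ∀ x, edist x (φ s x) ≤ ENNReal.ofReal η := by
  have h1 : ∀ x : X, ∃ δ > 0, ∃ U ∈ 𝓝 x, ∀ s : ℝ, |s| ≤ δ → ∀ y ∈ U,
      edist y (φ s y) ≤ ENNReal.ofReal η := by
    intro x
    have hc : Continuous fun p : ℝ × X => edist p.2 (φ p.1 p.2) := continuous_snd.edist hφ
    have hev : ∀ᶠ p in 𝓝 ((0 : ℝ), x), edist p.2 (φ p.1 p.2) < ENNReal.ofReal η := by
      refine hc.continuousAt.eventually_lt continuousAt_const ?_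
      simpa [h0] using hη
    rw [nhds_prod_eq, eventually_prod_iff] at hev
    obtain ⟨p, hp, q, hq, h⟩ := hev
    obtain ⟨δ, hδ, hball⟩ := Metric.nhds_basis_closedBall.mem_iff.1 hp
    exact ⟨δ, hδ, {y | q y}, hq, fun s hs y hy =>
      (h (hball (by simpa [Metric.mem_closedBall, Real.dist_eq] using hs)) hy).le⟩
  choose δ hδ U hU h using h1
  obtain ⟨t, ht⟩ := CompactSpace.elim_nhds_subcover U hU
  obtain ⟨-, -, r, hr, hmin⟩ := exists_uniform_constants t (P := fun x _ r => r ≤ δ x)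
    (fun i C C' r r' _ hr h => hr.trans h) (fun i _ => ⟨1, one_pos, δ i, hδ i, le_rfl⟩)
  refine ⟨r, hr, fun s hs x => ?_⟩
  have hx : x ∈ ⋃ y ∈ t, U y := by rw [ht]; exact mem_univ _
  simp only [mem_iUnion] at hx
  obtain ⟨y, hy, hxy⟩ := hx
  exact h y s (hs.trans (hmin y hy)) x hxy

set_option maxHeartbeats 1000000 in
/-- Near-closed orbit segments of an Anosov flow of nearly the same length `t` that start in a set
of diameter `e ^ (-L t)` are separated in all directions but one. -/
lemma IsAnosov.exists_separation {φ : ℝ → X → X} {V : (x : X) → TangentSpace (𝓡 n) x}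
    (hφ : IsSmoothFlow V φ) (hA : IsAnosov V φ) (hn : 0 < n) :
    ∃ (𝒜 : FiniteAtlas n X) (ℓ : X → (EuclideanSpace ℝ (Fin n) →L[ℝ] ℝ)) (K L δ : ℝ),
      1 ≤ K ∧ 0 < L ∧ 0 < δ ∧ δ ≤ 1 ∧ ∀ T ≥ K, ∀ ε, 0 ≤ ε → ε ≤ δ * Real.exp (-(L * T)) →
      ∀ c ∈ 𝒜.s, ∀ t ∈ Icc T (T + 1), ∀ t' ∈ Icc T (T + 1),
      |t' - t| ≤ δ * Real.exp (-(L * T)) → ∀ y y',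
      (∀ z, edist y z < ENNReal.ofReal 𝒜.r → z ∈ 𝒜.K c) →
      edist y y' ≤ ENNReal.ofReal (δ * Real.exp (-(L * T))) →
      edist y (φ t y) ≤ ENNReal.ofReal ε → edist y' (φ t' y') ≤ ENNReal.ofReal ε →
      |t' - t| + ‖extChartAt (𝓡 n) c y' - extChartAt (𝓡 n) c y‖ ≤
        K * (|ℓ c (extChartAt (𝓡 n) c y' - extChartAt (𝓡 n) c y)| + ε) := by
  obtain ⟨P₀, P₁, P₂, C, θ, h⟩ := hA.exists_isHyperbolicSplitting hφ
  have hVc : Continuous (fun x => (⟨x, V x⟩ : TangentBundle (𝓡 n) X)) :=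
    hφ.smooth_field.continuous
  -- The functional is the inner product with V at the chart centre. There it takes the value |V| ^
  -- 2 on V, and the sets `good` keep it above half of that.
  set ℓ : X → (EuclideanSpace ℝ (Fin n) →L[ℝ] ℝ) :=
    fun x => innerSL ℝ (chartDeriv x x (V x)) with hℓ
  have hne : ∀ x, chartDeriv x x (V x) ≠ 0 := by
    intro x hx
    apply h.field_ne_zero hφ hn x
    rw [← chartDerivSymm_chartDeriv (mem_extChartAt_source (I := 𝓡 n) x) (V x), hx, map_zero]
  set c₀ : X → ℝ := fun x => ‖chartDeriv x x (V x)‖ ^ 2 / 2 with hc₀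
  have hc₀pos : ∀ x, 0 < c₀ x := fun x => by
    have := norm_pos_iff.2 (hne x)
    positivity
  obtain ⟨𝒜, hgood⟩ := exists_finiteAtlas (n := n)
    (fun x : X => {y | c₀ x ≤ |ℓ x (chartDeriv x y (V y))|}) (by
      intro x
      have hcont : ContinuousAt (fun y => |ℓ x (chartDeriv x y (V y))|) x :=
        ((ℓ x).continuous.continuousAt.comp
          ((continuousOn_chartDeriv_section hVc x).continuousAt
            (extChartAt_source_mem_nhds (I := 𝓡 n) x))).abs
      have : c₀ x < |ℓ x (chartDeriv x x (V x))| := by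
        have := hc₀pos x
        rw [hℓ]
        simp only [innerSL_apply_apply, real_inner_self_eq_norm_sq, abs_pow, abs_norm]
        simp only [hc₀] at this ⊢
        linarith
      exact (hcont.eventually_const_lt this).mono fun y hy => hy.le)
  obtain ⟨K, hK, ε₀, hε₀, hest⟩ := exists_uniform_constants 𝒜.s
    (P := fun c K ε => ∀ t ≥ K, ∀ y ∈ 𝒜.K c, φ t y ∈ 𝒜.K c →
      edist y (φ t y) ≤ ENNReal.ofReal ε → ∀ (w : TangentSpace (𝓡 n) y) (s : ℝ),
      |s| + ‖chartDeriv c y w‖ ≤ K * (|ℓ c (chartDeriv c y w)| +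
        ‖s • chartDeriv c (φ t y) (V (φ t y)) +
          chartDeriv c (φ t y) (mfderiv (𝓡 n) (𝓡 n) (φ t) y w) - chartDeriv c y w‖))
    (by
      intro c K K' r r' hK hr hP t ht y hy hy' hd w s
      refine (hP t (hK.trans ht) y hy hy' (hd.trans (ENNReal.ofReal_le_ofReal hr)) w s).trans ?_
      gcongr)
    (fun c hc => h.exists_chart_estimate hφ 𝒜 hc (ℓ c) (hc₀pos c) (hgood c hc))
  obtain ⟨Λ, hΛ, r, hr, htaylor⟩ := 𝒜.exists_flow_taylor hφ.smooth_flow hφ.zero hφ.add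
  -- Chosen so that K η = 1/2, which lets the Taylor errors be absorbed in the left-hand side of the
  -- hyperbolic estimate.
  set η := 1 / (2 * K) with hη
  have hηpos : 0 < η := by positivity
  obtain ⟨-, -, ε₁, hε₁, hmodV⟩ := exists_uniform_constants 𝒜.s
    (P := fun c _ ε => ∀ y ∈ 𝒜.K c, ∀ y' ∈ 𝒜.K c, edist y y' ≤ ENNReal.ofReal ε →
      ‖chartDeriv c y' (V y') - chartDeriv c y (V y)‖ ≤ η)
    (fun c K K' r r' hK hr hP y hy y' hy' hd =>
      hP y hy y' hy' (hd.trans (ENNReal.ofReal_le_ofReal hr)))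
    (fun c hc => ⟨1, one_pos, exists_modulus_section hVc (𝒜.isCompact c hc)
      (𝒜.subset_source c hc) hηpos⟩)
  set m := min (𝒜.r / 2) (ε₁ / 2) with hm
  have hmpos : 0 < m := lt_min (half_pos 𝒜.r_pos) (half_pos hε₁)
  obtain ⟨δ₀, hδ₀, hspeed⟩ := exists_edist_flow_self_le hφ.smooth_flow.continuous hφ.zero
    (half_pos hmpos)
  have hCA := 𝒜.one_le_C
  have hCA0 : 0 < 𝒜.C := by linarith
  -- At the scale ρ = δ e^{-ΛT} the quadratic Taylor error becomes linear with the factor e^{Λ(t+1)}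
  -- `𝒜.C` ^ 3 ρ ≤ A δ ≤ η, as t + 1 ≤ T + 2. This is why the separation holds only at exponentially
  -- small scale.
  set A := Real.exp (2 * Λ) * 𝒜.C ^ 3 with hAdef
  have hApos : 0 < A := by positivity
  set δ := min (min 1 ε₀) (min (min δ₀ (m / 4)) (min r η / A)) with hδ
  have hδpos : 0 < δ := by
    have : 0 < min r η := lt_min hr hηpos
    positivity
  have hδ1 : δ ≤ 1 := (min_le_left _ _).trans (min_le_left _ _)
  have hδε₀ : δ ≤ ε₀ := (min_le_left _ _).trans (min_le_right _ _)
  have hδδ₀ : δ ≤ δ₀ := (min_le_right _ _).trans ((min_le_left _ _).trans (min_le_left _ _))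
  have hδm : δ ≤ m / 4 := (min_le_right _ _).trans ((min_le_left _ _).trans (min_le_right _ _))
  have hδA : A * δ ≤ min r η := by
    have : δ ≤ min r η / A := (min_le_right _ _).trans (min_le_right _ _)
    rwa [le_div_iff₀ hApos, mul_comm] at this
  refine ⟨𝒜, ℓ, max 1 (max K (4 * K * 𝒜.C)), Λ, δ, le_max_left _ _, hΛ, hδpos, hδ1, ?_⟩
  intro T hT ε hε hεT c hc t ht t' ht' htt y y' hball hyy' hy hy'
  have hT1 : 1 ≤ T := (le_max_left _ _).trans hT
  have hTK : K ≤ T := (le_max_left _ _).trans ((le_max_right _ _).trans hT)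
  set ρ := δ * Real.exp (-(Λ * T)) with hρ
  have hρpos : 0 < ρ := by positivity
  have hρδ : ρ ≤ δ := by
    refine mul_le_of_le_one_right hδpos.le (Real.exp_le_one_iff.2 ?_)
    have : 0 ≤ Λ * T := by positivity
    linarith
  have hmr : m ≤ 𝒜.r / 2 := min_le_left _ _
  have hme : m ≤ ε₁ / 2 := min_le_right _ _
  have hnear : ∀ z, edist y z ≤ ENNReal.ofReal m → z ∈ 𝒜.K c := fun z hz =>
    hball z (hz.trans_lt ((ENNReal.ofReal_lt_ofReal_iff 𝒜.r_pos).2 (by linarith [𝒜.r_pos])))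
  have hρm : ρ ≤ m / 4 := hρδ.trans hδm
  have hym : y ∈ 𝒜.K c := hnear y (by simp)
  have hytm : edist y (φ t y) ≤ ENNReal.ofReal (m / 4) :=
    hy.trans (ENNReal.ofReal_le_ofReal (hεT.trans hρm))
  have hyt : φ t y ∈ 𝒜.K c := hnear _ (hytm.trans (ENNReal.ofReal_le_ofReal (by linarith)))
  have hy'm : y' ∈ 𝒜.K c := hnear _ (hyy'.trans (ENNReal.ofReal_le_ofReal (by linarith)))
  have hflow : ∀ s, |s - t'| ≤ ρ → edist y (φ s y') ≤ ENNReal.ofReal m := by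
    intro s hs
    have e1 : φ s y' = φ (s - t') (φ t' y') := by rw [← hφ.add, sub_add_cancel]
    have e2 := hspeed (s - t') (hs.trans (hρδ.trans hδδ₀)) (φ t' y')
    rw [← e1] at e2
    calc edist y (φ s y') ≤ edist y y' + edist y' (φ t' y') + edist (φ t' y') (φ s y') :=
          edist_triangle4 _ _ _ _
      _ ≤ ENNReal.ofReal (m / 4) + ENNReal.ofReal (m / 4) + ENNReal.ofReal (m / 2) := by
          gcongr
          · exact hyy'.trans (ENNReal.ofReal_le_ofReal hρm)
          · exact hy'.trans (ENNReal.ofReal_le_ofReal (hεT.trans hρm))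
      _ = ENNReal.ofReal m := by
          rw [← ENNReal.ofReal_add (by positivity) (by positivity),
            ← ENNReal.ofReal_add (by positivity) (by positivity)]
          congr 1
          ring
  have hflowK : ∀ s, |s - t'| ≤ ρ → φ s y' ∈ 𝒜.K c := fun s hs => hnear _ (hflow s hs)
  set e := extChartAt (𝓡 n) c with he
  set v := e y' - e y with hv
  have hsrc := 𝒜.subset_source c hc
  set w := chartDerivSymm (n := n) c y v with hw
  have hDw : chartDeriv c y w = v := chartDeriv_symm (hsrc hym) v
  -- the displacement in space
  have hvρ : ‖v‖ ≤ 𝒜.C * ρ := 𝒜.norm_sub_le c hc y hym y' hy'm ρ hρpos.le hyy'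
  have hdv : edist y y' ≤ ENNReal.ofReal (𝒜.C * ‖v‖) := 𝒜.edist_le c hc y hym y' hy'm
  have hexp : Real.exp (Λ * (t + 1)) * (𝒜.C ^ 3 * ρ) ≤ min r η := by
    calc Real.exp (Λ * (t + 1)) * (𝒜.C ^ 3 * ρ)
        ≤ Real.exp (Λ * (T + 2)) * (𝒜.C ^ 3 * ρ) := by
          refine mul_le_mul_of_nonneg_right (Real.exp_le_exp.2 ?_) (by positivity)
          exact mul_le_mul_of_nonneg_left (by linarith [ht.2]) hΛ.le
      _ = A * δ := by
          have : Real.exp (Λ * (T + 2)) = Real.exp (2 * Λ) * Real.exp (Λ * T) := by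
            rw [← Real.exp_add]
            congr 1
            ring
          rw [hρ, this, Real.exp_neg, hAdef]
          field_simp
      _ ≤ min r η := hδA
  have hsmall : Real.exp (Λ * (t + 1)) * (𝒜.C * ‖v‖) ≤ r := by
    refine le_trans (mul_le_mul_of_nonneg_left ?_ (Real.exp_pos _).le)
      (hexp.trans (min_le_left _ _))
    calc 𝒜.C * ‖v‖ ≤ 𝒜.C * (𝒜.C * ρ) := by gcongr
      _ = 𝒜.C ^ 2 * ρ := by ring
      _ ≤ 𝒜.C ^ 3 * ρ :=
        mul_le_mul_of_nonneg_right (pow_le_pow_right₀ hCA (by norm_num)) hρpos.le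
  have hspace : ‖e (φ t y') - e (φ t y) - chartDeriv c (φ t y) (mfderiv (𝓡 n) (𝓡 n) (φ t) y w)‖
      ≤ η * ‖v‖ := by
    refine (htaylor t (by linarith [ht.1]) c hc c hc y hym y' hy'm (𝒜.C * ‖v‖) (by positivity)
      hsmall hdv w hDw hyt).trans ?_
    calc Real.exp (Λ * (t + 1)) * (𝒜.C * ‖v‖) ^ 2
        = Real.exp (Λ * (t + 1)) * (𝒜.C ^ 2 * ‖v‖) * ‖v‖ := by ring
      _ ≤ Real.exp (Λ * (t + 1)) * (𝒜.C ^ 2 * (𝒜.C * ρ)) * ‖v‖ := by gcongr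
      _ = Real.exp (Λ * (t + 1)) * (𝒜.C ^ 3 * ρ) * ‖v‖ := by ring
      _ ≤ η * ‖v‖ := by gcongr; exact hexp.trans (min_le_right _ _)
  -- the displacement in time
  have hseg : ∀ s ∈ uIcc t t', |s - t'| ≤ ρ := by
    intro s hs
    have := abs_sub_right_of_mem_uIcc hs
    rw [abs_sub_comm]
    exact this.trans htt
  have htime : ‖e (φ t' y') - e (φ t y') - (t' - t) • chartDeriv c (φ t y) (V (φ t y))‖ ≤
      η * |t' - t| := by
    have hder : ∀ s ∈ uIcc t t', HasDerivWithinAt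
        (fun a => e (φ a y') - a • chartDeriv c (φ t y) (V (φ t y)))
        (chartDeriv c (φ s y') (V (φ s y')) - chartDeriv c (φ t y) (V (φ t y))) (uIcc t t') s := by
      intro s hs
      have h1 := hasDerivAt_extChartAt_flow hφ (hsrc (hflowK s (hseg s hs)))
      have h2 := (hasDerivAt_id s).smul_const (chartDeriv c (φ t y) (V (φ t y)))
      rw [one_smul] at h2
      exact (h1.sub h2).hasDerivWithinAt
    have hbd : ∀ s ∈ uIcc t t',
        ‖chartDeriv c (φ s y') (V (φ s y')) - chartDeriv c (φ t y) (V (φ t y))‖ ≤ η := by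
      intro s hs
      refine hmodV c hc _ hyt _ (hflowK s (hseg s hs)) ?_
      calc edist (φ t y) (φ s y') ≤ edist (φ t y) y + edist y (φ s y') := edist_triangle _ _ _
        _ ≤ ENNReal.ofReal m + ENNReal.ofReal m := by
          gcongr
          · rw [edist_comm]
            exact hytm.trans (ENNReal.ofReal_le_ofReal (by linarith))
          · exact hflow s (hseg s hs)
        _ ≤ ENNReal.ofReal ε₁ := by
          rw [← ENNReal.ofReal_add hmpos.le hmpos.le]
          exact ENNReal.ofReal_le_ofReal (by linarith)
    -- The mean value inequality in time: all velocities on the segment differ from V(φ_t y) by at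
    -- most η in the chart.
    have := (convex_uIcc t t').norm_image_sub_le_of_norm_hasDerivWithin_le hder hbd
      left_mem_uIcc right_mem_uIcc
    rw [Real.norm_eq_abs] at this
    refine le_trans (le_of_eq ?_) this
    congr 1
    rw [sub_smul]
    abel
  have hret : ‖e (φ t y) - e y‖ ≤ 𝒜.C * ε := 𝒜.norm_sub_le c hc y hym _ hyt ε hε hy
  have hret' : ‖e (φ t' y') - e y'‖ ≤ 𝒜.C * ε :=
    𝒜.norm_sub_le c hc y' hy'm _ (hflowK t' (by simpa using hρpos.le)) ε hε hy'
  have hmain := hest c hc t (hTK.trans ht.1) y hym hyt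
    (hy.trans (ENNReal.ofReal_le_ofReal (hεT.trans (hρδ.trans hδε₀)))) w (t' - t)
  rw [hDw] at hmain
  -- The linearized return equation is the difference of the two return displacements, each O(ε),
  -- minus the Taylor remainders in time and in space.
  have hdef : (t' - t) • chartDeriv c (φ t y) (V (φ t y)) +
      chartDeriv c (φ t y) (mfderiv (𝓡 n) (𝓡 n) (φ t) y w) - v =
      (e (φ t' y') - e y') - (e (φ t y) - e y) -
      (e (φ t' y') - e (φ t y') - (t' - t) • chartDeriv c (φ t y) (V (φ t y))) -
      (e (φ t y') - e (φ t y) - chartDeriv c (φ t y) (mfderiv (𝓡 n) (𝓡 n) (φ t) y w)) := by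
    rw [hv]
    abel
  have hres : ‖(t' - t) • chartDeriv c (φ t y) (V (φ t y)) +
      chartDeriv c (φ t y) (mfderiv (𝓡 n) (𝓡 n) (φ t) y w) - v‖ ≤
      2 * 𝒜.C * ε + η * (|t' - t| + ‖v‖) := by
    rw [hdef]
    refine (norm_sub_le _ _).trans ?_
    refine (add_le_add ((norm_sub_le _ _).trans (add_le_add (norm_sub_le _ _) le_rfl))
      le_rfl).trans ?_
    linarith
  have hKη : K * η = 1 / 2 := by
    rw [hη]
    field_simp
  have h1 : |t' - t| + ‖v‖ ≤ K * (|ℓ c v| + (2 * 𝒜.C * ε + η * (|t' - t| + ‖v‖))) :=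
    hmain.trans (by gcongr)
  have h2 : |t' - t| + ‖v‖ ≤ 2 * K * (|ℓ c v| + 2 * 𝒜.C * ε) := by
    have : K * (|ℓ c v| + (2 * 𝒜.C * ε + η * (|t' - t| + ‖v‖))) =
      K * (|ℓ c v| + 2 * 𝒜.C * ε) + K * η * (|t' - t| + ‖v‖) := by ring
    rw [this, hKη] at h1
    linarith
  refine h2.trans ?_
  have h3 := abs_nonneg (ℓ c v)
  calc 2 * K * (|ℓ c v| + 2 * 𝒜.C * ε) ≤ 2 * K * (2 * 𝒜.C * |ℓ c v| + 2 * 𝒜.C * ε) := by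
        have : |ℓ c v| ≤ 2 * 𝒜.C * |ℓ c v| := le_mul_of_one_le_left h3 (by linarith)
        gcongr
    _ = 4 * K * 𝒜.C * (|ℓ c v| + ε) := by ring
    _ ≤ _ := mul_le_mul_of_nonneg_right ((le_max_right _ _).trans (le_max_right _ _))
      (add_nonneg h3 hε)

end Separation

/-! ### Volume of separated sets by double counting -/

section Averaging

/-- Double counting for a measurable relation between two measure spaces. -/
lemma mul_measure_le_of_relation {α β : Type*} [MeasurableSpace α] [MeasurableSpace β]
    (m : Measure α) (ν : Measure β) [SFinite m] [SFinite ν] {S : Set α} (hS : MeasurableSet S)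
    {R : Set (α × β)} (hR : MeasurableSet R) {a b : ℝ≥0∞}
    (ha : ∀ p ∈ S, a ≤ ν {z | (p, z) ∈ R}) (hb : ∀ z, m {p | p ∈ S ∧ (p, z) ∈ R} ≤ b) :
    a * m S ≤ b * ν univ := by
  have hQ : MeasurableSet ((S ×ˢ univ) ∩ R) := (hS.prod MeasurableSet.univ).inter hR
  calc a * m S = ∫⁻ _ in S, a ∂m := by rw [setLIntegral_const]
    _ ≤ ∫⁻ p in S, ν (Prod.mk p ⁻¹' ((S ×ˢ univ) ∩ R)) ∂m := by
        refine setLIntegral_mono' hS fun p hp => (ha p hp).trans (measure_mono fun z hz => ?_)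
        exact ⟨⟨hp, mem_univ _⟩, hz⟩
    _ ≤ ∫⁻ p, ν (Prod.mk p ⁻¹' ((S ×ˢ univ) ∩ R)) ∂m := setLIntegral_le_lintegral _ _
    _ = (m.prod ν) ((S ×ˢ univ) ∩ R) := (Measure.prod_apply hQ).symm
    _ = ∫⁻ z, m ((fun p => (p, z)) ⁻¹' ((S ×ˢ univ) ∩ R)) ∂ν := Measure.prod_apply_symm hQ
    _ ≤ ∫⁻ _, b ∂ν := by
        refine lintegral_mono fun z => (measure_mono fun p hp => ?_).trans (hb z)
        exact ⟨hp.1.1, hp.2⟩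
    _ = b * ν univ := lintegral_const b

/-- At least one half of the ball around t stays in the unit interval, on the side away from the
nearer end point. -/
lemma ofReal_half_le_volume_Icc_inter {T t ρ : ℝ} (hρ1 : ρ ≤ 1) (hρ : 0 < ρ)
    (ht : t ∈ Icc T (T + 1)) :
    ENNReal.ofReal (ρ / 2) ≤ volume.restrict (Icc T (T + 1)) (Metric.closedBall t (ρ / 2)) := by
  rw [Measure.restrict_apply Metric.isClosed_closedBall.measurableSet, Real.closedBall_eq_Icc]
  rcases le_total t (T + 1 / 2) with h | h
  · refine le_trans ?_ (measure_mono (s := Icc t (t + ρ / 2)) fun s hs => ?_)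
    · rw [Real.volume_Icc]
      exact ENNReal.ofReal_le_ofReal (by linarith)
    · exact ⟨⟨by linarith [hs.1], hs.2⟩, by linarith [hs.1, ht.1], by linarith [hs.2]⟩
  · refine le_trans ?_ (measure_mono (s := Icc (t - ρ / 2) t) fun s hs => ?_)
    · rw [Real.volume_Icc]
      exact ENNReal.ofReal_le_ofReal (by linarith)
    · exact ⟨⟨hs.1, by linarith [hs.2]⟩, by linarith [hs.1], by linarith [hs.2, ht.2]⟩

/-- A subset of `[T, T + 1] × X` whose points are separated in all directions but one, in a way that
is quantified by the function `g`, has a small measure. -/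
lemma exists_measure_le_of_separated {X : Type*} [EMetricSpace X] [SecondCountableTopology X]
    [MeasurableSpace X] [BorelSpace X] (μ : Measure X) [IsFiniteMeasure μ] {n : ℕ} {A c B M : ℝ}
    (hA : 0 < A) (hc : 0 < c) (hB : 0 ≤ B) (hM : 0 < M)
    (hupper : ∀ x r, 0 ≤ r → μ (Metric.closedEBall x (ENNReal.ofReal r)) ≤
      ENNReal.ofReal (A * r ^ n))
    (hlower : ∀ x r, 0 < r → r ≤ 1 → ENNReal.ofReal (c * r ^ n) ≤
      μ (Metric.closedEBall x (ENNReal.ofReal r)))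
    {g : X → ℝ} (hg : Measurable g) (hgB : ∀ x, |g x| ≤ B) :
    ∃ D, 0 ≤ D ∧ ∀ (T ρ ε : ℝ) (S : Set (ℝ × X)), MeasurableSet S → S ⊆ Icc T (T + 1) ×ˢ univ →
      0 < ρ → ρ ≤ 1 → 0 < ε → ε ≤ 1 →
      (∀ p ∈ S, ∀ q ∈ S, |q.1 - p.1| ≤ ρ → edist p.2 q.2 ≤ ENNReal.ofReal ρ →
        |q.1 - p.1| ≤ M * (|g q.2 - g p.2| + ε) ∧
        edist p.2 q.2 ≤ ENNReal.ofReal (M * (|g q.2 - g p.2| + ε))) →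
      volume.prod μ S ≤ ENNReal.ofReal (D * (ε ^ n / ρ ^ (n + 1))) := by
  set b₀ := 2 * (3 * M) * (A * (3 * M) ^ n) with hb₀
  set N := μ.real univ * (2 * (B + 1)) with hN
  have hN0 : 0 ≤ N := by positivity
  refine ⟨b₀ * N * 2 ^ n / c, by positivity, ?_⟩
  intro T ρ ε S hS hST hρ hρ1 hε hε1 hsep
  set ν := ((volume.restrict (Icc T (T + 1))).prod μ).prod
    (volume.restrict (Icc (-(B + 1)) (B + 1)) : Measure ℝ) with hν
  -- A point of S is related to the base points within ρ / 2 of it and to the values within ε of g.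
  -- The related set has measure at least of order ρ ^ (n + 1) ε. Conversely, points of S sharing a
  -- relative have g-values within 2 ε, so they lie within 3 M ε of each other, in a set of measure
  -- O(ε ^ (n + 1)). The quotient is ε ^ n / ρ ^ (n + 1). Values of g range over a window enlarged
  -- by 1 to contain these ε-balls.
  set R : Set ((ℝ × X) × ((ℝ × X) × ℝ)) :=
    {w | dist w.2.1.1 w.1.1 ≤ ρ / 2 ∧ edist w.2.1.2 w.1.2 ≤ ENNReal.ofReal (ρ / 2) ∧
      dist w.2.2 (g w.1.2) ≤ ε} with hR
  have hRm : MeasurableSet R := by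
    have e1 : Measurable fun w : (ℝ × X) × ((ℝ × X) × ℝ) => dist w.2.1.1 w.1.1 := by fun_prop
    have e2 : Measurable fun w : (ℝ × X) × ((ℝ × X) × ℝ) => edist w.2.1.2 w.1.2 :=
      (continuous_edist (α := X)).measurable.comp
        (by fun_prop : Measurable fun w : (ℝ × X) × ((ℝ × X) × ℝ) => (w.2.1.2, w.1.2))
    have e3 : Measurable fun w : (ℝ × X) × ((ℝ × X) × ℝ) => dist w.2.2 (g w.1.2) :=
      Measurable.dist (by fun_prop) (hg.comp (by fun_prop))
    exact (measurableSet_le e1 measurable_const).inter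
      ((measurableSet_le e2 measurable_const).inter (measurableSet_le e3 measurable_const))
  have h1 := mul_measure_le_of_relation (volume.prod μ) ν hS hRm
    (a := ENNReal.ofReal (ρ / 2) * ENNReal.ofReal (c * (ρ / 2) ^ n) * ENNReal.ofReal (2 * ε))
    (b := ENNReal.ofReal (2 * (3 * M * ε)) * ENNReal.ofReal (A * (3 * M * ε) ^ n)) ?_ ?_
  · have hνu : ν univ = ENNReal.ofReal N := by
      rw [hν, ← univ_prod_univ, Measure.prod_prod, ← univ_prod_univ, Measure.prod_prod,
        Measure.restrict_apply_univ, Measure.restrict_apply_univ, Real.volume_Icc, Real.volume_Icc,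
        add_sub_cancel_left, ENNReal.ofReal_one, one_mul, hN, ENNReal.ofReal_mul (by positivity),
        ofReal_measureReal]
      congr 2
      ring
    rw [hνu, ← ENNReal.ofReal_mul (by positivity), ← ENNReal.ofReal_mul (by positivity),
      ← ENNReal.ofReal_mul (by positivity), ← ENNReal.ofReal_mul (by positivity)] at h1
    have ha : 0 < ρ / 2 * (c * (ρ / 2) ^ n) * (2 * ε) := by positivity
    rw [mul_comm, ← ENNReal.le_div_iff_mul_le (Or.inl (by simpa using ha))
      (Or.inl ENNReal.ofReal_ne_top), ← ENNReal.ofReal_div_of_pos ha] at h1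
    refine h1.trans (le_of_eq ?_)
    congr 1
    rw [hb₀, mul_pow (3 * M), div_pow, pow_succ]
    field_simp
  · intro p hp
    have hpT := (hST hp).1
    refine le_trans ?_ (measure_mono (s := (Metric.closedBall p.1 (ρ / 2) ×ˢ
      Metric.closedEBall p.2 (ENNReal.ofReal (ρ / 2))) ×ˢ Metric.closedBall (g p.2) ε) ?_)
    · rw [hν, Measure.prod_prod, Measure.prod_prod]
      refine mul_le_mul' (mul_le_mul' (ofReal_half_le_volume_Icc_inter hρ1 hρ hpT)
        (hlower _ _ (by linarith) (by linarith))) ?_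
      have hgp := abs_le.1 (hgB p.2)
      rw [Measure.restrict_apply Metric.isClosed_closedBall.measurableSet,
        inter_eq_left.2, Real.volume_closedBall]
      rw [Real.closedBall_eq_Icc]
      exact Icc_subset_Icc (by linarith) (by linarith)
    · rintro ⟨⟨t, x⟩, s⟩ ⟨⟨h1, h2⟩, h3⟩
      exact ⟨h1, h2, h3⟩
  · intro z
    rcases eq_empty_or_nonempty {p | p ∈ S ∧ (p, z) ∈ R} with he | ⟨p, hp, hpt, hpx, hpg⟩
    · rw [he, measure_empty]
      exact zero_le
    · simp only at hpt hpx hpg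
      rw [← Real.volume_closedBall p.1]
      refine le_trans (measure_mono (t := Metric.closedBall p.1 (3 * M * ε) ×ˢ
        Metric.closedEBall p.2 (ENNReal.ofReal (3 * M * ε))) ?_) ?_
      · rintro q ⟨hq, hqt, hqx, hqg⟩
        simp only at hqt hqx hqg
        have ht : |q.1 - p.1| ≤ ρ := by
          rw [← Real.dist_eq]
          refine (dist_triangle_left _ _ z.1.1).trans ?_
          linarith
        have hx : edist p.2 q.2 ≤ ENNReal.ofReal ρ := by
          refine (edist_triangle_left _ _ z.1.2).trans ?_
          refine (add_le_add hpx hqx).trans (le_of_eq ?_)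
          rw [← ENNReal.ofReal_add (by positivity) (by positivity)]
          congr 1
          ring
        have hgg : |g q.2 - g p.2| ≤ 2 * ε := by
          rw [← Real.dist_eq]
          refine (dist_triangle_left _ _ z.2).trans ?_
          linarith
        have hle : M * (|g q.2 - g p.2| + ε) ≤ 3 * M * ε := by
          have := mul_le_mul_of_nonneg_left hgg hM.le
          linarith
        obtain ⟨h1, h2⟩ := hsep p hp q hq ht hx
        refine ⟨?_, ?_⟩
        · rw [Metric.mem_closedBall, Real.dist_eq]
          exact h1.trans hle
        · rw [Metric.mem_closedEBall, edist_comm]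
          exact h2.trans (ENNReal.ofReal_le_ofReal hle)
      · rw [Measure.prod_prod]
        exact mul_le_mul_right (hupper _ _ (by positivity)) _

end Averaging

/-! ### Volume of the near-returns -/

section Returns

variable {n : ℕ} {X : Type*} [EMetricSpace X] [CompactSpace X] [SecondCountableTopology X]
  [ChartedSpace (EuclideanSpace ℝ (Fin n)) X]
  [IsManifold (𝓡 n) ∞ X] [RiemannianBundle (fun x : X => TangentSpace (𝓡 n) x)]
  [IsContinuousRiemannianBundle (EuclideanSpace ℝ (Fin n)) (fun x : X => TangentSpace (𝓡 n) x)]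
  [IsRiemannianManifold (𝓡 n) X] [MeasurableSpace X] [BorelSpace X]

omit [CompactSpace X] [SecondCountableTopology X]
  [ChartedSpace (EuclideanSpace ℝ (Fin n)) X]
  [IsManifold (𝓡 n) ∞ X] [RiemannianBundle (fun x : X => TangentSpace (𝓡 n) x)]
  [IsContinuousRiemannianBundle (EuclideanSpace ℝ (Fin n)) (fun x : X => TangentSpace (𝓡 n) x)]
  [IsRiemannianManifold (𝓡 n) X] [MeasurableSpace X] [BorelSpace X] in
lemma isClosed_setOf_eball_subset (K : Set X) (r : ℝ≥0∞) :
    IsClosed {y : X | ∀ z, edist y z < r → z ∈ K} := by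
  simp only [ofPred_forall]
  refine isClosed_iInter fun z => ?_
  by_cases hz : z ∈ K
  · simp [hz]
  · simp only [hz, imp_false, not_lt]
    exact isClosed_le continuous_const (continuous_id.edist continuous_const)

omit [CompactSpace X] [ChartedSpace (EuclideanSpace ℝ (Fin n)) X]
  [IsManifold (𝓡 n) ∞ X] [RiemannianBundle (fun x : X => TangentSpace (𝓡 n) x)]
  [IsContinuousRiemannianBundle (EuclideanSpace ℝ (Fin n)) (fun x : X => TangentSpace (𝓡 n) x)]
  [IsRiemannianManifold (𝓡 n) X] in
lemma measurableSet_return {φ : ℝ → X → X} (hφ : Continuous fun p : ℝ × X => φ p.1 p.2) (r : ℝ≥0∞) :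
    MeasurableSet {p : ℝ × X | edist p.2 (φ p.1 p.2) ≤ r} :=
  (isClosed_le (continuous_snd.edist hφ) continuous_const).measurableSet

/-- The set of near-closed orbits with a large period has a small measure. -/
lemma IsAnosov.exists_measure_return_le_of_large {μ : Measure X}
    (hμ : IsSmoothDensity (n := n) μ) {φ : ℝ → X → X} {V : (x : X) → TangentSpace (𝓡 n) x}
    (hφ : IsSmoothFlow V φ) (hA : IsAnosov V φ) (hn : 0 < n) :
    ∃ C > 0, ∀ T ≥ C, ∀ ε > 0,
      ∫⁻ t in Icc T (T + 1), μ {y | edist y (φ t y) ≤ ENNReal.ofReal ε} ≤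
        ENNReal.ofReal (C * Real.exp (C * T) * ε ^ n) := by
  have := hμ.isFiniteMeasure
  obtain ⟨𝒜, ℓ, K, L, δ, hK, hL, hδ, hδ1, hsep⟩ := hA.exists_separation hφ hn
  obtain ⟨A, hA0, hupper⟩ := hμ.exists_measure_closedEBall_le
  obtain ⟨c, hc, hlower⟩ := hμ.exists_le_measure_closedEBall
  have hφc := hφ.smooth_flow.continuous
  have hCA := 𝒜.one_le_C
  -- the estimate in each of the charts
  set P : X → ℝ → ℝ → ℝ → Set (ℝ × X) := fun x T ε r =>
    {p | (p.1 ∈ Icc T (T + 1) ∧ edist p.2 (φ p.1 p.2) ≤ ENNReal.ofReal ε) ∧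
      ∀ z, edist p.2 z < ENNReal.ofReal r → z ∈ 𝒜.K x} with hP
  have hchart : ∀ x ∈ 𝒜.s, ∃ D, 0 ≤ D ∧ ∀ T ≥ K, ∀ ε, 0 < ε →
      ε ≤ δ * Real.exp (-(L * T)) → volume.prod μ (P x T ε 𝒜.r) ≤
        ENNReal.ofReal (D * (ε ^ n / (δ * Real.exp (-(L * T))) ^ (n + 1))) := by
    intro x hx
    have hcont : ContinuousOn (fun y => ℓ x (extChartAt (𝓡 n) x y)) (𝒜.K x) :=
      (ℓ x).continuous.comp_continuousOn
        ((continuousOn_extChartAt x).mono (𝒜.subset_source x hx))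
    obtain ⟨B, hB⟩ := (𝒜.isCompact x hx).exists_bound_of_continuousOn hcont
    classical
    -- Outside the compact set the chart need not be regular; the extension by 0 makes the function
    -- globally measurable and bounded.
    set g : X → ℝ := (𝒜.K x).piecewise (fun y => ℓ x (extChartAt (𝓡 n) x y)) (fun _ => 0) with hg
    have hgm : Measurable g := hcont.measurable_piecewise continuousOn_const
      (𝒜.isCompact x hx).isClosed.measurableSet
    have hgB : ∀ y, |g y| ≤ max B 0 := by
      intro y
      by_cases hy : y ∈ 𝒜.K x
      · rw [hg, piecewise_eq_of_mem _ _ _ hy]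
        exact (hB y hy).trans (le_max_left _ _)
      · rw [hg, piecewise_eq_of_notMem _ _ _ hy, abs_zero]
        exact le_max_right _ _
    obtain ⟨D, hD, hmain⟩ := exists_measure_le_of_separated μ hA0 hc (le_max_right B 0)
      (M := 𝒜.C * K) (by positivity) hupper hlower hgm hgB
    refine ⟨D, hD, fun T hT ε hε hεT => ?_⟩
    have hρ1 : δ * Real.exp (-(L * T)) ≤ 1 := by
      refine mul_le_one₀ hδ1 (Real.exp_pos _).le (Real.exp_le_one_iff.2 ?_)
      have : 0 ≤ L * T := mul_nonneg hL.le (by linarith)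
      linarith
    refine hmain T _ ε _ ?_ (fun p hp => ⟨hp.1.1, mem_univ _⟩) (by positivity) hρ1 hε
      (hεT.trans hρ1) ?_
    · refine MeasurableSet.inter (MeasurableSet.inter (measurable_fst measurableSet_Icc)
        (measurableSet_return hφc _)) ?_
      exact measurable_snd (isClosed_setOf_eball_subset (𝒜.K x) _).measurableSet
    · intro p hp q hq hpq hd
      have hmem : ∀ p ∈ P x T ε 𝒜.r, p.2 ∈ 𝒜.K x := fun p hp =>
        hp.2 _ (by rw [edist_self]; exact ENNReal.ofReal_pos.2 𝒜.r_pos)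
      have hgp : g p.2 = ℓ x (extChartAt (𝓡 n) x p.2) := piecewise_eq_of_mem _ _ _ (hmem p hp)
      have hgq : g q.2 = ℓ x (extChartAt (𝓡 n) x q.2) := piecewise_eq_of_mem _ _ _ (hmem q hq)
      have h1 := hsep T hT ε hε.le hεT x hx p.1 hp.1.1 q.1 hq.1.1 hpq p.2 q.2 hp.2 hd hp.1.2
        hq.1.2
      rw [map_sub, ← hgp, ← hgq] at h1
      have h2 := norm_nonneg (extChartAt (𝓡 n) x q.2 - extChartAt (𝓡 n) x p.2)
      have h3 := abs_nonneg (q.1 - p.1)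
      have h4 : 0 ≤ K * (|g q.2 - g p.2| + ε) := by positivity
      constructor
      · rw [mul_assoc]
        nlinarith
      · refine (𝒜.edist_le x hx _ (hmem p hp) _ (hmem q hq)).trans (ENNReal.ofReal_le_ofReal ?_)
        rw [mul_assoc]
        gcongr
        linarith
  choose! D hD hchart using hchart
  have hD' : 0 ≤ ∑ x ∈ 𝒜.s, D x := Finset.sum_nonneg hD
  set D₀ := (∑ x ∈ 𝒜.s, D x + μ.real univ) / δ ^ (n + 1) with hD₀
  have hD₀0 : 0 ≤ D₀ := by positivity
  set C := K + D₀ + L * (n + 1) with hC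
  have hCpos : 0 < C := by positivity
  refine ⟨C, hCpos, fun T hT ε hε => ?_⟩
  have hTK : K ≤ T := by
    have : 0 ≤ L * (n + 1) := by positivity
    linarith
  have hT0 : 0 < T := by linarith
  set ρ := δ * Real.exp (-(L * T)) with hρ
  have hρpos : 0 < ρ := by positivity
  have hρ1 : ρ ≤ 1 := by
    refine mul_le_one₀ hδ1 (Real.exp_pos _).le (Real.exp_le_one_iff.2 ?_)
    have : 0 ≤ L * T := mul_nonneg hL.le (by linarith)
    linarith
  have hbound : (∑ x ∈ 𝒜.s, D x + μ.real univ) * (ε ^ n / ρ ^ (n + 1)) ≤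
      C * Real.exp (C * T) * ε ^ n := by
    have e1 : (∑ x ∈ 𝒜.s, D x + μ.real univ) * (ε ^ n / ρ ^ (n + 1)) =
        D₀ * Real.exp (L * (n + 1) * T) * ε ^ n := by
      have : Real.exp (L * (n + 1) * T) = (Real.exp (L * T)) ^ (n + 1) := by
        rw [← Real.exp_nat_mul]
        congr 1
        push_cast
        ring
      rw [hD₀, hρ, this, mul_pow, Real.exp_neg, inv_pow]
      field_simp
    rw [e1]
    have e2 : D₀ ≤ C := by
      have : 0 ≤ L * (n + 1) := by positivity
      linarith
    have e3 : L * (n + 1) * T ≤ C * T := by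
      refine mul_le_mul_of_nonneg_right ?_ hT0.le
      linarith
    exact mul_le_mul_of_nonneg_right (mul_le_mul e2 (Real.exp_le_exp.2 e3) (Real.exp_pos _).le
      hCpos.le) (by positivity)
  refine le_trans ?_ (ENNReal.ofReal_le_ofReal hbound)
  rcases le_total ε ρ with hερ | hερ
  · have hmeas : MeasurableSet {p : ℝ × X | p.1 ∈ Icc T (T + 1) ∧
        edist p.2 (φ p.1 p.2) ≤ ENNReal.ofReal ε} :=
      (measurable_fst measurableSet_Icc).inter (measurableSet_return hφc _)
    calc ∫⁻ t in Icc T (T + 1), μ {y | edist y (φ t y) ≤ ENNReal.ofReal ε}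
        = volume.prod μ {p : ℝ × X | p.1 ∈ Icc T (T + 1) ∧
          edist p.2 (φ p.1 p.2) ≤ ENNReal.ofReal ε} := by
          rw [Measure.prod_apply hmeas, ← lintegral_indicator measurableSet_Icc]
          refine lintegral_congr fun t => ?_
          by_cases ht : t ∈ Icc T (T + 1)
          · rw [indicator_of_mem ht]
            congr 1
            ext y
            simp only [mem_ofPred_eq, mem_preimage, ht, true_and]
          · rw [indicator_of_notMem ht]
            simp only [preimage_ofPred_eq, ht, false_and, ofPred_false, measure_empty]
      _ ≤ volume.prod μ (⋃ x ∈ 𝒜.s, P x T ε 𝒜.r) := by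
          refine measure_mono fun p hp => ?_
          obtain ⟨x, hx, hball, -⟩ := 𝒜.exists_chart p.2
          simp only [mem_iUnion]
          exact ⟨x, hx, hp, hball⟩
      _ ≤ ∑ x ∈ 𝒜.s, volume.prod μ (P x T ε 𝒜.r) := measure_biUnion_finset_le _ _
      _ ≤ ∑ x ∈ 𝒜.s, ENNReal.ofReal (D x * (ε ^ n / ρ ^ (n + 1))) :=
          Finset.sum_le_sum fun x hx => hchart x hx T hTK ε hε hερ
      _ = ENNReal.ofReal (∑ x ∈ 𝒜.s, D x * (ε ^ n / ρ ^ (n + 1))) := by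
          rw [ENNReal.ofReal_sum_of_nonneg]
          exact fun x hx => mul_nonneg (hD x hx) (by positivity)
      _ ≤ _ := by
          refine ENNReal.ofReal_le_ofReal ?_
          rw [← Finset.sum_mul]
          gcongr
          linarith [measureReal_nonneg (μ := μ) (s := univ)]
  -- If ε exceeds the separation scale ρ ≤ 1, then ε ^ n / ρ ^ (n + 1) ≥ 1 and the total mass
  -- suffices.
  · calc ∫⁻ t in Icc T (T + 1), μ {y | edist y (φ t y) ≤ ENNReal.ofReal ε}
        ≤ ∫⁻ t in Icc T (T + 1), μ univ := lintegral_mono fun t => measure_mono (subset_univ _)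
      _ = ENNReal.ofReal (μ.real univ) := by
          rw [setLIntegral_const, Real.volume_Icc, add_sub_cancel_left, ENNReal.ofReal_one,
            mul_one, ofReal_measureReal]
      _ ≤ _ := by
          refine ENNReal.ofReal_le_ofReal ?_
          have h1 : 1 ≤ ε ^ n / ρ ^ (n + 1) := by
            rw [one_le_div (by positivity)]
            calc ρ ^ (n + 1) ≤ ρ ^ n := pow_le_pow_of_le_one hρpos.le hρ1 (Nat.le_succ n)
              _ ≤ ε ^ n := by gcongr
          have h2 := measureReal_nonneg (μ := μ) (s := univ)
          nlinarith

omit [CompactSpace X] [SecondCountableTopology X]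
  [ChartedSpace (EuclideanSpace ℝ (Fin n)) X]
  [IsManifold (𝓡 n) ∞ X] [RiemannianBundle (fun x : X => TangentSpace (𝓡 n) x)]
  [IsContinuousRiemannianBundle (EuclideanSpace ℝ (Fin n)) (fun x : X => TangentSpace (𝓡 n) x)]
  [IsRiemannianManifold (𝓡 n) X] [MeasurableSpace X] [BorelSpace X] in
-- The successive points φ_{kt} y and φ_{(k+1)t} y are images of y and φ_t y under φ_{kt}. Their
-- distances are bounded by the Lipschitz constant and summed by the triangle inequality.
lemma edist_flow_mul_le {φ : ℝ → X → X} (h0 : ∀ x, φ 0 x = x)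
    (hadd : ∀ s t x, φ (s + t) x = φ s (φ t x)) {t Λ : ℝ} (ht : 0 ≤ t) (hΛ : 0 ≤ Λ)
    (hlip : ∀ t, LipschitzWith (Real.toNNReal (Real.exp (Λ * (|t| + 1)))) (φ t)) (N : ℕ) {r : ℝ}
    (hr : 0 ≤ r) {y : X} (hy : edist y (φ t y) ≤ ENNReal.ofReal r) :
    edist y (φ (N * t) y) ≤ ENNReal.ofReal (N * Real.exp (Λ * (N * t + 1)) * r) := by
  have main : ∀ k ≤ N, edist y (φ (k * t) y) ≤
      ENNReal.ofReal (k * Real.exp (Λ * (N * t + 1)) * r) := by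
    intro k
    induction k with
    | zero => simp [h0]
    | succ k ih =>
      intro hk
      have e1 : φ ((k + 1 : ℕ) * t) y = φ (k * t) (φ t y) := by
        rw [← hadd]
        push_cast
        ring_nf
      have e2 : edist (φ (k * t) y) (φ (k * t) (φ t y)) ≤
          ENNReal.ofReal (Real.exp (Λ * (N * t + 1)) * r) := by
        refine (hlip (k * t) y (φ t y)).trans ?_
        rw [ENNReal.ofReal_mul (Real.exp_pos _).le]
        refine mul_le_mul' (ENNReal.ofReal_le_ofReal (Real.exp_le_exp.2 ?_)) hy
        rw [abs_of_nonneg (by positivity)]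
        have : (k : ℝ) ≤ N := by exact_mod_cast (Nat.le_succ k).trans hk
        gcongr
      rw [e1]
      refine (edist_triangle _ (φ (k * t) y) _).trans
        ((add_le_add (ih ((Nat.le_succ k).trans hk)) e2).trans (le_of_eq ?_))
      rw [← ENNReal.ofReal_add (by positivity) (by positivity)]
      congr 1
      push_cast
      ring
  exact main N le_rfl

lemma setLIntegral_Icc_add_natCast_le {f : ℝ → ℝ≥0∞} {b : ℝ≥0∞} (a : ℝ) (N : ℕ)
    (h : ∀ k < N, ∫⁻ t in Icc (a + k) (a + k + 1), f t ≤ b) :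
    ∫⁻ t in Icc a (a + N), f t ≤ N * b := by
  induction N with
  | zero => simp
  | succ N ih =>
    have e : Icc a (a + (N + 1 : ℕ)) ⊆ Icc a (a + N) ∪ Icc (a + N) (a + N + 1) := by
      intro s hs
      rcases le_total s (a + N) with h | h
      · exact Or.inl ⟨hs.1, h⟩
      · refine Or.inr ⟨h, ?_⟩
        have := hs.2
        push_cast at this
        linarith
    refine (lintegral_mono_set e).trans ((lintegral_union_le _ _ _).trans ?_)
    push_cast
    rw [add_mul, one_mul]
    exact add_le_add (ih fun k hk => h k (hk.trans (Nat.lt_succ_self N))) (h N (Nat.lt_succ_self N))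

lemma setLIntegral_Icc_comp_natCast_mul_le {f : ℝ → ℝ≥0∞} (hf : Measurable f) {N : ℕ} (hN : 0 < N)
    (T : ℝ) : ∫⁻ t in Icc T (T + 1), f (N * t) ≤ ∫⁻ t in Icc (N * T) (N * T + N), f t := by
  have hN0 : (N : ℝ) ≠ 0 := by positivity
  have hN1 : (1 : ℝ) ≤ N := by exact_mod_cast hN
  have hgm : Measurable ((Icc (N * T) (N * T + N)).indicator f) := hf.indicator measurableSet_Icc
  calc ∫⁻ t in Icc T (T + 1), f (N * t)
      = ∫⁻ t, (Icc (N * T) (N * T + N)).indicator f (N * t) := by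
        rw [← lintegral_indicator measurableSet_Icc]
        refine lintegral_congr fun t => ?_
        have : t ∈ Icc T (T + 1) ↔ (N : ℝ) * t ∈ Icc (N * T) (N * T + N) := by
          have hNpos : (0 : ℝ) < N := by positivity
          rw [mem_Icc, mem_Icc, mul_le_mul_iff_right₀ hNpos, ← mul_add_one,
            mul_le_mul_iff_right₀ hNpos]
        by_cases ht : t ∈ Icc T (T + 1)
        · rw [indicator_of_mem ht, indicator_of_mem (this.1 ht)]
        · rw [indicator_of_notMem ht, indicator_of_notMem (fun h => ht (this.2 h))]
    _ = ∫⁻ s, (Icc (N * T) (N * T + N)).indicator f s ∂(volume.map fun t : ℝ => N * t) :=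
        (lintegral_map hgm (measurable_const_mul _)).symm
    _ = ENNReal.ofReal |(N : ℝ)⁻¹| * ∫⁻ t in Icc (N * T) (N * T + N), f t := by
        rw [Real.map_volume_mul_left hN0, lintegral_smul_measure, lintegral_indicator
          measurableSet_Icc, smul_eq_mul]
    _ ≤ _ := by
        refine mul_le_of_le_one_left' ?_
        rw [abs_of_nonneg (by positivity), ← ENNReal.ofReal_one]
        exact ENNReal.ofReal_le_ofReal (inv_le_one_of_one_le₀ hN1)

/-- The set of near-closed orbits has a small measure. -/
lemma IsAnosov.exists_measure_return_le {μ : Measure X}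
    (hμ : IsSmoothDensity (n := n) μ) {φ : ℝ → X → X} {V : (x : X) → TangentSpace (𝓡 n) x}
    (hφ : IsSmoothFlow V φ) (hA : IsAnosov V φ) {t₀ : ℝ} (ht₀ : 0 < t₀) :
    ∃ C > 0, ∀ T ≥ t₀, ∀ ε > 0,
      ∫⁻ t in Icc T (T + 1), μ {y | edist y (φ t y) ≤ ENNReal.ofReal ε} ≤
        ENNReal.ofReal (C * Real.exp (C * T) * ε ^ n) := by
  have := hμ.isFiniteMeasure
  -- In dimension 0 the field is necessarily zero and hyperbolicity gives nothing, but ε ^ n = 1 and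
  -- the total mass suffices.
  rcases Nat.eq_zero_or_pos n with rfl | hn
  · refine ⟨μ.real univ + 1, by positivity, fun T hT ε hε => ?_⟩
    calc ∫⁻ t in Icc T (T + 1), μ {y | edist y (φ t y) ≤ ENNReal.ofReal ε}
        ≤ ∫⁻ t in Icc T (T + 1), μ univ := lintegral_mono fun t => measure_mono (subset_univ _)
      _ = ENNReal.ofReal (μ.real univ) := by
          rw [setLIntegral_const, Real.volume_Icc, add_sub_cancel_left, ENNReal.ofReal_one,
            mul_one, ofReal_measureReal]
      _ ≤ _ := by
          refine ENNReal.ofReal_le_ofReal ?_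
          have h2 := measureReal_nonneg (μ := μ) (s := univ)
          have h3 : 1 ≤ Real.exp ((μ.real univ + 1) * T) :=
            Real.one_le_exp (mul_nonneg (by linarith) (by linarith))
          rw [pow_zero, mul_one]
          nlinarith
  obtain ⟨C, hC, hlarge⟩ := hA.exists_measure_return_le_of_large hμ hφ hn
  obtain ⟨Λ, hΛ, hlip⟩ := exists_edist_flow_le hφ.smooth_flow hφ.zero hφ.add
  -- With this N, all times N t with t ≥ t₀ lie in the range of the estimate for large times. N
  -- depends on t₀ only, so the growth of the iterated errors stays exponential in T.
  obtain ⟨N, hN⟩ := exists_nat_gt (C / t₀)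
  have hNpos : (0 : ℝ) < N := lt_trans (by positivity) hN
  have hN0 : 0 < N := by exact_mod_cast hNpos
  rw [div_lt_iff₀ ht₀] at hN
  set b := Λ * (N + 1) with hb
  set D := N * (C * Real.exp (C * N) * (N * Real.exp b) ^ n) with hD
  have hDpos : 0 < D := by positivity
  set C' := D + C * N + Λ * N * n with hC'
  refine ⟨C', by positivity, fun T hT ε hε => ?_⟩
  have hT0 : 0 < T := ht₀.trans_le hT
  set ε' := N * Real.exp (Λ * (N * (T + 1) + 1)) * ε with hε'
  have hε'pos : 0 < ε' := by positivity
  set f : ℝ → ℝ≥0∞ := fun t => μ {y | edist y (φ t y) ≤ ENNReal.ofReal ε'} with hf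
  have hfm : Measurable f :=
    measurable_measure_prodMk_left (measurableSet_return hφ.smooth_flow.continuous _)
  calc ∫⁻ t in Icc T (T + 1), μ {y | edist y (φ t y) ≤ ENNReal.ofReal ε}
      ≤ ∫⁻ t in Icc T (T + 1), f (N * t) := by
        refine setLIntegral_mono' measurableSet_Icc fun t ht => measure_mono fun y hy => ?_
        refine (edist_flow_mul_le hφ.zero hφ.add (hT0.le.trans ht.1) hΛ hlip N hε.le hy).trans
          (ENNReal.ofReal_le_ofReal ?_)
        rw [hε']
        have := ht.2
        gcongr
    _ ≤ ∫⁻ t in Icc (N * T) (N * T + N), f t := setLIntegral_Icc_comp_natCast_mul_le hfm hN0 T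
    _ ≤ N * ENNReal.ofReal (C * Real.exp (C * (N * T + N)) * ε' ^ n) := by
        refine setLIntegral_Icc_add_natCast_le _ _ fun k hk => ?_
        have hk' : (k : ℝ) ≤ N := by exact_mod_cast hk.le
        have hNT : C ≤ N * T + k := by
          have : (N : ℝ) * t₀ ≤ N * T := by gcongr
          have : (0 : ℝ) ≤ k := Nat.cast_nonneg k
          linarith
        refine (hlarge (N * T + k) hNT ε' hε'pos).trans (ENNReal.ofReal_le_ofReal ?_)
        gcongr
    _ = ENNReal.ofReal (N * (C * Real.exp (C * (N * T + N)) * ε' ^ n)) := by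
        rw [ENNReal.ofReal_mul hNpos.le, ENNReal.ofReal_natCast]
    _ ≤ _ := by
        refine ENNReal.ofReal_le_ofReal ?_
        have e1 : N * (C * Real.exp (C * (N * T + N)) * ε' ^ n) =
            D * Real.exp ((C * N + Λ * N * n) * T) * ε ^ n := by
          have h1 : Real.exp (C * (N * T + N)) = Real.exp (C * N) * Real.exp (C * N * T) := by
            rw [← Real.exp_add]
            congr 1
            ring
          have h2 : Real.exp (Λ * (N * (T + 1) + 1)) = Real.exp b * Real.exp (Λ * N * T) := by
            rw [← Real.exp_add, hb]
            congr 1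
            ring
          have h3 : Real.exp ((C * N + Λ * N * n) * T) =
              Real.exp (C * N * T) * Real.exp (Λ * N * T) ^ n := by
            rw [← Real.exp_nat_mul, ← Real.exp_add]
            congr 1
            ring
          rw [hε', h1, h2, h3, hD]
          ring
        rw [e1]
        have e2 : 0 ≤ Λ * N * n := by positivity
        have e3 : 0 ≤ C * N := by positivity
        refine mul_le_mul_of_nonneg_right (mul_le_mul (by linarith) (Real.exp_le_exp.2 ?_)
          (Real.exp_pos _).le (by linarith)) (by positivity)
        exact mul_le_mul_of_nonneg_right (by linarith) hT0.le

end Returns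

/-! ### Pullbacks and integral operators on L²; trace and trace norm -/

section L2Operators

variable {X : Type*} [MeasurableSpace X] {μ : Measure X}

lemma norm_sq_eq_integral (u : Lp ℂ 2 μ) : ‖u‖ ^ 2 = ∫ x, ‖u x‖ ^ 2 ∂μ := by
  have h := @inner_self_eq_norm_sq_to_K ℂ _ _ _ _ u
  rw [L2.inner_def] at h
  have h2 : ∀ x, ⟪u x, u x⟫_ℂ = ((‖u x‖ ^ 2 : ℝ) : ℂ) := fun x => by
    rw [inner_self_eq_norm_sq_to_K]
    push_cast
    rfl
  simp_rw [h2] at h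
  rw [integral_complex_ofReal] at h
  have h3 : ((∫ x, ‖u x‖ ^ 2 ∂μ : ℝ) : ℂ) = ((‖u‖ ^ 2 : ℝ) : ℂ) := by
    rw [h]
    push_cast
    rfl
  exact (Complex.ofReal_injective h3).symm

lemma integrable_norm_sq (u : Lp ℂ 2 μ) : Integrable (fun x => ‖u x‖ ^ 2) μ :=
  (Lp.memLp u).integrable_norm_pow (by norm_num)

/-- The squared norm of u ∘ f is the integral of |u| ^ 2 against the push-forward of μ, hence the
square of c in the assumption. Domination of the push-forward also makes u ∘ f independent of the
representative of u. -/
lemma exists_isPullback {f : X → X} (hf : Measurable f) {c : ℝ} (hc : 0 ≤ c)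
    (h : μ.map f ≤ ENNReal.ofReal (c ^ 2) • μ) :
    ∃ Φ : Lp ℂ 2 μ →L[ℂ] Lp ℂ 2 μ, IsPullback μ f Φ ∧ ‖Φ‖ ≤ c := by
  have hq : Measure.QuasiMeasurePreserving f μ μ :=
    ⟨hf, Measure.absolutelyContinuous_of_le_smul h⟩
  have hle : ∀ u : Lp ℂ 2 μ, eLpNorm (u ∘ f) 2 μ ≤ ENNReal.ofReal c * eLpNorm u 2 μ := by
    intro u
    rw [← eLpNorm_map_measure ((Lp.aestronglyMeasurable u).mono_ac hq.absolutelyContinuous)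
      hf.aemeasurable]
    refine (eLpNorm_mono_measure _ h).trans ?_
    rw [eLpNorm_smul_measure_of_ne_top (by simp), smul_eq_mul]
    refine mul_le_mul' (le_of_eq ?_) le_rfl
    rw [ENNReal.ofReal_rpow_of_nonneg (by positivity) (by positivity)]
    congr 1
    rw [one_div, ENNReal.toReal_inv, ENNReal.toReal_ofNat]
    simpa using Real.pow_rpow_inv_natCast hc two_ne_zero
  have hmem : ∀ u : Lp ℂ 2 μ, MemLp (u ∘ f) 2 μ := fun u =>
    ⟨(Lp.aestronglyMeasurable u).comp_quasiMeasurePreserving hq,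
      (hle u).trans_lt (ENNReal.mul_lt_top ENNReal.ofReal_lt_top (Lp.eLpNorm_lt_top u))⟩
  let L : Lp ℂ 2 μ →ₗ[ℂ] Lp ℂ 2 μ :=
    { toFun := fun u => (hmem u).toLp _
      map_add' := fun u v => by
        refine Lp.ext ?_
        filter_upwards [(hmem (u + v)).coeFn_toLp, (hmem u).coeFn_toLp, (hmem v).coeFn_toLp,
          Lp.coeFn_add ((hmem u).toLp _) ((hmem v).toLp _), hq.ae_eq_comp (Lp.coeFn_add u v)]
          with x h1 h2 h3 h4 h5
        rw [h1, h4, Pi.add_apply, h2, h3, h5]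
        rfl
      map_smul' := fun a u => by
        refine Lp.ext ?_
        filter_upwards [(hmem (a • u)).coeFn_toLp, (hmem u).coeFn_toLp,
          Lp.coeFn_smul a ((hmem u).toLp _), hq.ae_eq_comp (Lp.coeFn_smul a u)]
          with x h1 h2 h3 h4
        rw [h1, RingHom.id_apply, h3, Pi.smul_apply, h2, h4]
        rfl }
  have hL : ∀ u, ‖L u‖ ≤ c * ‖u‖ := by
    intro u
    change ‖(hmem u).toLp _‖ ≤ c * ‖u‖
    have e : c * ‖u‖ = (ENNReal.ofReal c * eLpNorm u 2 μ).toReal := by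
      rw [ENNReal.toReal_mul, ENNReal.toReal_ofReal hc, Lp.norm_def]
    rw [Lp.norm_toLp, e]
    exact ENNReal.toReal_mono
      (ENNReal.mul_lt_top ENNReal.ofReal_lt_top (Lp.eLpNorm_lt_top u)).ne (hle u)
  exact ⟨L.mkContinuous c hL, fun u => (hmem u).coeFn_toLp, L.mkContinuous_norm_le hc _⟩

variable [IsFiniteMeasure μ]

section Kernel

variable {K : X → X → ℝ} (hK : Measurable (Function.uncurry K)) {B : ℝ} (hB : ∀ x y, |K x y| ≤ B)

include hK hB in
lemma memLp_kernel_section (x : X) : MemLp (fun y => (K x y : ℂ)) 2 μ :=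
  MemLp.of_bound (Complex.measurable_ofReal.comp
    (hK.comp measurable_prodMk_left)).aestronglyMeasurable B
    (Eventually.of_forall fun y => by simpa using hB x y)

/-- The function `K (x, ·)` as an element of `L²`. -/
def kernelSection (μ : Measure X) [IsFiniteMeasure μ] (hK : Measurable (Function.uncurry K))
    (hB : ∀ x y, |K x y| ≤ B) (x : X) : Lp ℂ 2 μ :=
  (memLp_kernel_section hK hB x).toLp _

lemma coeFn_kernelSection (x : X) :
    kernelSection μ hK hB x =ᵐ[μ] fun y => (K x y : ℂ) :=
  (memLp_kernel_section hK hB x).coeFn_toLp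

lemma inner_kernelSection (x : X) (u : Lp ℂ 2 μ) :
    ⟪kernelSection μ hK hB x, u⟫_ℂ = ∫ y, (K x y : ℂ) * u y ∂μ := by
  rw [L2.inner_def]
  refine integral_congr_ae ?_
  filter_upwards [coeFn_kernelSection hK hB x] with y hy
  rw [hy, RCLike.inner_apply, Complex.conj_ofReal, mul_comm]

lemma norm_sq_kernelSection (x : X) :
    ‖kernelSection μ hK hB x‖ ^ 2 = ∫ y, K x y ^ 2 ∂μ := by
  rw [norm_sq_eq_integral]
  refine integral_congr_ae ?_
  filter_upwards [coeFn_kernelSection hK hB x] with y hy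
  rw [hy, Complex.norm_real, Real.norm_eq_abs, sq_abs]

lemma norm_kernelSection_le (x : X) :
    ‖kernelSection μ hK hB x‖ ≤ (measureUnivNNReal μ : ℝ) ^ (2 : ℝ≥0∞).toReal⁻¹ * B := by
  refine Lp.norm_le_of_ae_bound ((abs_nonneg _).trans (hB x x)) ?_
  filter_upwards [coeFn_kernelSection hK hB x] with y hy
  rw [hy, Complex.norm_real]
  exact hB x y

lemma stronglyMeasurable_inner_kernelSection (u : Lp ℂ 2 μ) :
    StronglyMeasurable fun x => ⟪kernelSection μ hK hB x, u⟫_ℂ := by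
  simp_rw [inner_kernelSection hK hB]
  refine StronglyMeasurable.integral_prod_right (f := fun x y => (K x y : ℂ) * u y) ?_
  exact (Complex.measurable_ofReal.comp hK).stronglyMeasurable.mul
    ((Lp.stronglyMeasurable u).comp_measurable measurable_snd)

include hK hB in
-- The value at x is the inner product with the kernel section K(x, ·); the sections are uniformly
-- bounded in L², so Cauchy-Schwarz bounds the image uniformly.
lemma exists_isIntegralOperator : ∃ A : Lp ℂ 2 μ →L[ℂ] Lp ℂ 2 μ, IsIntegralOperator μ K A := by
  rcases isEmpty_or_nonempty X with hX | ⟨⟨x₀⟩⟩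
  · exact ⟨0, fun u => Eventually.of_forall fun x => hX.elim x⟩
  have hB0 : 0 ≤ B := (abs_nonneg _).trans (hB x₀ x₀)
  set a := (measureUnivNNReal μ : ℝ) ^ (2 : ℝ≥0∞).toReal⁻¹ with ha
  have ha0 : 0 ≤ a := by positivity
  set k := kernelSection μ hK hB with hk
  have hbound : ∀ u x, ‖⟪k x, u⟫_ℂ‖ ≤ a * B * ‖u‖ := fun u x =>
    (norm_inner_le_norm _ _).trans (by gcongr; exact norm_kernelSection_le hK hB x)
  have hmem : ∀ u : Lp ℂ 2 μ, MemLp (fun x => ⟪k x, u⟫_ℂ) 2 μ := fun u =>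
    MemLp.of_bound (stronglyMeasurable_inner_kernelSection hK hB u).aestronglyMeasurable _
      (Eventually.of_forall (hbound u))
  let L : Lp ℂ 2 μ →ₗ[ℂ] Lp ℂ 2 μ :=
    { toFun := fun u => (hmem u).toLp _
      map_add' := fun u v => by
        rw [← MemLp.toLp_add]
        congr 1
        funext x
        exact inner_add_right _ _ _
      map_smul' := fun a u => by
        rw [RingHom.id_apply, ← MemLp.toLp_const_smul]
        congr 1
        funext x
        exact inner_smul_right _ _ _ }
  have hL : ∀ u, ‖L u‖ ≤ a * (a * B) * ‖u‖ := by
    intro u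
    rw [mul_assoc]
    refine Lp.norm_le_of_ae_bound (by positivity) ?_
    filter_upwards [(hmem u).coeFn_toLp] with x hx
    exact (congrArg norm hx).trans_le (hbound u x)
  refine ⟨L.mkContinuous _ hL, fun u => ?_⟩
  refine (hmem u).coeFn_toLp.trans (Eventually.of_forall fun x => ?_)
  exact inner_kernelSection hK hB x u

/-- The adjoint of an integral operator with a real kernel has the transposed kernel. -/
lemma inner_isIntegralOperator_transpose {A A' : Lp ℂ 2 μ →L[ℂ] Lp ℂ 2 μ}
    (hK : Measurable (Function.uncurry K)) (hB : ∀ x y, |K x y| ≤ B)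
    (hA : IsIntegralOperator μ K A) (hA' : IsIntegralOperator μ (fun x y => K y x) A')
    (f g : Lp ℂ 2 μ) : ⟪A' f, g⟫_ℂ = ⟪f, A g⟫_ℂ := by
  have hInt : ∀ u : Lp ℂ 2 μ, Integrable u μ := fun u =>
    (Lp.memLp u).integrable (by norm_num)
  have hconj : Integrable (fun x => starRingEnd ℂ (f x)) μ :=
    (RCLike.conjCLE (K := ℂ)).toContinuousLinearMap.integrable_comp (hInt f)
  have hprod : Integrable (Function.uncurry fun x y =>
      (K x y : ℂ) * (starRingEnd ℂ (f x) * g y)) (μ.prod μ) :=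
    Integrable.bdd_mul (c := B) (hconj.mul_prod (hInt g))
      (Complex.measurable_ofReal.comp hK).aestronglyMeasurable
      (Eventually.of_forall fun p => by simpa using hB p.1 p.2)
  have h1 : ⟪f, A g⟫_ℂ = ∫ x, ∫ y, (K x y : ℂ) * (starRingEnd ℂ (f x) * g y) ∂μ ∂μ := by
    rw [L2.inner_def]
    refine integral_congr_ae ?_
    filter_upwards [hA g] with x hx
    rw [hx, RCLike.inner_apply, mul_comm, ← integral_const_mul]
    refine integral_congr_ae (Eventually.of_forall fun y => ?_)
    simp only
    ring
  have h2 : ⟪A' f, g⟫_ℂ = ∫ y, ∫ x, (K x y : ℂ) * (starRingEnd ℂ (f x) * g y) ∂μ ∂μ := by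
    rw [L2.inner_def]
    refine integral_congr_ae ?_
    filter_upwards [hA' f] with y hy
    rw [hy, RCLike.inner_apply, ← integral_conj, ← integral_const_mul]
    refine integral_congr_ae (Eventually.of_forall fun x => ?_)
    simp only [map_mul, Complex.conj_ofReal]
    ring
  rw [h1, h2, integral_integral_swap hprod]

/-- Bessel's inequality bounds the Hilbert-Schmidt norm of an integral operator. -/
lemma sum_norm_sq_isIntegralOperator_le {A : Lp ℂ 2 μ →L[ℂ] Lp ℂ 2 μ}
    (hK : Measurable (Function.uncurry K)) (hB : ∀ x y, |K x y| ≤ B)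
    (hA : IsIntegralOperator μ K A) {M : ℝ} (hM : ∀ x, ∫ y, K x y ^ 2 ∂μ ≤ M)
    {ι : Type*} {e : ι → Lp ℂ 2 μ} (he : Orthonormal ℂ e) (s : Finset ι) :
    ∑ i ∈ s, ‖A (e i)‖ ^ 2 ≤ M * μ.real univ := by
  simp_rw [norm_sq_eq_integral]
  rw [← integral_finsetSum _ fun i _ => integrable_norm_sq _]
  have hle : ∀ᵐ x ∂μ, ∑ i ∈ s, ‖A (e i) x‖ ^ 2 ≤ M := by
    have hall : ∀ᵐ x ∂μ, ∀ i ∈ s, A (e i) x = ⟪kernelSection μ hK hB x, e i⟫_ℂ := by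
      rw [Finset.eventually_all]
      intro i _
      filter_upwards [hA (e i)] with x hx
      rw [hx, inner_kernelSection]
    filter_upwards [hall] with x hx
    rw [Finset.sum_congr rfl fun i hi => by rw [hx i hi, norm_inner_symm]]
    refine (he.sum_inner_products_le _).trans ?_
    rw [norm_sq_kernelSection]
    exact hM x
  calc ∫ x, ∑ i ∈ s, ‖A (e i) x‖ ^ 2 ∂μ ≤ ∫ _, M ∂μ :=
        integral_mono_ae (integrable_finsetSum _ fun i _ => integrable_norm_sq _)
          (integrable_const M) hle
    _ = M * μ.real univ := by rw [integral_const, smul_eq_mul, mul_comm]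

/-- Moving the outer A to the other side gives ⟪A' f, Φ A e⟫, and the arithmetic-geometric mean
inequality leaves the Hilbert-Schmidt sums of A and of its transpose A'. The kernel is not assumed
symmetric, so both row and column bounds enter. -/
lemma traceNorm_isIntegralOperator_comp_le {A Φ : Lp ℂ 2 μ →L[ℂ] Lp ℂ 2 μ}
    (hK : Measurable (Function.uncurry K)) (hB : ∀ x y, |K x y| ≤ B)
    (hA : IsIntegralOperator μ K A) {M : ℝ} (hM : ∀ x, ∫ y, K x y ^ 2 ∂μ ≤ M)
    (hM' : ∀ y, ∫ x, K x y ^ 2 ∂μ ≤ M) {c : ℝ} (hc : 0 ≤ c) (hΦ : ‖Φ‖ ≤ c) :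
    traceNorm (A ∘L Φ ∘L A) ≤ ENNReal.ofReal (c * (M * μ.real univ)) := by
  have hK' : Measurable (Function.uncurry fun x y => K y x) := hK.comp measurable_swap
  obtain ⟨A', hA'⟩ := exists_isIntegralOperator (μ := μ) hK' fun x y => hB y x
  refine iSup_le fun m => iSup_le fun e => iSup_le fun f => iSup_le fun he => iSup_le fun hf => ?_
  simp_rw [← ofReal_norm]
  rw [← ENNReal.ofReal_sum_of_nonneg fun i _ => norm_nonneg _]
  refine ENNReal.ofReal_le_ofReal ?_
  have h1 := sum_norm_sq_isIntegralOperator_le hK hB hA hM he Finset.univ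
  have h2 := sum_norm_sq_isIntegralOperator_le hK' (fun x y => hB y x) hA' hM' hf Finset.univ
  calc ∑ i, ‖⟪f i, (A ∘L Φ ∘L A) (e i)⟫_ℂ‖
      ≤ ∑ i, c * ((‖A' (f i)‖ ^ 2 + ‖A (e i)‖ ^ 2) / 2) := by
        refine Finset.sum_le_sum fun i _ => ?_
        change ‖⟪f i, A (Φ (A (e i)))⟫_ℂ‖ ≤ _
        rw [← inner_isIntegralOperator_transpose hK hB hA hA']
        calc ‖⟪A' (f i), Φ (A (e i))⟫_ℂ‖ ≤ ‖A' (f i)‖ * (c * ‖A (e i)‖) :=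
              (norm_inner_le_norm _ _).trans (by gcongr; exact Φ.le_of_opNorm_le hΦ _)
          _ = c * (‖A' (f i)‖ * ‖A (e i)‖) := by ring
          _ ≤ _ := by
            gcongr
            linarith [two_mul_le_add_sq ‖A' (f i)‖ ‖A (e i)‖]
    _ = c * ((∑ i, ‖A' (f i)‖ ^ 2 + ∑ i, ‖A (e i)‖ ^ 2) / 2) := by
        rw [← Finset.mul_sum, ← Finset.sum_div, Finset.sum_add_distrib]
    _ ≤ _ := by
        gcongr
        linarith

omit [MeasurableSpace X] in
-- Orthonormal vectors have mutual distance √2, so the balls of radius 1/2 around them are disjoint,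
-- and a separable space contains only countably many such balls.
lemma countable_of_orthonormal {H : Type*} [NormedAddCommGroup H] [InnerProductSpace ℂ H]
    [TopologicalSpace.SeparableSpace H] {ι : Type*} {e : ι → H} (he : Orthonormal ℂ e) :
    Countable ι := by
  have h : (univ : Set ι).PairwiseDisjoint fun i => Metric.ball (e i) (1 / 2) := by
    intro i _ j _ hij
    refine Metric.ball_disjoint_ball ?_
    have h1 : ‖e i - e j‖ ^ 2 = 2 := by
      rw [@norm_sub_sq ℂ, he.1, he.1, he.2 hij]
      norm_num
    rw [dist_eq_norm]
    nlinarith [norm_nonneg (e i - e j)]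
  have := h.countable_of_isOpen (fun i _ => Metric.isOpen_ball)
    (fun i _ => ⟨e i, Metric.mem_ball_self (by norm_num)⟩)
  exact countable_univ_iff.1 this

/-- Each diagonal entry is the integral of A' b_i paired with Φ A b_i. At almost every x these
values are inner products of b_i with kernel sections, so Parseval sums them to ⟪K(f x, ·), K(·,
x)⟫. The Hilbert-Schmidt bounds justify exchanging sum and integral, and a countable basis allows
one null set for all i. -/
lemma hasTrace_isIntegralOperator_comp [MeasurableSpace.CountablyGenerated X]
    {A Φ : Lp ℂ 2 μ →L[ℂ] Lp ℂ 2 μ}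
    (hK : Measurable (Function.uncurry K)) (hB : ∀ x y, |K x y| ≤ B)
    (hA : IsIntegralOperator μ K A) {f : X → X}
    (hf : Measure.QuasiMeasurePreserving f μ μ) (hΦ : IsPullback μ f Φ) :
    HasTrace (A ∘L Φ ∘L A) ((∫ x, ∫ y, K (f x) y * K y x ∂μ ∂μ : ℝ) : ℂ) := by
  intro w b
  have : Fact ((2 : ℝ≥0∞) ≠ ⊤) := ⟨by simp⟩
  have : Countable w := countable_of_orthonormal b.orthonormal
  have hK' : Measurable (Function.uncurry fun x y => K y x) := hK.comp measurable_swap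
  have hB' : ∀ x y, |K y x| ≤ B := fun x y => hB y x
  obtain ⟨A', hA'⟩ := exists_isIntegralOperator (μ := μ) hK' hB'
  set k := kernelSection μ hK hB with hk
  set k' := kernelSection μ hK' hB' with hk'
  rcases isEmpty_or_nonempty X with hX | ⟨⟨x₀⟩⟩
  · have : ∀ u : Lp ℂ 2 μ, u = 0 := fun u => Lp.ext (Eventually.of_forall fun x => hX.elim x)
    have h0 : ∀ g : X → ℝ, ∫ x, g x ∂μ = 0 := fun g => by
      rw [Measure.eq_zero_of_isEmpty μ, integral_zero_measure]
    rw [h0]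
    simp [this (b _)]
  have hB2 : ∀ x y, K x y ^ 2 ≤ B ^ 2 := fun x y => sq_le_sq.2 ((hB x y).trans (le_abs_self B))
  have hM : ∀ x, ∫ y, K x y ^ 2 ∂μ ≤ B ^ 2 * μ.real univ := fun x => by
    refine (integral_mono_of_nonneg (Eventually.of_forall fun y => sq_nonneg _)
      (integrable_const (B ^ 2)) (Eventually.of_forall fun y => hB2 x y)).trans (le_of_eq ?_)
    rw [integral_const, smul_eq_mul, mul_comm]
  have hM' : ∀ y, ∫ x, K x y ^ 2 ∂μ ≤ B ^ 2 * μ.real univ := fun y => by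
    refine (integral_mono_of_nonneg (Eventually.of_forall fun x => sq_nonneg _)
      (integrable_const (B ^ 2)) (Eventually.of_forall fun x => hB2 x y)).trans (le_of_eq ?_)
    rw [integral_const, smul_eq_mul, mul_comm]
  have hs : Summable fun i => ‖A (b i)‖ ^ 2 :=
    summable_of_sum_le (fun i => sq_nonneg _)
      fun s => sum_norm_sq_isIntegralOperator_le hK hB hA hM b.orthonormal s
  have hs' : Summable fun i => ‖A' (b i)‖ ^ 2 :=
    summable_of_sum_le (fun i => sq_nonneg _)
      fun s => sum_norm_sq_isIntegralOperator_le hK' hB' hA' hM' b.orthonormal s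
  set F : w → X → ℂ := fun i x => ⟪A' (b i) x, Φ (A (b i)) x⟫_ℂ with hF
  have hFint : ∀ i, Integrable (F i) μ := fun i => L2.integrable_inner _ _
  have hΦsq : ∀ u : Lp ℂ 2 μ, ‖Φ u‖ ^ 2 ≤ ‖Φ‖ ^ 2 * ‖u‖ ^ 2 := fun u => by
    rw [← mul_pow]
    gcongr
    exact Φ.le_opNorm u
  have hFsum : Summable fun i => ∫ x, ‖F i x‖ ∂μ := by
    refine Summable.of_nonneg_of_le (fun i => integral_nonneg fun x => norm_nonneg _) (fun i => ?_)
      (hs'.add (hs.mul_left (‖Φ‖ ^ 2)))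
    calc ∫ x, ‖F i x‖ ∂μ ≤ ∫ x, (‖A' (b i) x‖ ^ 2 + ‖Φ (A (b i)) x‖ ^ 2) ∂μ := by
          refine integral_mono (hFint i).norm
            ((integrable_norm_sq _).add (integrable_norm_sq _)) fun x => ?_
          refine (norm_inner_le_norm _ _).trans ?_
          nlinarith [two_mul_le_add_sq ‖A' (b i) x‖ ‖Φ (A (b i)) x‖,
            mul_nonneg (norm_nonneg (A' (b i) x)) (norm_nonneg (Φ (A (b i)) x))]
      _ = ‖A' (b i)‖ ^ 2 + ‖Φ (A (b i))‖ ^ 2 := by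
          rw [integral_add (integrable_norm_sq _) (integrable_norm_sq _), norm_sq_eq_integral,
            norm_sq_eq_integral]
      _ ≤ _ := by gcongr; exact hΦsq _
  have key := hasSum_integral_of_summable_integral_norm hFint hFsum
  have e1 : (fun i => ∫ x, F i x ∂μ) = fun i => ⟪b i, (A ∘L Φ ∘L A) (b i)⟫_ℂ := by
    funext i
    rw [hF, ← L2.inner_def, inner_isIntegralOperator_transpose hK hB hA hA']
    rfl
  have e2 : ∫ x, ∑' i, F i x ∂μ = ((∫ x, ∫ y, K (f x) y * K y x ∂μ ∂μ : ℝ) : ℂ) := by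
    rw [← integral_complex_ofReal]
    refine integral_congr_ae ?_
    have h1 : ∀ᵐ x ∂μ, ∀ i, A' (b i) x = ⟪k' x, b i⟫_ℂ := by
      rw [ae_all_iff]
      intro i
      filter_upwards [hA' (b i)] with x hx
      rw [hx, hk', inner_kernelSection]
    have h2 : ∀ᵐ x ∂μ, ∀ i, Φ (A (b i)) x = ⟪k (f x), b i⟫_ℂ := by
      rw [ae_all_iff]
      intro i
      filter_upwards [hΦ (A (b i)), hf.ae_eq_comp (hA (b i))] with x hx hx'
      rw [hx, hk, inner_kernelSection]
      exact hx'
    filter_upwards [h1, h2] with x hx hx'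
    have h3 : ∀ i, F i x = ⟪k (f x), b i⟫_ℂ * ⟪b i, k' x⟫_ℂ := fun i => by
      rw [hF]
      simp only
      rw [hx, hx', RCLike.inner_apply, inner_conj_symm]
    simp_rw [h3]
    rw [(b.hasSum_inner_mul_inner (k (f x)) (k' x)).tsum_eq, hk, inner_kernelSection,
      ← integral_complex_ofReal]
    refine integral_congr_ae ?_
    filter_upwards [coeFn_kernelSection hK' hB' x] with y hy
    rw [hk', hy]
    push_cast
    rfl
  rw [e1, e2] at key
  exact key

end Kernel

end L2Operators

/-! ### Size and support of the mollifier kernels -/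

section MollifierBounds

variable {X : Type*} [EMetricSpace X]

lemma cutoff_ne_zero_imp_and_eq_one {ψ : ℝ → ℝ} {ε : ℝ} (hε : 0 < ε) {x y : X} :
    (∀ R, 0 ≤ R → (∀ s, ψ s ≠ 0 → |s| ≤ R) → cutoff ψ ε x y ≠ 0 →
      edist x y ≤ ENNReal.ofReal (R * ε)) ∧
    (∀ a, 0 ≤ a → (∀ s, |s| ≤ a → ψ s = 1) → edist x y ≤ ENNReal.ofReal (a * ε) →
      cutoff ψ ε x y = 1) := by
  constructor
  · intro R hR h hne
    have htop : edist x y ≠ ⊤ := fun htop => hne (by simp [cutoff, htop])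
    rw [cutoff, if_neg htop] at hne
    have h1 := h _ hne
    rw [abs_of_nonneg (by positivity), div_le_iff₀ hε] at h1
    rw [← ENNReal.ofReal_toReal htop]
    exact ENNReal.ofReal_le_ofReal h1
  · intro a ha h hd
    have htop : edist x y ≠ ⊤ := (hd.trans_lt ENNReal.ofReal_lt_top).ne
    rw [cutoff, if_neg htop]
    refine h _ ?_
    rw [abs_of_nonneg (by positivity), div_le_iff₀ hε]
    exact ENNReal.toReal_le_of_le_ofReal (by positivity) hd

lemma cutoff_mem_Icc {ψ : ℝ → ℝ} (hψI : ∀ s, ψ s ∈ Icc (0 : ℝ) 1) (ε : ℝ) (x y : X) :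
    cutoff ψ ε x y ∈ Icc (0 : ℝ) 1 := by
  unfold cutoff
  split_ifs
  · simp
  · exact hψI _

variable [MeasurableSpace X] [BorelSpace X] [SecondCountableTopology X]

lemma measurable_cutoff {ψ : ℝ → ℝ} (hψ : Measurable ψ) (ε : ℝ) :
    Measurable (Function.uncurry (cutoff (X := X) ψ ε)) := by
  have hd : Measurable fun p : X × X => edist p.1 p.2 := measurable_fst.edist measurable_snd
  exact Measurable.ite (hd (measurableSet_singleton ⊤)) measurable_const
    (hψ.comp (hd.ennreal_toReal.div_const ε))

variable (μ : Measure X) [IsFiniteMeasure μ]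

lemma measurable_mollifierKernel {ψ : ℝ → ℝ} (hψ : Measurable ψ) (ε : ℝ) :
    Measurable (Function.uncurry (mollifierKernel μ ψ ε)) := by
  have h : Measurable (mollifierNorm μ ψ ε) :=
    ((measurable_cutoff hψ ε).stronglyMeasurable.integral_prod_right (ν := μ)).measurable
  exact ((h.comp measurable_fst).const_div 1).mul (measurable_cutoff hψ ε)

/-- The mollifiers with parameter `ε` are concentrated in an `O(ε)`-neighbourhood of the diagonal,
where they are bounded by a multiple of `ε ^ (-n)`. -/
lemma exists_mollifierKernel_bound {n : ℕ} {c : ℝ} (hc : 0 < c)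
    (hlower : ∀ x r, 0 < r → r ≤ 1 → ENNReal.ofReal (c * r ^ n) ≤
      μ (Metric.closedEBall x (ENNReal.ofReal r)))
    {ψ : ℝ → ℝ} (hψ : Continuous ψ) (hψc : HasCompactSupport ψ)
    (hψI : ∀ s, ψ s ∈ Icc (0 : ℝ) 1) (hψ1 : ∀ᶠ s in 𝓝 (0 : ℝ), ψ s = 1) :
    ∃ R > 0, ∃ D > 0, ∀ ε ∈ Ioc (0 : ℝ) 1, ∀ x y, |mollifierKernel μ ψ ε x y| ≤ D / ε ^ n ∧
      (mollifierKernel μ ψ ε x y ≠ 0 → edist x y ≤ ENNReal.ofReal (R * ε)) := by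
  obtain ⟨R, hR, hsupp⟩ : ∃ R > 0, ∀ s, ψ s ≠ 0 → |s| ≤ R := by
    obtain ⟨R, hR, h⟩ := hψc.isCompact.isBounded.subset_closedBall_lt 0 0
    refine ⟨R, hR, fun s hs => ?_⟩
    have := h (subset_tsupport _ hs)
    rwa [Metric.mem_closedBall, Real.dist_eq, sub_zero] at this
  obtain ⟨a, ha, hone⟩ : ∃ a > 0, ∀ s, |s| ≤ a → ψ s = 1 := by
    obtain ⟨a, ha, h⟩ := Metric.nhds_basis_closedBall.mem_iff.1 hψ1
    refine ⟨a, ha, fun s hs => h ?_⟩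
    rwa [Metric.mem_closedBall, Real.dist_eq, sub_zero]
  -- The cap at 1 keeps the radius a' ε in the range where the lower volume bound holds.
  set a' := min a 1 with ha'
  have ha'0 : 0 < a' := lt_min ha one_pos
  refine ⟨R, hR, 1 / (c * a' ^ n), by positivity, fun ε hε x y => ⟨?_, fun hne => ?_⟩⟩
  · have hε0 := hε.1
    have hcut := cutoff_mem_Icc hψI ε x y
    have hF : c * (a' * ε) ^ n ≤ mollifierNorm μ ψ ε x := by
      have h1 : ENNReal.ofReal (c * (a' * ε) ^ n) ≤
          μ (Metric.closedEBall x (ENNReal.ofReal (a' * ε))) :=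
        hlower x _ (by positivity) (mul_le_one₀ (min_le_right _ _) hε0.le hε.2)
      have h2 : c * (a' * ε) ^ n ≤ μ.real (Metric.closedEBall x (ENNReal.ofReal (a' * ε))) :=
        (ENNReal.ofReal_le_iff_le_toReal (measure_ne_top _ _)).1 h1
      refine h2.trans ?_
      have hmeas : MeasurableSet (Metric.closedEBall x (ENNReal.ofReal (a' * ε))) :=
        Metric.isClosed_closedEBall.measurableSet
      rw [← integral_indicator_one hmeas]
      refine integral_mono ((integrable_const (1 : ℝ)).indicator hmeas) ?_ fun z => ?_
      · refine Integrable.of_bound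
          ((measurable_cutoff hψ.measurable ε).comp measurable_prodMk_left).aestronglyMeasurable 1
          (Eventually.of_forall fun z => ?_)
        have := cutoff_mem_Icc hψI ε x z
        rw [Real.norm_eq_abs, abs_le]
        exact ⟨by linarith [this.1], this.2⟩
      · by_cases hz : z ∈ Metric.closedEBall x (ENNReal.ofReal (a' * ε))
        · rw [indicator_of_mem hz, (cutoff_ne_zero_imp_and_eq_one hε0).2 a' ha'0.le
            (fun s hs => hone s (hs.trans (min_le_left _ _)))
            (by rw [edist_comm]; exact hz)]
          exact le_rfl
        · rw [indicator_of_notMem hz]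
          exact (cutoff_mem_Icc hψI ε x z).1
    have hpos : 0 < c * (a' * ε) ^ n := by positivity
    have hFpos := hpos.trans_le hF
    unfold mollifierKernel
    rw [abs_of_nonneg (mul_nonneg (by positivity) hcut.1)]
    calc 1 / mollifierNorm μ ψ ε x * cutoff ψ ε x y ≤ 1 / (c * (a' * ε) ^ n) * 1 := by
          exact mul_le_mul (one_div_le_one_div_of_le hpos hF) hcut.2 hcut.1 (by positivity)
      _ = 1 / (c * a' ^ n) / ε ^ n := by
          rw [mul_pow]
          field_simp
  · refine (cutoff_ne_zero_imp_and_eq_one hε.1).1 R hR.le hsupp fun h0 => hne ?_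
    rw [mollifierKernel, h0, mul_zero]

omit [BorelSpace X] [SecondCountableTopology X] [EMetricSpace X] in
lemma abs_integral_le_of_support {f : X → ℝ} {S : Set X} {q : ℝ} (hq : ∀ y, |f y| ≤ q)
    (hS : ∀ y, f y ≠ 0 → y ∈ S) : |∫ y, f y ∂μ| ≤ q * μ.real S := by
  rw [← setIntegral_eq_integral_of_forall_compl_eq_zero (s := S)
    fun y hy => by_contra fun h => hy (hS y h)]
  exact norm_setIntegral_le_of_norm_le_const (f := f) (measure_lt_top _ _) fun y _ => hq y

end MollifierBounds

/-! ### The trace integral and near-returns -/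

section TraceIntegral

variable {X : Type*} [EMetricSpace X] [MeasurableSpace X] [BorelSpace X]
  [SecondCountableTopology X] (μ : Measure X) [IsFiniteMeasure μ]

/-- The trace of an integral operator with the kernel `K` composed with a pullback and with itself
is controlled by the measure of the set of points that nearly return. -/
lemma abs_integral_integral_kernel_le {K : X → X → ℝ} {q r m : ℝ} (hq : ∀ x y, |K x y| ≤ q)
    (hr : 0 ≤ r) (hsupp : ∀ x y, K x y ≠ 0 → edist x y ≤ ENNReal.ofReal r)
    (hm : ∀ x, μ.real (Metric.closedEBall x (ENNReal.ofReal r)) ≤ m) (f : X → X) :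
    |∫ x, ∫ y, K (f x) y * K y x ∂μ ∂μ| ≤
      q ^ 2 * m * μ.real {x | edist x (f x) ≤ ENNReal.ofReal (2 * r)} := by
  refine abs_integral_le_of_support μ (fun x => ?_) fun x hx => ?_
  · refine (abs_integral_le_of_support μ (q := q ^ 2)
      (S := Metric.closedEBall x (ENNReal.ofReal r)) (fun y => ?_) fun y hy => ?_).trans ?_
    · rw [abs_mul, sq]
      exact mul_le_mul (hq _ _) (hq _ _) (abs_nonneg _) ((abs_nonneg _).trans (hq x x))
    · exact hsupp _ _ (right_ne_zero_of_mul hy)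
    · exact mul_le_mul_of_nonneg_left (hm x) (sq_nonneg q)
  -- If the inner integral is nonzero, some y lies within r of both x and f x, which forces x to
  -- return within 2 r.
  · by_contra hd
    refine hx (integral_eq_zero_of_ae (Eventually.of_forall fun y => ?_))
    by_contra hy
    refine hd ?_
    have h1 : edist y (f x) ≤ ENNReal.ofReal r := by
      rw [edist_comm]
      exact hsupp _ _ (left_ne_zero_of_mul hy)
    have h2 := hsupp _ _ (right_ne_zero_of_mul hy)
    refine (edist_triangle_left x (f x) y).trans ((add_le_add h2 h1).trans (le_of_eq ?_))
    rw [← ENNReal.ofReal_add hr hr, two_mul]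

end TraceIntegral

/-! ### Assembly of the estimates -/

section Main

variable {n : ℕ} {X : Type*} [EMetricSpace X] [CompactSpace X] [SecondCountableTopology X]
  [ChartedSpace (EuclideanSpace ℝ (Fin n)) X]
  [IsManifold (𝓡 n) ∞ X] [RiemannianBundle (fun x : X => TangentSpace (𝓡 n) x)]
  [IsContinuousRiemannianBundle (EuclideanSpace ℝ (Fin n)) (fun x : X => TangentSpace (𝓡 n) x)]
  [IsRiemannianManifold (𝓡 n) X] [MeasurableSpace X] [BorelSpace X]

/-- The trace and the trace norm of the mollified pullbacks by an Anosov flow. -/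
theorem IsAnosov.exists_trace_estimates
    (μ : Measure X) (hμ : IsSmoothDensity (n := n) μ)
    (V : (x : X) → TangentSpace (𝓡 n) x) (φ : ℝ → X → X)
    (hφ : IsSmoothFlow V φ) (hA : IsAnosov V φ)
    (ψ : ℝ → ℝ) (hψ : Continuous ψ) (hψc : HasCompactSupport ψ)
    (hψI : ∀ s, ψ s ∈ Icc (0 : ℝ) 1) (hψ1 : ∀ᶠ s in 𝓝 (0 : ℝ), ψ s = 1) :
    ∃ (E Φ : ℝ → Lp ℂ 2 μ →L[ℂ] Lp ℂ 2 μ),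
      (∀ ε ∈ Ioc (0 : ℝ) 1, IsIntegralOperator μ (mollifierKernel μ ψ ε) (E ε)) ∧
      (∀ t, IsPullback μ (φ t) (Φ t)) ∧
      ∀ t₀ > 0, ∃ C > 0, ∀ ε ∈ Ioc (0 : ℝ) 1,
        ∃ τ : ℝ → ℂ, (∀ t, HasTrace (E ε ∘L Φ (-t) ∘L E ε) (τ t)) ∧
          ∀ T ≥ t₀,
            traceNorm (E ε ∘L Φ (-T) ∘L E ε) ≤
              ENNReal.ofReal (C * Real.exp (C * T) * ε ^ (-(n : ℤ) - 2)) ∧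
            IntervalIntegrable (fun t => ‖τ t‖) volume T (T + 1) ∧
            ∫ t in T..(T + 1), ‖τ t‖ ≤ C * Real.exp (C * T) := by
  have := hμ.isFiniteMeasure
  obtain ⟨A, hA0, hupper⟩ := hμ.exists_measure_closedEBall_le
  obtain ⟨c, hc, hlower⟩ := hμ.exists_le_measure_closedEBall
  obtain ⟨Λ, hΛ, hmap⟩ := hμ.exists_map_flow_le hφ.smooth_flow hφ.zero hφ.add
  obtain ⟨R, hR, D, hD, hker⟩ := exists_mollifierKernel_bound μ hc hlower hψ hψc hψI hψ1
  have hφc := hφ.smooth_flow.continuous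
  have hφt : ∀ t, Measurable (φ t) := fun t =>
    (hφc.comp (continuous_const.prodMk continuous_id)).measurable
  have hmeas := fun ε => measurable_mollifierKernel μ hψ.measurable ε
  have hE : ∀ ε : ℝ, ∃ A : Lp ℂ 2 μ →L[ℂ] Lp ℂ 2 μ, ε ∈ Ioc (0 : ℝ) 1 →
      IsIntegralOperator μ (mollifierKernel μ ψ ε) A := by
    intro ε
    by_cases hε : ε ∈ Ioc (0 : ℝ) 1
    · obtain ⟨A, hA⟩ := exists_isIntegralOperator (μ := μ) (hmeas ε)
        fun x y => (hker ε hε x y).1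
      exact ⟨A, fun _ => hA⟩
    · exact ⟨0, fun h => (hε h).elim⟩
  choose E hE using hE
  have hΦ : ∀ t, ∃ Φ : Lp ℂ 2 μ →L[ℂ] Lp ℂ 2 μ, IsPullback μ (φ t) Φ ∧
      ‖Φ‖ ≤ Real.exp (Λ * (|t| + 1)) := by
    intro t
    refine exists_isPullback (hφt t) (Real.exp_pos _).le ((hmap t).trans ?_)
    intro s
    refine mul_le_mul' (ENNReal.ofReal_le_ofReal ?_) le_rfl
    -- Bounding the exponential by its square loses nothing that matters: the operator norm only
    -- needs to be exponential in t.
    exact le_self_pow₀ (Real.one_le_exp (by positivity)) two_ne_zero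
  choose Φ hΦ hΦn using hΦ
  refine ⟨E, Φ, fun ε hε => hE ε hε, hΦ, fun t₀ ht₀ => ?_⟩
  obtain ⟨C₁, hC₁, hret⟩ := hA.exists_measure_return_le hμ hφ ht₀
  set G := D ^ 2 * (A * R ^ n) with hG
  have hGpos : 0 < G := by positivity
  set M₁ := Real.exp Λ * (G * μ.real univ) with hM₁
  set M₂ := G * Real.exp (2 * Λ) * (C₁ * (2 * R) ^ n) with hM₂
  have hM₁0 : 0 ≤ M₁ := by positivity
  have hM₂0 : 0 < M₂ := by positivity
  refine ⟨M₁ + M₂ + Λ + C₁, by positivity, fun ε hε => ?_⟩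
  have hε0 := hε.1
  set K := mollifierKernel μ ψ ε with hK
  set q := D / ε ^ n with hq
  set r := R * ε with hr
  set m := A * r ^ n with hm
  -- Two kernels of size ε^{-n} against one ball of volume O(ε^n) leave ε^{-n}. The measure O(ε^n)
  -- of the near-returns cancels it in the trace estimate; for the trace norm it is the final power,
  -- better than required.
  have hqm : q ^ 2 * m = G / ε ^ n := by
    rw [hq, hm, hr, hG, mul_pow]
    field_simp
  have hKq : ∀ x y, |K x y| ≤ q := fun x y => (hker ε hε x y).1
  have hKr : ∀ x y, K x y ≠ 0 → edist x y ≤ ENNReal.ofReal r := fun x y => (hker ε hε x y).2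
  have hmr : ∀ x, μ.real (Metric.closedEBall x (ENNReal.ofReal r)) ≤ m := fun x =>
    ENNReal.toReal_le_of_le_ofReal (by positivity) (hupper x r (by positivity))
  set τ : ℝ → ℝ := fun t => ∫ x, ∫ y, K (φ (-t) x) y * K y x ∂μ ∂μ with hτ
  have hquasi : ∀ t, Measure.QuasiMeasurePreserving (φ t) μ μ := fun t =>
    ⟨hφt t, Measure.absolutelyContinuous_of_le_smul (hmap t)⟩
  refine ⟨fun t => (τ t : ℂ), fun t =>
    hasTrace_isIntegralOperator_comp (hmeas ε) hKq (hE ε hε) (hquasi (-t)) (hΦ (-t)),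
    fun T hT => ?_⟩
  have hT0 : 0 < T := lt_of_lt_of_le ht₀ hT
  have hτm : StronglyMeasurable τ := by
    refine StronglyMeasurable.integral_prod_right
      (f := fun t x => ∫ y, K (φ (-t) x) y * K y x ∂μ) ?_
    refine StronglyMeasurable.integral_prod_right
      (f := fun (p : ℝ × X) y => K (φ (-p.1) p.2) y * K y p.2) ?_
    refine Measurable.stronglyMeasurable (Measurable.mul ?_ ?_)
    · have : Measurable fun p : (ℝ × X) × X => (φ (-p.1.1) p.1.2, p.2) := by
        refine Measurable.prodMk ?_ measurable_snd
        exact hφc.measurable.comp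
          (by fun_prop : Measurable fun p : (ℝ × X) × X => (-p.1.1, p.1.2))
      exact (hmeas ε).comp this
    · exact (hmeas ε).comp (by fun_prop : Measurable fun p : (ℝ × X) × X => (p.2, p.1.2))
  have hτb : ∀ t, |τ t| ≤
      q ^ 2 * m * μ.real {x | edist x (φ (-t) x) ≤ ENNReal.ofReal (2 * r)} := fun t =>
    abs_integral_integral_kernel_le μ hKq (by positivity) hKr hmr _
  have hqm0 : 0 ≤ q ^ 2 * m := by positivity
  have hInt : IntervalIntegrable (fun t => ‖(τ t : ℂ)‖) volume T (T + 1) := by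
    rw [intervalIntegrable_iff]
    refine Measure.integrableOn_of_bounded (M := q ^ 2 * m * μ.real univ) (by simp)
      (Complex.measurable_ofReal.comp hτm.measurable).norm.aestronglyMeasurable
      (Eventually.of_forall fun t => ?_)
    rw [norm_norm, Complex.norm_real, Real.norm_eq_abs]
    refine (hτb t).trans (mul_le_mul_of_nonneg_left ?_ hqm0)
    exact measureReal_mono (subset_univ _)
  have hexp : ∀ {a b : ℝ}, 0 ≤ a → a ≤ M₁ + M₂ + Λ + C₁ → b ≤ M₁ + M₂ + Λ + C₁ →
      a * Real.exp (b * T) ≤ (M₁ + M₂ + Λ + C₁) * Real.exp ((M₁ + M₂ + Λ + C₁) * T) := by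
    intro a b ha0 ha hb
    exact mul_le_mul ha (Real.exp_le_exp.2 (mul_le_mul_of_nonneg_right hb hT0.le))
      (Real.exp_pos _).le (by positivity)
  refine ⟨?_, hInt, ?_⟩
  · -- the trace norm
    have hsq : ∀ x y, |K x y ^ 2| ≤ q ^ 2 := fun x y => by
      rw [abs_pow]
      gcongr
      exact hKq x y
    have h1 : ∀ x, ∫ y, K x y ^ 2 ∂μ ≤ q ^ 2 * m := fun x =>
      (le_abs_self _).trans ((abs_integral_le_of_support μ (hsq x)
        (S := Metric.closedEBall x (ENNReal.ofReal r)) fun y hy => by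
          rw [Metric.mem_closedEBall, edist_comm]
          exact hKr _ _ (fun h => hy (by rw [h]; simp))).trans
        (mul_le_mul_of_nonneg_left (hmr x) (sq_nonneg q)))
    have h2 : ∀ y, ∫ x, K x y ^ 2 ∂μ ≤ q ^ 2 * m := fun y =>
      (le_abs_self _).trans ((abs_integral_le_of_support μ (fun x => hsq x y)
        (S := Metric.closedEBall y (ENNReal.ofReal r)) fun x hx => by
          rw [Metric.mem_closedEBall]
          exact hKr _ _ (fun h => hx (by rw [h]; simp))).trans
        (mul_le_mul_of_nonneg_left (hmr y) (sq_nonneg q)))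
    refine (traceNorm_isIntegralOperator_comp_le (hmeas ε) hKq (hE ε hε) h1 h2
      (Real.exp_pos _).le (hΦn (-T))).trans (ENNReal.ofReal_le_ofReal ?_)
    rw [abs_neg, abs_of_pos hT0, hqm]
    have e1 : Real.exp (Λ * (T + 1)) * (G / ε ^ n * μ.real univ) =
        M₁ * Real.exp (Λ * T) * (1 / ε ^ n) := by
      rw [mul_add, mul_one, Real.exp_add, hM₁]
      ring
    have e2 : 1 / ε ^ n ≤ ε ^ (-(n : ℤ) - 2) := by
      rw [zpow_sub₀ hε0.ne', zpow_neg, zpow_natCast, one_div]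
      refine le_div_self (by positivity) (by positivity) ?_
      exact_mod_cast pow_le_one₀ hε0.le hε.2
    rw [e1]
    exact mul_le_mul (hexp hM₁0 (by linarith) (by linarith)) e2 (by positivity) (by positivity)
  · -- the trace
    have hset : ∀ t, μ.real {x | edist x (φ (-t) x) ≤ ENNReal.ofReal (2 * r)} ≤
        Real.exp (Λ * (|t| + 1)) * μ.real {x | edist x (φ t x) ≤ ENNReal.ofReal (2 * r)} := by
      intro t
      have hmt : MeasurableSet {x | edist x (φ t x) ≤ ENNReal.ofReal (2 * r)} :=
        measurableSet_le (measurable_id.edist (hφt t)) measurable_const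
      -- The trace involves returns under φ_{-t}, while the volume bound concerns φ_t. The two sets
      -- correspond under φ_{-t}, which changes measures by at most an exponential factor.
      have e : {x | edist x (φ (-t) x) ≤ ENNReal.ofReal (2 * r)} =
          φ (-t) ⁻¹' {x | edist x (φ t x) ≤ ENNReal.ofReal (2 * r)} := by
        ext x
        rw [mem_preimage, mem_ofPred_eq, mem_ofPred_eq, ← hφ.add, add_neg_cancel, hφ.zero,
          edist_comm]
      have h1 := hmap (-t) {x | edist x (φ t x) ≤ ENNReal.ofReal (2 * r)}
      rw [Measure.map_apply (hφt _) hmt, ← e, abs_neg, Measure.smul_apply, smul_eq_mul] at h1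
      have h2 := ENNReal.toReal_mono (ENNReal.mul_ne_top ENNReal.ofReal_ne_top
        (measure_ne_top _ _)) h1
      rwa [ENNReal.toReal_mul, ENNReal.toReal_ofReal (Real.exp_pos _).le] at h2
    set H := q ^ 2 * m * Real.exp (Λ * (T + 2)) with hH
    have hH0 : 0 ≤ H := by positivity
    have hpt : ∀ t ∈ Icc T (T + 1), ‖(τ t : ℂ)‖ₑ ≤
        ENNReal.ofReal H * μ {x | edist x (φ t x) ≤ ENNReal.ofReal (2 * r)} := by
      intro t ht
      rw [← ofReal_norm, Complex.norm_real, Real.norm_eq_abs, ← ofReal_measureReal,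
        ← ENNReal.ofReal_mul hH0]
      refine ENNReal.ofReal_le_ofReal ((hτb t).trans ?_)
      rw [hH, mul_assoc (q ^ 2 * m)]
      refine mul_le_mul_of_nonneg_left ((hset t).trans ?_) hqm0
      refine mul_le_mul_of_nonneg_right (Real.exp_le_exp.2 ?_) measureReal_nonneg
      rw [abs_of_pos (hT0.trans_le ht.1)]
      exact mul_le_mul_of_nonneg_left (by linarith [ht.2]) hΛ
    have hlint : ∫⁻ t in Ioc T (T + 1), ‖(τ t : ℂ)‖ₑ ≤
        ENNReal.ofReal (H * (C₁ * Real.exp (C₁ * T) * (2 * r) ^ n)) := by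
      calc ∫⁻ t in Ioc T (T + 1), ‖(τ t : ℂ)‖ₑ
          ≤ ∫⁻ t in Icc T (T + 1), ‖(τ t : ℂ)‖ₑ := lintegral_mono_set Ioc_subset_Icc_self
        _ ≤ ∫⁻ t in Icc T (T + 1),
            ENNReal.ofReal H * μ {x | edist x (φ t x) ≤ ENNReal.ofReal (2 * r)} :=
          setLIntegral_mono' measurableSet_Icc hpt
        _ = ENNReal.ofReal H *
            ∫⁻ t in Icc T (T + 1), μ {x | edist x (φ t x) ≤ ENNReal.ofReal (2 * r)} :=
          lintegral_const_mul' _ _ ENNReal.ofReal_ne_top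
        _ ≤ ENNReal.ofReal H * ENNReal.ofReal (C₁ * Real.exp (C₁ * T) * (2 * r) ^ n) := by
          gcongr
          exact hret T hT (2 * r) (by positivity)
        _ = _ := (ENNReal.ofReal_mul hH0).symm
    have hle : ∫ t in T..(T + 1), ‖(τ t : ℂ)‖ ≤
        H * (C₁ * Real.exp (C₁ * T) * (2 * r) ^ n) := by
      have hτc : AEStronglyMeasurable (fun t => (τ t : ℂ)) (volume.restrict (Ioc T (T + 1))) :=
        (Complex.measurable_ofReal.comp hτm.measurable).aestronglyMeasurable
      rw [intervalIntegral.integral_of_le (by linarith), integral_norm_eq_lintegral_enorm hτc]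
      exact ENNReal.toReal_le_of_le_ofReal (by positivity) hlint
    refine hle.trans ?_
    have e : H * (C₁ * Real.exp (C₁ * T) * (2 * r) ^ n) = M₂ * Real.exp ((Λ + C₁) * T) := by
      have h1 : Real.exp (Λ * (T + 2)) = Real.exp (2 * Λ) * Real.exp (Λ * T) := by
        rw [← Real.exp_add]
        congr 1
        ring
      rw [hH, hqm, h1, hM₂, hr, ← mul_assoc 2 R ε, mul_pow (2 * R) ε, add_mul, Real.exp_add]
      field_simp
    rw [e]
    exact hexp hM₂0.le (by linarith) (by linarith)

end Main

end

end FlatTrace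

theorem lemma4p1 {n : ℕ} {X : Type*} [EMetricSpace X] [CompactSpace X]
    [ChartedSpace (EuclideanSpace ℝ (Fin n)) X] [IsManifold (𝓡 n) ∞ X]
    [RiemannianBundle (fun x : X => TangentSpace (𝓡 n) x)]
    [IsContMDiffRiemannianBundle (𝓡 n) ∞ (EuclideanSpace ℝ (Fin n))
      (fun x : X => TangentSpace (𝓡 n) x)]
    [IsRiemannianManifold (𝓡 n) X]
    [MeasurableSpace X] [BorelSpace X]
    (μ : Measure X) (hμ : FlatTrace.IsSmoothDensity (n := n) μ)
    (V : (x : X) → TangentSpace (𝓡 n) x) (φ : ℝ → X → X)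
    (hφ : FlatTrace.IsSmoothFlow V φ) (hA : FlatTrace.IsAnosov V φ)
    (ψ : ℝ → ℝ) (hψ : ContDiff ℝ ∞ ψ) (hψc : HasCompactSupport ψ)
    (hψI : ∀ s, ψ s ∈ Icc (0 : ℝ) 1) (hψ1 : ∀ᶠ s in 𝓝 (0 : ℝ), ψ s = 1) :
    -- the mollifiers and the pullbacks by the flow are bounded operators on `L²(X, μ)`
    ∃ (E Φ : ℝ → Lp ℂ 2 μ →L[ℂ] Lp ℂ 2 μ),
      (∀ ε ∈ Ioc (0 : ℝ) 1,
        FlatTrace.IsIntegralOperator μ (FlatTrace.mollifierKernel μ ψ ε) (E ε)) ∧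
      (∀ t, FlatTrace.IsPullback μ (φ t) (Φ t)) ∧
      ∀ t₀ > 0, ∃ C > 0, ∀ ε ∈ Ioc (0 : ℝ) 1,
        ∃ τ : ℝ → ℂ, (∀ t, FlatTrace.HasTrace (E ε ∘L Φ (-t) ∘L E ε) (τ t)) ∧
          ∀ T ≥ t₀,
            FlatTrace.traceNorm (E ε ∘L Φ (-T) ∘L E ε) ≤
              ENNReal.ofReal (C * Real.exp (C * T) * ε ^ (-(n : ℤ) - 2)) ∧
            IntervalIntegrable (fun t => ‖τ t‖) volume T (T + 1) ∧
            ∫ t in T..(T + 1), ‖τ t‖ ≤ C * Real.exp (C * T) := by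
  have : SecondCountableTopology X := EMetric.secondCountable_of_sigmaCompact X
  have : IsContinuousRiemannianBundle (EuclideanSpace ℝ (Fin n))
      (fun x : X => TangentSpace (𝓡 n) x) := by
    obtain ⟨g, hg, h⟩ := IsContMDiffRiemannianBundle.exists_contMDiff (IB := 𝓡 n) (n := ∞)
      (F := EuclideanSpace ℝ (Fin n)) (E := fun x : X => TangentSpace (𝓡 n) x)
    exact ⟨g, hg.continuous, h⟩
  exact hA.exists_trace_estimates μ hμ V φ hφ ψ hψ.continuous hψc hψI hψ1
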